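/- Let $\sigma_+>0$ and $\sigma_-<0$ be constants and put $\kappa_\sigma:=\sigma_- /\sigma_+$. For $\delta\in(0,1)$ consider the half-annulus $$\Omega^\delta:=\{(r\cos\theta,r\sin\theta)\mid \delta<r<1,\ 0<\theta<\pi\}$$ and its subdomains $\Omega^\delta_+$ (where $\pi/4<\theta<\pi$) and $\Omega^\delta_-$ (where $0<\theta<\pi/4$), and let $\sigma^\delta:=\sigma_\pm$ in $\Omega^\delta_\pm$. Let $H^1_0(\Omega^\delta)$ be the space of complex-valued $H^1$ functions on $\Omega^\delta$ that vanish on $\partial\Omega^\delta$, let $H^{-1}(\Omega^\delta)$ be the space of continuous antilinear forms on $H^1_0(\Omega^\delta)$, and let $A^\delta:H^1_0(\Omega^\delta)\to H^{-1}(\Omega^\delta)$ be the continuous linear operator given by $$\langle A^\delta u,v\rangle=\int_{\Omega^\delta}\sigma^\delta\,\nabla u\cdot\overline{\nabla v}\,d\mathbf{x},\qquad u,v\in H^1_0(\Omega^\delta).$$ (i) Suppose that $\kappa_\sigma\in(-1,-1/3)$, and for integers $n\ge 1$ set $$\delta^n:=\exp\left(-\frac{n\pi^2}{2\operatorname{acosh}\left(\frac{1-\kappa_\sigma}{2(1+\kappa_\sigma)}\right)}\right).$$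 Then $\delta^n\in(0,1)$ for all $n\ge1$, and $\delta^n\to0$ as $n\to\infty$. For every $\delta\in(0,1)$, the operator $A^\delta$ has a nontrivial kernel if and only if $\delta=\delta^n$ for some $n\ge1$, and $A^\delta$ is an isomorphism if and only if $\delta\ne\delta^n$ for all $n\ge1$. (ii) Suppose that $\kappa_\sigma\notin[-1,-1/3]$, that is, $\kappa_\sigma\in(-\infty,-1)\cup(-1/3,0)$. Then $A^\delta$ is injective for every $\delta\in(0,1)$. -/

import Mathlib

open MeasureTheory Set Filter Topology
open scoped ContDiff

noncomputable section

namespace HalfAnnulus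

/-! ### The spaces `H¹₀(Ω)` and `H⁻¹(Ω)` of a planar set -/

/-- Test functions `φ ∈ C_c^∞(Ω; ℂ)`. -/
structure IsTest (Ω : Set (ℝ × ℝ)) (φ : ℝ × ℝ → ℂ) : Prop where
  smooth : ContDiff ℝ ∞ φ
  compact : HasCompactSupport φ
  support : tsupport φ ⊆ Ω

/-- The classical gradient `(∂φ/∂x, ∂φ/∂y)`, with values in `ℂ²`. -/
def grad (φ : ℝ × ℝ → ℂ) (x : ℝ × ℝ) : EuclideanSpace ℂ (Fin 2) :=
  !₂[fderiv ℝ φ x (1, 0), fderiv ℝ φ x (0, 1)]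

/-- `L²(Ω; ℂ) × L²(Ω; ℂ²)` with its Hilbert norm `(‖u‖² + ‖p‖²)^(1/2)`. -/
abbrev Jets (Ω : Set (ℝ × ℝ)) : Type :=
  WithLp 2 (Lp ℂ 2 (volume.restrict Ω) × Lp (EuclideanSpace ℂ (Fin 2)) 2 (volume.restrict Ω))

/-- The pairs `(φ, ∇φ)`, where `φ` is a test function. -/
def testJets (Ω : Set (ℝ × ℝ)) : Submodule ℂ (Jets Ω) where
  carrier := {w | ∃ φ, IsTest Ω φ ∧ w.fst =ᵐ[volume.restrict Ω] φ ∧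
    w.snd =ᵐ[volume.restrict Ω] grad φ}
  zero_mem' := by
    refine ⟨0, ⟨contDiff_const, HasCompactSupport.zero, ?_⟩, Lp.coeFn_zero _ _ _, ?_⟩
    · simp [tsupport]
    · filter_upwards [Lp.coeFn_zero (EuclideanSpace ℂ (Fin 2)) 2 (volume.restrict Ω)] with x hx
      rw [WithLp.zero_snd, hx]
      ext i
      fin_cases i <;> simp [grad]
  add_mem' := by
    rintro u v ⟨φ, hφ, h1, h2⟩ ⟨ψ, hψ, h3, h4⟩
    refine ⟨φ + ψ, ⟨hφ.smooth.add hψ.smooth, hφ.compact.add hψ.compact, ?_⟩, ?_, ?_⟩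
    · exact (tsupport_add φ ψ).trans (union_subset hφ.support hψ.support)
    · rw [WithLp.add_fst]
      filter_upwards [Lp.coeFn_add u.fst v.fst, h1, h3] with x hx h h'
      rw [hx, Pi.add_apply, h, h', Pi.add_apply]
    · rw [WithLp.add_snd]
      filter_upwards [Lp.coeFn_add u.snd v.snd, h2, h4] with x hx h h'
      rw [hx, Pi.add_apply, h, h']
      have e := fderiv_add (hφ.smooth.differentiable (by simp) x)
        (hψ.smooth.differentiable (by simp) x)
      ext i
      fin_cases i <;> simp [grad, e]
  smul_mem' := by
    rintro c u ⟨φ, hφ, h1, h2⟩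
    refine ⟨c • φ, ⟨hφ.smooth.const_smul c, hφ.compact.smul_left (f := fun _ => c), ?_⟩, ?_, ?_⟩
    · exact (tsupport_smul_subset_right (fun _ => c) φ).trans hφ.support
    · rw [WithLp.smul_fst]
      filter_upwards [Lp.coeFn_smul c u.fst, h1] with x hx h
      simp [hx, h]
    · rw [WithLp.smul_snd]
      filter_upwards [Lp.coeFn_smul c u.snd, h2] with x hx h
      rw [hx, Pi.smul_apply, h]
      have e := fderiv_const_smul (hφ.smooth.differentiable (by simp) x) c
      ext i
      fin_cases i <;> simp [grad, e]

/-- `H¹₀(Ω)`, the closure of `C_c^∞(Ω; ℂ)` in the `H¹`-norm; an element `u` is stored as the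
pair of `u` (`u.1.fst`) and its weak gradient (`u.1.snd`). -/
abbrev H10 (Ω : Set (ℝ × ℝ)) : Type := (testJets Ω).topologicalClosure

/-- The weak gradient of an element of `H¹₀(Ω)`. -/
def wgrad {Ω : Set (ℝ × ℝ)} (u : H10 Ω) :
    Lp (EuclideanSpace ℂ (Fin 2)) 2 (volume.restrict Ω) := u.1.snd

/-- `H⁻¹(Ω)`, the space of continuous antilinear forms on `H¹₀(Ω)`. -/
abbrev HNeg1 (Ω : Set (ℝ × ℝ)) : Type := H10 Ω →L⋆[ℂ] ℂ

/-! ### The geometry -/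

/-- `{(r cos θ, r sin θ) | δ < r < 1, α < θ < β}` -/
def sector (δ α β : ℝ) : Set (ℝ × ℝ) :=
  (fun p : ℝ × ℝ => (p.1 * Real.cos p.2, p.1 * Real.sin p.2)) '' (Ioo δ 1 ×ˢ Ioo α β)

/-- `Ω^δ` -/
def dom (δ : ℝ) : Set (ℝ × ℝ) := sector δ 0 Real.pi

/-- `Ω₊^δ` -/
def domPos (δ : ℝ) : Set (ℝ × ℝ) := sector δ (Real.pi / 4) Real.pi

/-- `Ω₋^δ` -/
def domNeg (δ : ℝ) : Set (ℝ × ℝ) := sector δ 0 (Real.pi / 4)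

/-- The coefficient `σ^δ`, equal to `σ₊` in `Ω₊^δ` and to `σ₋` in `Ω₋^δ`. -/
def coeff (δ σp σm : ℝ) (x : ℝ × ℝ) : ℝ :=
  (domPos δ).indicator (fun _ => σp) x + (domNeg δ).indicator (fun _ => σm) x

theorem measurableSet_sector (δ α β : ℝ) : MeasurableSet (sector δ α β) := by
  have ho : IsOpen (Ioo δ 1 ×ˢ Ioo α β) := isOpen_Ioo.prod isOpen_Ioo
  have : LocallyCompactSpace ↥(Ioo δ 1 ×ˢ Ioo α β) := ho.locallyCompactSpace
  have hs : IsSigmaCompact (Ioo δ 1 ×ˢ Ioo α β) :=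
    isSigmaCompact_iff_sigmaCompactSpace.mpr inferInstance
  obtain ⟨K, hK, hU⟩ := hs.image
    (f := fun p : ℝ × ℝ => (p.1 * Real.cos p.2, p.1 * Real.sin p.2)) (by fun_prop)
  rw [sector, ← hU]
  exact MeasurableSet.iUnion fun n => (hK n).measurableSet

theorem measurable_coeff (δ σp σm : ℝ) : Measurable (coeff δ σp σm) :=
  (measurable_const.indicator (measurableSet_sector _ _ _)).add
    (measurable_const.indicator (measurableSet_sector _ _ _))

theorem abs_coeff_le (δ σp σm : ℝ) (x : ℝ × ℝ) : |coeff δ σp σm x| ≤ |σp| + |σm| := by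
  refine (abs_add_le _ _).trans (add_le_add ?_ ?_)
  · exact norm_indicator_le_norm_self (fun _ => σp) x
  · exact norm_indicator_le_norm_self (fun _ => σm) x

/-! ### The operator -/

/-- `(σ^δ ∇u, ∇v) = ∫_{Ω^δ} σ^δ ∇u · conj(∇v)`; the inner product `inner ℂ p q` of `ℂ²` is
antilinear in `p`. -/
def form (δ σp σm : ℝ) (u v : H10 (dom δ)) : ℂ :=
  ∫ x in dom δ, (coeff δ σp σm x : ℂ) * inner ℂ (wgrad v x) (wgrad u x)

theorem integrable_form (δ σp σm : ℝ) (u v : H10 (dom δ)) :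
    Integrable (fun x => (coeff δ σp σm x : ℂ) * inner ℂ (wgrad v x) (wgrad u x))
      (volume.restrict (dom δ)) := by
  refine (L2.integrable_inner (𝕜 := ℂ) (wgrad v) (wgrad u)).bdd_mul (c := |σp| + |σm|) ?_ ?_
  · exact (Complex.measurable_ofReal.comp (measurable_coeff δ σp σm)).aestronglyMeasurable
  · refine Eventually.of_forall fun x => ?_
    rw [Complex.norm_real]
    exact abs_coeff_le δ σp σm x

theorem norm_form_le (δ σp σm : ℝ) (u v : H10 (dom δ)) :
    ‖form δ σp σm u v‖ ≤ (|σp| + |σm|) * ‖u‖ * ‖v‖ := by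
  have hm : MemLp (fun x => (coeff δ σp σm x : ℂ) • wgrad u x) 2 (volume.restrict (dom δ)) := by
    refine MemLp.of_le_mul (c := |σp| + |σm|) (Lp.memLp (wgrad u)) ?_ ?_
    · exact (Complex.measurable_ofReal.comp
        (measurable_coeff δ σp σm)).aestronglyMeasurable.smul (Lp.aestronglyMeasurable _)
    · refine Eventually.of_forall fun x => ?_
      rw [norm_smul, Complex.norm_real]
      exact mul_le_mul_of_nonneg_right (abs_coeff_le δ σp σm x) (norm_nonneg _)
  have he : form δ σp σm u v = inner ℂ (wgrad v) (hm.toLp _) := by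
    rw [L2.inner_def, form]
    refine integral_congr_ae ?_
    filter_upwards [hm.coeFn_toLp] with x hx
    rw [hx, inner_smul_right]
  have hn : ‖hm.toLp _‖ ≤ (|σp| + |σm|) * ‖wgrad u‖ := by
    refine Lp.norm_le_mul_norm_of_ae_le_mul ?_
    filter_upwards [hm.coeFn_toLp] with x hx
    rw [hx, norm_smul, Complex.norm_real]
    exact mul_le_mul_of_nonneg_right (abs_coeff_le δ σp σm x) (norm_nonneg _)
  have hg : ∀ w : H10 (dom δ), ‖wgrad w‖ ≤ ‖w‖ := fun w => WithLp.norm_snd_le _ w.1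
  rw [he]
  calc ‖inner ℂ (wgrad v) (hm.toLp _)‖ ≤ ‖wgrad v‖ * ‖hm.toLp _‖ := norm_inner_le_norm _ _
    _ ≤ ‖v‖ * ((|σp| + |σm|) * ‖u‖) := by
        have := hg u
        have := hg v
        gcongr
        exact hn.trans (by gcongr)
    _ = _ := by ring

/-- The operator `A^δ : H¹₀(Ω^δ) → H⁻¹(Ω^δ)`, `⟨A^δ u, v⟩ = (σ^δ ∇u, ∇v)`. -/
def A (δ σp σm : ℝ) : H10 (dom δ) →L[ℂ] HNeg1 (dom δ) :=
  LinearMap.mkContinuous₂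
    (LinearMap.mk₂'ₛₗ (RingHom.id ℂ) (starRingEnd ℂ) (form δ σp σm)
      (by
        intro u u' v
        rw [form, form, form, ← integral_add (integrable_form ..) (integrable_form ..)]
        refine integral_congr_ae ?_
        filter_upwards [Lp.coeFn_add (wgrad u) (wgrad u')] with x hx
        change _ * inner ℂ _ ((wgrad u + wgrad u') x) = _
        rw [hx, Pi.add_apply, inner_add_right, mul_add])
      (by
        intro c u v
        rw [form, form, smul_eq_mul, ← integral_const_mul]
        refine integral_congr_ae ?_
        filter_upwards [Lp.coeFn_smul c (wgrad u)] with x hx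
        change _ * inner ℂ _ ((c • wgrad u) x) = _
        rw [hx, Pi.smul_apply, inner_smul_right, RingHom.id_apply]
        ring)
      (by
        intro u v v'
        rw [form, form, form, ← integral_add (integrable_form ..) (integrable_form ..)]
        refine integral_congr_ae ?_
        filter_upwards [Lp.coeFn_add (wgrad v) (wgrad v')] with x hx
        change _ * inner ℂ ((wgrad v + wgrad v') x) _ = _
        rw [hx, Pi.add_apply, inner_add_left, mul_add])
      (by
        intro c u v
        rw [form, form, smul_eq_mul, ← integral_const_mul]
        refine integral_congr_ae ?_
        filter_upwards [Lp.coeFn_smul c (wgrad v)] with x hx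
        change _ * inner ℂ ((c • wgrad v) x) _ = _
        rw [hx, Pi.smul_apply, inner_smul_left]
        ring))
    (|σp| + |σm|) (norm_form_le δ σp σm)

theorem A_apply (δ σp σm : ℝ) (u v : H10 (dom δ)) :
    A δ σp σm u v =
      ∫ x in dom δ, (coeff δ σp σm x : ℂ) * inner ℂ (wgrad v x) (wgrad u x) := rfl

/-- `δⁿ = exp(-nπ² / (2 acosh((1 - κ) / (2 (1 + κ)))))` -/
def critDelta (κ : ℝ) (n : ℕ) : ℝ :=
  Real.exp (-(n * Real.pi ^ 2 / (2 * Real.arcosh ((1 - κ) / (2 * (1 + κ))))))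

end HalfAnnulus

end

noncomputable section

namespace HalfAnnulus

/-! In the coordinates `s = log r` and `θ` the half-annulus becomes the rectangle `(log δ, 0) × (0,
π)`. The change of variables is conformal, so the form keeps its shape, and the coefficient depends
on `θ` alone. Expanding in `sin(μ_k s)` with `μ_k = kπ / |log δ|`, `k ≥ 1`, makes the form block
diagonal: up to the factor `|log δ| / 2`, block `k` is the angular form `σ₋ E_L + σ₊ E_R`, where `E`
is the energy `∫ |w'|² + μ_k² |w|²` over one side of `θ = π/4` (`form_of_isMode`).

On each side an angular profile splits, orthogonally for the energy, into a part vanishing at the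
interface and a multiple of the hyperbolic-sine lift of its interface value. The form is definite on
the vanishing parts, negative on the left and positive on the right. On the lift of the value `c` it
equals `|c|² (σ₋ μ coth(μπ/4) + σ₊ μ coth(3μπ/4))`. Choosing a sign for each of the three pieces
(`IsAngular.exists_flip`) gives a test function of the same gradient norm for which the form is
coercive, unless the last bracket vanishes. After division by the sum of the two lift energies the
bracket tends to `(σ₊ + σ₋)/2`, which is nonzero for `κ ≠ -1`, so the coercivity constant is uniform
in `k` (`exists_coercivity_const`).

The triple-angle formulas turn the vanishing of the bracket into `2 cosh(μπ/2) (σ₊ + σ₋) = σ₊ - σ₋`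
(`resonance_iff`). For `κ ∈ (-1, -1/3)` this says `δ = δᵏ`; for `κ` outside `[-1, -1/3]` it never
holds. Without a resonance, `A` is bounded below, and being Hermitian it is invertible. At a
resonance, `sin(μ_k s)` times the glued lift lies in the kernel.

Both directions need density of finite sums of modes in `H¹₀` (`dense_iSup_modeSpace`). This rests
on two facts: products of one-variable primitives vanishing at the ends lie in `H¹₀`
(`exists_H10_prod`), and an element gradient-orthogonal to every mode vanishes
(`eq_zero_of_orthogonal_modes`), by Green's formula and completeness of the sines. -/

/-! ### Logarithmic polar coordinates -/

/-- Logarithmic polar coordinates `(s, θ) ↦ (eˢ cos θ, eˢ sin θ)`. -/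
def logPolar (p : ℝ × ℝ) : ℝ × ℝ :=
  (Real.exp p.1 * Real.cos p.2, Real.exp p.1 * Real.sin p.2)

/-- The inverse of `logPolar`, given by the principal branch of the complex logarithm. -/
def logPolarInv (x : ℝ × ℝ) : ℝ × ℝ :=
  ((Complex.log (Complex.equivRealProdCLM.symm x)).re,
    (Complex.log (Complex.equivRealProdCLM.symm x)).im)

/-- The rectangle of logarithmic polar coordinates of the half-annulus. -/
def rect (δ : ℝ) : Set (ℝ × ℝ) := Ioo (Real.log δ) 0 ×ˢ Ioo 0 Real.pi

theorem isOpen_rect (δ : ℝ) : IsOpen (rect δ) := isOpen_Ioo.prod isOpen_Ioo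

theorem measurableSet_rect (δ : ℝ) : MeasurableSet (rect δ) := (isOpen_rect δ).measurableSet

theorem contDiff_logPolar : ContDiff ℝ ∞ logPolar := by
  unfold logPolar
  fun_prop

theorem equivRealProdCLM_symm_logPolar (p : ℝ × ℝ) :
    Complex.equivRealProdCLM.symm (logPolar p) = Complex.exp (p.1 + p.2 * Complex.I) := by
  apply Complex.ext
  · simp [logPolar, Complex.exp_re]
  · simp [logPolar, Complex.exp_im]

theorem logPolarInv_logPolar {p : ℝ × ℝ} (h₁ : -Real.pi < p.2) (h₂ : p.2 ≤ Real.pi) :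
    logPolarInv (logPolar p) = p := by
  rw [logPolarInv, equivRealProdCLM_symm_logPolar, Complex.log_exp (by simpa) (by simpa)]
  ext <;> simp

theorem logPolar_logPolarInv {x : ℝ × ℝ} (hx : x ≠ 0) : logPolar (logPolarInv x) = x := by
  apply Complex.equivRealProdCLM.symm.injective
  rw [equivRealProdCLM_symm_logPolar, logPolarInv, Complex.re_add_im, Complex.exp_log]
  simpa using hx

theorem measurable_logPolarInv : Measurable logPolarInv := by
  have h : Measurable fun x : ℝ × ℝ => Complex.log (Complex.equivRealProdCLM.symm x) :=
    Complex.measurable_log.comp Complex.equivRealProdCLM.symm.continuous.measurable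
  exact (Complex.measurable_re.comp h).prodMk (Complex.measurable_im.comp h)

theorem injOn_logPolar (δ : ℝ) : InjOn logPolar (rect δ) := by
  intro p hp q hq h
  have hpi := Real.pi_pos
  rw [← logPolarInv_logPolar (p := p) (by linarith [hp.2.1]) hp.2.2.le, h,
    logPolarInv_logPolar (by linarith [hq.2.1]) hq.2.2.le]

theorem logPolar_mem_sector {δ α β : ℝ} (hδ : 0 < δ) (hα : 0 ≤ α) (hβ : β ≤ Real.pi) {p : ℝ × ℝ}
    (hp : p ∈ rect δ) : logPolar p ∈ sector δ α β ↔ p.2 ∈ Ioo α β := by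
  have hpi := Real.pi_pos
  constructor
  · rintro ⟨⟨r, θ⟩, ⟨hr, hθ⟩, h⟩
    have hr0 : 0 < r := hδ.trans hr.1
    have h' : logPolar (Real.log r, θ) = logPolar p := by
      rw [← h, logPolar, Real.exp_log hr0]
    have hθ' : θ ∈ Ioo α β := hθ
    have : p = (Real.log r, θ) := by
      rw [← logPolarInv_logPolar (p := p) (by linarith [hp.2.1]) hp.2.2.le, ← h',
        logPolarInv_logPolar (by simp only; linarith [hθ'.1]) (hθ'.2.le.trans hβ)]
    rw [this]
    exact hθ'
  · intro h
    refine ⟨(Real.exp p.1, p.2), ⟨⟨?_, ?_⟩, h⟩, rfl⟩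
    · exact (Real.log_lt_iff_lt_exp hδ).1 hp.1.1
    · exact Real.exp_lt_one_iff.2 hp.1.2

theorem image_logPolar {δ : ℝ} (hδ : 0 < δ) : logPolar '' rect δ = dom δ := by
  apply Subset.antisymm
  · rintro _ ⟨p, hp, rfl⟩
    exact (logPolar_mem_sector hδ le_rfl le_rfl hp).2 hp.2
  · rintro _ ⟨⟨r, θ⟩, ⟨hr, hθ⟩, rfl⟩
    have hr0 : 0 < r := hδ.trans hr.1
    refine ⟨(Real.log r, θ), ⟨⟨Real.log_lt_log hδ hr.1, Real.log_neg hr0 hr.2⟩, hθ⟩, ?_⟩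
    rw [logPolar, Real.exp_log hr0]

theorem logPolarInv_mem_rect {δ : ℝ} (hδ : 0 < δ) {x : ℝ × ℝ} (hx : x ∈ dom δ) :
    logPolarInv x ∈ rect δ := by
  rw [← image_logPolar hδ] at hx
  obtain ⟨p, hp, rfl⟩ := hx
  rwa [logPolarInv_logPolar (by linarith [hp.2.1, Real.pi_pos]) hp.2.2.le]

theorem snd_pos_of_mem_dom {δ : ℝ} (hδ : 0 < δ) {x : ℝ × ℝ} (hx : x ∈ dom δ) : 0 < x.2 := by
  obtain ⟨⟨r, θ⟩, ⟨hr, hθ⟩, rfl⟩ := hx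
  exact mul_pos (hδ.trans hr.1) (Real.sin_pos_of_pos_of_lt_pi hθ.1 hθ.2)

theorem contDiffAt_logPolarInv {x : ℝ × ℝ} (hx : 0 < x.2) : ContDiffAt ℝ ∞ logPolarInv x := by
  have h : ContDiffAt ℝ ∞ (fun x : ℝ × ℝ => Complex.log (Complex.equivRealProdCLM.symm x)) x := by
    have h1 : Complex.equivRealProdCLM.symm x ∈ Complex.slitPlane :=
      Or.inr (by simpa using hx.ne')
    have h2 : ContDiffAt ℝ ∞ Complex.log (Complex.equivRealProdCLM.symm x) :=
      (Complex.contDiffAt_log h1).restrict_scalars ℝ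
    exact h2.comp x Complex.equivRealProdCLM.symm.contDiff.contDiffAt
  exact (Complex.reCLM.contDiff.contDiffAt.comp x h).prodMk
    (Complex.imCLM.contDiff.contDiffAt.comp x h)

theorem isOpen_dom {δ : ℝ} (hδ : 0 < δ) : IsOpen (dom δ) := by
  -- The condition `0 < x.2` restricts to a region where the principal logarithm is continuous.
  have : dom δ = {x | 0 < x.2} ∩ logPolarInv ⁻¹' (rect δ) := by
    ext x
    refine ⟨fun hx => ⟨snd_pos_of_mem_dom hδ hx, logPolarInv_mem_rect hδ hx⟩, fun hx => ?_⟩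
    rw [← image_logPolar hδ]
    refine ⟨_, hx.2, logPolar_logPolarInv ?_⟩
    rintro rfl
    exact lt_irrefl (0 : ℝ) hx.1
  rw [this]
  refine ContinuousOn.isOpen_inter_preimage ?_ (isOpen_lt continuous_const continuous_snd)
    (isOpen_rect δ)
  exact fun x hx => (contDiffAt_logPolarInv hx).continuousAt.continuousWithinAt

theorem measurableSet_dom (δ : ℝ) : MeasurableSet (dom δ) := measurableSet_sector _ _ _

theorem volume_dom_lt_top (δ : ℝ) (hδ : 0 < δ) : volume (dom δ) < ⊤ := by
  have : dom δ ⊆ Icc (-1) 1 ×ˢ Icc (-1) 1 := by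
    rintro _ ⟨⟨r, θ⟩, ⟨hr, hθ⟩, rfl⟩
    have h0 : 0 < r := hδ.trans hr.1
    have h1 : r < 1 := hr.2
    have := Real.neg_one_le_cos θ
    have := Real.cos_le_one θ
    have := Real.neg_one_le_sin θ
    have := Real.sin_le_one θ
    refine ⟨⟨?_, ?_⟩, ⟨?_, ?_⟩⟩ <;> simp only <;> nlinarith
  exact (measure_mono this).trans_lt (isCompact_Icc.prod isCompact_Icc).measure_lt_top

/-- The derivative of `logPolar`. -/
def logPolarDeriv (p : ℝ × ℝ) : ℝ × ℝ →L[ℝ] ℝ × ℝ :=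
  LinearMap.toContinuousLinearMap (Matrix.toLin (Module.Basis.finTwoProd ℝ) (Module.Basis.finTwoProd ℝ)
    !![Real.exp p.1 * Real.cos p.2, -(Real.exp p.1 * Real.sin p.2);
      Real.exp p.1 * Real.sin p.2, Real.exp p.1 * Real.cos p.2])

theorem logPolarDeriv_apply (p v : ℝ × ℝ) : logPolarDeriv p v =
    (Real.exp p.1 * Real.cos p.2 * v.1 - Real.exp p.1 * Real.sin p.2 * v.2,
      Real.exp p.1 * Real.sin p.2 * v.1 + Real.exp p.1 * Real.cos p.2 * v.2) := by
  rw [logPolarDeriv, LinearMap.coe_toContinuousLinearMap', Matrix.toLin_finTwoProd_apply]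
  ext
  · simp
    ring
  · simp

theorem hasFDerivAt_logPolar (p : ℝ × ℝ) : HasFDerivAt logPolar (logPolarDeriv p) p := by
  have h1 : HasFDerivAt (fun p : ℝ × ℝ => Real.exp p.1)
      (Real.exp p.1 • ContinuousLinearMap.fst ℝ ℝ ℝ) p := hasFDerivAt_fst.exp
  have h2 : HasFDerivAt (fun p : ℝ × ℝ => Real.cos p.2)
      (-Real.sin p.2 • ContinuousLinearMap.snd ℝ ℝ ℝ) p := hasFDerivAt_snd.cos
  have h3 : HasFDerivAt (fun p : ℝ × ℝ => Real.sin p.2)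
      (Real.cos p.2 • ContinuousLinearMap.snd ℝ ℝ ℝ) p := hasFDerivAt_snd.sin
  refine ((h1.mul h2).prodMk (h1.mul h3)).congr_fderiv ?_
  ext <;> simp [logPolarDeriv_apply, mul_comm]

theorem det_logPolarDeriv (p : ℝ × ℝ) : (logPolarDeriv p).det = Real.exp p.1 ^ 2 := by
  rw [logPolarDeriv, LinearMap.det_toContinuousLinearMap, LinearMap.det_toLin, Matrix.det_fin_two_of]
  linear_combination Real.exp p.1 ^ 2 * Real.sin_sq_add_cos_sq p.2

theorem integral_dom {E : Type*} [NormedAddCommGroup E] [NormedSpace ℝ E] {δ : ℝ} (hδ : 0 < δ)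
    (F : ℝ × ℝ → E) :
    ∫ x in dom δ, F x = ∫ p in rect δ, Real.exp p.1 ^ 2 • F (logPolar p) := by
  rw [← image_logPolar hδ, integral_image_eq_integral_abs_det_fderiv_smul volume
    (measurableSet_rect δ) (fun p _ => (hasFDerivAt_logPolar p).hasFDerivWithinAt)
    (injOn_logPolar δ)]
  refine integral_congr_ae (Eventually.of_forall fun p => ?_)
  simp only
  rw [det_logPolarDeriv, abs_of_nonneg (by positivity)]

/-- The Jacobian `e^{2s}` never vanishes, so the area formula applied to the indicator of a null set
shows that its preimage is null. -/
theorem ae_rect_of_ae_dom {δ : ℝ} (hδ : 0 < δ) {P : ℝ × ℝ → Prop}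
    (h : ∀ᵐ x ∂volume.restrict (dom δ), P x) :
    ∀ᵐ p ∂volume.restrict (rect δ), P (logPolar p) := by
  obtain ⟨N, hN, hNm, hN0⟩ := exists_measurable_superset_of_null (ae_iff.1 h)
  have key := lintegral_image_eq_lintegral_abs_det_fderiv_mul volume
    (measurableSet_rect δ) (fun p _ => (hasFDerivAt_logPolar p).hasFDerivWithinAt)
    (injOn_logPolar δ) (N.indicator fun _ => 1)
  rw [image_logPolar hδ, lintegral_indicator hNm, setLIntegral_one, hN0] at key
  have hm : Measurable fun p : ℝ × ℝ => ENNReal.ofReal |(logPolarDeriv p).det| *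
      N.indicator (fun _ => (1 : ENNReal)) (logPolar p) := by
    simp_rw [det_logPolarDeriv]
    refine Measurable.mul (by fun_prop) ?_
    exact (measurable_const.indicator hNm).comp contDiff_logPolar.continuous.measurable
  have := (lintegral_eq_zero_iff hm).1 key.symm
  filter_upwards [this] with p hp
  by_contra hP
  have hmem : logPolar p ∈ N := hN hP
  simp [hmem, det_logPolarDeriv, (Real.exp_pos p.1).ne'] at hp

/-- Differentiable maps between spaces of equal dimension send null sets to null sets. -/
theorem ae_dom_of_ae_rect {δ : ℝ} (hδ : 0 < δ) {P : ℝ × ℝ → Prop}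
    (h : ∀ᵐ p ∂volume.restrict (rect δ), P (logPolar p)) :
    ∀ᵐ x ∂volume.restrict (dom δ), P x := by
  rw [ae_restrict_iff' (measurableSet_rect δ)] at h
  rw [ae_restrict_iff' (measurableSet_dom δ)]
  have h0 : volume (rect δ ∩ {p | ¬ P (logPolar p)}) = 0 := by
    refine measure_mono_null ?_ (ae_iff.1 h)
    rintro p ⟨hp, hP⟩ H
    exact hP (H hp)
  have := addHaar_image_eq_zero_of_differentiableOn_of_addHaar_eq_zero (f := logPolar) volume
    (fun p _ => (hasFDerivAt_logPolar p).differentiableAt.differentiableWithinAt) h0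
  refine measure_mono_null ?_ this
  intro x hx
  simp only [mem_compl_iff, mem_ofPred_eq, Classical.not_imp] at hx
  obtain ⟨hx, hP⟩ := hx
  rw [← image_logPolar hδ] at hx
  obtain ⟨p, hp, rfl⟩ := hx
  exact ⟨p, ⟨hp, hP⟩, rfl⟩

/-- The ray `θ = π/4` belongs to neither open sector, so the coefficient takes the value `0` there.
The ray is a null set (`ae_rect_snd_ne`), so integrals do not see it. -/
theorem coeff_logPolar {δ : ℝ} (hδ : 0 < δ) (σp σm : ℝ) {p : ℝ × ℝ} (hp : p ∈ rect δ)
    (h : p.2 ≠ Real.pi / 4) :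
    coeff δ σp σm (logPolar p) = if p.2 < Real.pi / 4 then σm else σp := by
  have hpi := Real.pi_pos
  have h1 := logPolar_mem_sector (α := Real.pi / 4) (β := Real.pi) hδ (by positivity) le_rfl hp
  have h2 := logPolar_mem_sector (α := 0) (β := Real.pi / 4) hδ le_rfl (by linarith) hp
  rw [coeff, domPos, domNeg]
  split_ifs with hlt
  · rw [indicator_of_notMem (by rw [h1]; exact fun h => absurd h.1 (by linarith)),
      indicator_of_mem (h2.2 ⟨hp.2.1, hlt⟩), zero_add]
  · have hgt := lt_of_le_of_ne (not_lt.1 hlt) h.symm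
    rw [indicator_of_mem (h1.2 ⟨hgt, hp.2.2⟩),
      indicator_of_notMem (by rw [h2]; exact fun h => absurd h.2 (by linarith)), add_zero]

/-! ### Jets in logarithmic polar coordinates -/

/-- The vector with coordinates `a`, `b` in the orthonormal frame `(e_r, e_θ)` at the angle `θ`. -/
def rot (θ : ℝ) (a b : ℂ) : EuclideanSpace ℂ (Fin 2) :=
  !₂[Real.cos θ * a - Real.sin θ * b, Real.sin θ * a + Real.cos θ * b]

theorem inner_rot (θ : ℝ) (a b c d : ℂ) :
    inner ℂ (rot θ a b) (rot θ c d) = c * starRingEnd ℂ a + d * starRingEnd ℂ b := by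
  have h : ((Real.sin θ : ℂ)) ^ 2 + (Real.cos θ : ℂ) ^ 2 = 1 := by
    exact_mod_cast Real.sin_sq_add_cos_sq θ
  simp only [rot, PiLp.inner_apply, Fin.sum_univ_two, RCLike.inner_apply, Matrix.cons_val_zero,
    Matrix.cons_val_one, map_sub, map_add, map_mul, Complex.conj_ofReal]
  linear_combination (c * starRingEnd ℂ a + d * starRingEnd ℂ b) * h

theorem rot_add (θ : ℝ) (a b c d : ℂ) : rot θ (a + c) (b + d) = rot θ a b + rot θ c d := by
  ext i
  fin_cases i <;> simp [rot] <;> ring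

theorem rot_smul (θ : ℝ) (k a b : ℂ) : rot θ (k * a) (k * b) = k • rot θ a b := by
  ext i
  fin_cases i <;> simp [rot] <;> ring

theorem rot_zero (θ : ℝ) : rot θ 0 0 = 0 := by
  ext i
  fin_cases i <;> simp [rot]

theorem norm_rot_sq (θ : ℝ) (a b : ℂ) : ‖rot θ a b‖ ^ 2 = ‖a‖ ^ 2 + ‖b‖ ^ 2 := by
  have h := inner_self_eq_norm_sq_to_K (𝕜 := ℂ) (rot θ a b)
  rw [inner_rot, Complex.mul_conj, Complex.mul_conj, Complex.normSq_eq_norm_sq,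
    Complex.normSq_eq_norm_sq] at h
  apply Complex.ofReal_injective
  push_cast at h ⊢
  exact h.symm

/-- In logarithmic polar coordinates, the jet `w` has the value `U` and the derivatives `P` with
respect to `s` and `Q` with respect to `θ`. -/
def HasRep {δ : ℝ} (w : Jets (dom δ)) (U P Q : ℝ × ℝ → ℂ) : Prop :=
  ∀ᵐ p ∂volume.restrict (rect δ), w.fst (logPolar p) = U p ∧
    (Real.exp p.1 : ℂ) • w.snd (logPolar p) = rot p.2 (P p) (Q p)

theorem HasRep.congr {δ : ℝ} {w : Jets (dom δ)} {U P Q U' P' Q' : ℝ × ℝ → ℂ}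
    (h : HasRep w U P Q) (hU : ∀ p ∈ rect δ, U p = U' p) (hP : ∀ p ∈ rect δ, P p = P' p)
    (hQ : ∀ p ∈ rect δ, Q p = Q' p) : HasRep w U' P' Q' := by
  filter_upwards [h, ae_restrict_mem (measurableSet_rect δ)] with p hp hm
  rwa [← hU p hm, ← hP p hm, ← hQ p hm]

theorem HasRep.add {δ : ℝ} (hδ : 0 < δ) {w w' : Jets (dom δ)} {U P Q U' P' Q' : ℝ × ℝ → ℂ}
    (h : HasRep w U P Q) (h' : HasRep w' U' P' Q') :
    HasRep (w + w') (U + U') (P + P') (Q + Q') := by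
  filter_upwards [h, h', ae_rect_of_ae_dom hδ (Lp.coeFn_add w.fst w'.fst),
    ae_rect_of_ae_dom hδ (Lp.coeFn_add w.snd w'.snd)] with p hp hp' h1 h2
  rw [WithLp.add_fst, WithLp.add_snd, h1, h2]
  simp only [Pi.add_apply, smul_add, hp.1, hp'.1, hp.2, hp'.2, rot_add, and_self]

theorem HasRep.smul {δ : ℝ} (hδ : 0 < δ) {w : Jets (dom δ)} {U P Q : ℝ × ℝ → ℂ} (c : ℂ)
    (h : HasRep w U P Q) : HasRep (c • w) (c • U) (c • P) (c • Q) := by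
  filter_upwards [h, ae_rect_of_ae_dom hδ (Lp.coeFn_smul c w.fst),
    ae_rect_of_ae_dom hδ (Lp.coeFn_smul c w.snd)] with p hp h1 h2
  rw [WithLp.smul_fst, WithLp.smul_snd, h1, h2]
  simp only [Pi.smul_apply, smul_eq_mul, hp.1, smul_comm _ c, hp.2, rot_smul, and_self]

theorem HasRep.sub {δ : ℝ} (hδ : 0 < δ) {w w' : Jets (dom δ)} {U P Q U' P' Q' : ℝ × ℝ → ℂ}
    (h : HasRep w U P Q) (h' : HasRep w' U' P' Q') :
    HasRep (w - w') (U - U') (P - P') (Q - Q') := by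
  have := h.add hδ (h'.smul hδ (-1))
  simp only [neg_smul, one_smul, ← sub_eq_add_neg] at this
  exact this

theorem HasRep.zero {δ : ℝ} (hδ : 0 < δ) : HasRep (0 : Jets (dom δ)) 0 0 0 := by
  filter_upwards [ae_rect_of_ae_dom hδ (Lp.coeFn_zero ℂ 2 (volume.restrict (dom δ))),
    ae_rect_of_ae_dom hδ
      (Lp.coeFn_zero (EuclideanSpace ℂ (Fin 2)) 2 (volume.restrict (dom δ)))] with p h1 h2
  rw [WithLp.zero_fst, WithLp.zero_snd, h1, h2]
  simp [rot_zero]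

theorem HasRep.inner_snd {δ : ℝ} {w w' : Jets (dom δ)} {U P Q U' P' Q' : ℝ × ℝ → ℂ}
    (h : HasRep w U P Q) (h' : HasRep w' U' P' Q') :
    ∀ᵐ p ∂volume.restrict (rect δ),
      (Real.exp p.1 : ℂ) ^ 2 * inner ℂ (w'.snd (logPolar p)) (w.snd (logPolar p)) =
        P p * starRingEnd ℂ (P' p) + Q p * starRingEnd ℂ (Q' p) := by
  filter_upwards [h, h'] with p hp hp'
  rw [← inner_rot p.2, ← hp.2, ← hp'.2, inner_smul_left, inner_smul_right, Complex.conj_ofReal]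
  ring

/-- Conformal invariance of the Dirichlet integral: the Jacobian `e^{2s}` cancels the factor
`e^{-s}` carried by each gradient. The function components have no such factor, hence the weight in
`HasRep.inner_fst`. -/
theorem HasRep.inner_eq {δ : ℝ} (hδ : 0 < δ) {w w' : Jets (dom δ)} {U P Q U' P' Q' : ℝ × ℝ → ℂ}
    (h : HasRep w U P Q) (h' : HasRep w' U' P' Q') :
    inner ℂ w'.snd w.snd =
      ∫ p in rect δ, (P p * starRingEnd ℂ (P' p) + Q p * starRingEnd ℂ (Q' p)) := by
  rw [L2.inner_def, integral_dom hδ]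
  refine integral_congr_ae ?_
  filter_upwards [h.inner_snd h'] with p hp
  rw [← hp, Complex.real_smul]
  push_cast
  rfl

theorem HasRep.inner_fst {δ : ℝ} (hδ : 0 < δ) {w w' : Jets (dom δ)} {U P Q U' P' Q' : ℝ × ℝ → ℂ}
    (h : HasRep w U P Q) (h' : HasRep w' U' P' Q') :
    inner ℂ w'.fst w.fst =
      ∫ p in rect δ, (Real.exp p.1 : ℂ) ^ 2 * (U p * starRingEnd ℂ (U' p)) := by
  rw [L2.inner_def, integral_dom hδ]
  refine integral_congr_ae ?_
  filter_upwards [h, h'] with p hp hp'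
  rw [← hp.1, ← hp'.1, Complex.real_smul, RCLike.inner_apply]
  push_cast
  rfl

theorem ae_rect_snd_ne (δ c : ℝ) : ∀ᵐ p ∂volume.restrict (rect δ), p.2 ≠ c := by
  refine ae_restrict_of_ae ?_
  have : (volume : Measure ℝ) {c} = 0 := measure_singleton c
  exact (Measure.quasiMeasurePreserving_snd (μ := (volume : Measure ℝ))
    (ν := (volume : Measure ℝ))).ae (compl_mem_ae_iff.2 this)

theorem HasRep.form_eq {δ : ℝ} (hδ : 0 < δ) (σp σm : ℝ) {u v : H10 (dom δ)}
    {U P Q U' P' Q' : ℝ × ℝ → ℂ} (h : HasRep u.1 U P Q) (h' : HasRep v.1 U' P' Q') :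
    form δ σp σm u v = ∫ p in rect δ, ((if p.2 < Real.pi / 4 then σm else σp : ℝ) : ℂ) *
      (P p * starRingEnd ℂ (P' p) + Q p * starRingEnd ℂ (Q' p)) := by
  rw [form, integral_dom hδ]
  refine integral_congr_ae ?_
  filter_upwards [h.inner_snd h', ae_rect_snd_ne δ (Real.pi / 4),
    ae_restrict_mem (measurableSet_rect δ)] with p hp hne hmem
  rw [← hp, coeff_logPolar hδ σp σm hmem hne, Complex.real_smul, wgrad, wgrad]
  push_cast
  ring

/-- On the rectangle `s < 0`, so the weight `e^{2s}` on the function component is at most `1` and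
can be dropped. -/
theorem HasRep.norm_sq_le {δ : ℝ} (hδ : 0 < δ) {w : Jets (dom δ)} {U P Q : ℝ × ℝ → ℂ}
    (h : HasRep w U P Q) {G : ℝ × ℝ → ℝ} (hG : IntegrableOn G (rect δ))
    (hle : ∀ p ∈ rect δ, ‖U p‖ ^ 2 + (‖P p‖ ^ 2 + ‖Q p‖ ^ 2) ≤ G p) :
    ‖w‖ ^ 2 ≤ ∫ p in rect δ, G p := by
  have e1 : ‖w.fst‖ ^ 2 = ∫ x in dom δ, ‖w.fst x‖ ^ 2 := by
    have := inner_self_eq_norm_sq_to_K (𝕜 := ℂ) w.fst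
    rw [L2.inner_def] at this
    simp_rw [inner_self_eq_norm_sq_to_K] at this
    have h2 := integral_ofReal (𝕜 := ℂ) (f := fun x => ‖w.fst x‖ ^ 2) (μ := volume.restrict (dom δ))
    push_cast at h2
    exact_mod_cast (h2.symm.trans this).symm
  have e2 : ‖w.snd‖ ^ 2 = ∫ x in dom δ, ‖w.snd x‖ ^ 2 := by
    have := inner_self_eq_norm_sq_to_K (𝕜 := ℂ) w.snd
    rw [L2.inner_def] at this
    simp_rw [inner_self_eq_norm_sq_to_K] at this
    have h2 := integral_ofReal (𝕜 := ℂ) (f := fun x => ‖w.snd x‖ ^ 2) (μ := volume.restrict (dom δ))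
    push_cast at h2
    exact_mod_cast (h2.symm.trans this).symm
  rw [WithLp.prod_norm_sq_eq_of_L2, e1, e2, ← integral_add, integral_dom hδ]
  · refine integral_mono_of_nonneg (Eventually.of_forall fun p => ?_) hG ?_
    · simp only [Pi.zero_apply, smul_eq_mul]
      positivity
    · filter_upwards [h, ae_restrict_mem (measurableSet_rect δ)] with p hp hm
      refine le_trans ?_ (hle p hm)
      have h1 : Real.exp p.1 ≤ 1 := (Real.exp_lt_one_iff.2 hm.1.2).le
      have h2 := congrArg (fun x => ‖x‖ ^ 2) hp.2
      simp only [norm_smul, norm_rot_sq, Complex.norm_real, Real.norm_eq_abs, Real.abs_exp] at h2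
      rw [← h2, hp.1, smul_eq_mul, mul_add, mul_pow]
      gcongr
      exact mul_le_of_le_one_left (by positivity) (pow_le_one₀ (Real.exp_pos _).le h1)
  · exact (Lp.memLp w.fst).integrable_norm_pow two_ne_zero
  · exact (Lp.memLp w.snd).integrable_norm_pow two_ne_zero

/-- The three functions need not be related: the jet is only an element of `L² × L²`. Boundedness
suffices because the domain has finite measure and the factor `e^{-s}` is at most `1/δ`. -/
theorem exists_hasRep_of_bounded {δ : ℝ} (hδ : 0 < δ) {U P Q : ℝ × ℝ → ℂ} (hU : Measurable U)
    (hP : Measurable P) (hQ : Measurable Q) {C : ℝ} (bU : ∀ p ∈ rect δ, ‖U p‖ ≤ C)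
    (bP : ∀ p ∈ rect δ, ‖P p‖ ≤ C) (bQ : ∀ p ∈ rect δ, ‖Q p‖ ≤ C) :
    ∃ w : Jets (dom δ), HasRep w U P Q := by
  have : IsFiniteMeasure ((volume : Measure (ℝ × ℝ)).restrict (dom δ)) :=
    ⟨by rw [Measure.restrict_apply_univ]; exact volume_dom_lt_top δ hδ⟩
  have hL := measurable_logPolarInv
  have m1 : MemLp (fun x => U (logPolarInv x)) 2 (volume.restrict (dom δ)) := by
    refine MemLp.of_bound (hU.comp hL).aestronglyMeasurable C ?_
    filter_upwards [ae_restrict_mem (measurableSet_dom δ)] with x hx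
    exact bU _ (logPolarInv_mem_rect hδ hx)
  have m2 : MemLp (fun x => (Real.exp (-(logPolarInv x).1) : ℂ) •
      rot (logPolarInv x).2 (P (logPolarInv x)) (Q (logPolarInv x))) 2
      (volume.restrict (dom δ)) := by
    refine MemLp.of_bound (C := Real.exp (-Real.log δ) * (2 * C)) ?_ ?_
    · refine Measurable.aestronglyMeasurable ?_
      have h2 : Measurable fun x => (logPolarInv x).2 := hL.snd
      have hPm := hP.comp hL
      have hQm := hQ.comp hL
      refine Measurable.smul (f := fun x => (Real.exp (-(logPolarInv x).1) : ℂ))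
        (Complex.measurable_ofReal.comp (Real.measurable_exp.comp hL.fst.neg)) ?_
      refine (PiLp.continuous_toLp 2 _).measurable.comp (measurable_pi_lambda _ fun i => ?_)
      fin_cases i
      · exact ((Complex.measurable_ofReal.comp (Real.measurable_cos.comp h2)).mul hPm).sub
          ((Complex.measurable_ofReal.comp (Real.measurable_sin.comp h2)).mul hQm)
      · exact ((Complex.measurable_ofReal.comp (Real.measurable_sin.comp h2)).mul hPm).add
          ((Complex.measurable_ofReal.comp (Real.measurable_cos.comp h2)).mul hQm)
    · filter_upwards [ae_restrict_mem (measurableSet_dom δ)] with x hx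
      have hm := logPolarInv_mem_rect hδ hx
      have b1 := bP _ hm
      have b2 := bQ _ hm
      have h0 : 0 ≤ C := (norm_nonneg _).trans b1
      rw [norm_smul, Complex.norm_real, Real.norm_eq_abs, Real.abs_exp]
      refine mul_le_mul (Real.exp_le_exp.2 (neg_le_neg hm.1.1.le)) ?_ (norm_nonneg _)
        (Real.exp_pos _).le
      refine abs_le_of_sq_le_sq' ?_ (by positivity) |>.2
      rw [norm_rot_sq]
      nlinarith [norm_nonneg (P (logPolarInv x)), norm_nonneg (Q (logPolarInv x))]
  refine ⟨WithLp.toLp 2 (m1.toLp, m2.toLp), ?_⟩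
  filter_upwards [ae_rect_of_ae_dom hδ m1.coeFn_toLp, ae_rect_of_ae_dom hδ m2.coeFn_toLp,
    ae_restrict_mem (measurableSet_rect δ)] with p h1 h2 hp
  have hinv : logPolarInv (logPolar p) = p :=
    logPolarInv_logPolar (by linarith [hp.2.1, Real.pi_pos]) hp.2.2.le
  refine ⟨?_, ?_⟩
  · change (m1.toLp) (logPolar p) = _
    rw [h1, hinv]
  · change _ • (m2.toLp) (logPolar p) = _
    rw [h2, hinv, smul_smul, ← Complex.ofReal_mul, ← Real.exp_add, add_neg_cancel, Real.exp_zero,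
      Complex.ofReal_one, one_smul]

/-! ### Test functions in logarithmic polar coordinates -/

/-- Chain rule: the `s` and `θ` derivatives are `e^s` times the components of the gradient along
`e_r` and `e_θ`. -/
theorem hasRep_of_isTest {δ : ℝ} (hδ : 0 < δ) {w : Jets (dom δ)} {φ : ℝ × ℝ → ℂ}
    (hφ : ContDiff ℝ ∞ φ) (h1 : w.fst =ᵐ[volume.restrict (dom δ)] φ)
    (h2 : w.snd =ᵐ[volume.restrict (dom δ)] grad φ) :
    HasRep w (φ ∘ logPolar) (fun p => fderiv ℝ (φ ∘ logPolar) p (1, 0))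
      (fun p => fderiv ℝ (φ ∘ logPolar) p (0, 1)) := by
  filter_upwards [ae_rect_of_ae_dom hδ h1, ae_rect_of_ae_dom hδ h2] with p h1 h2
  refine ⟨h1, ?_⟩
  have hd : HasFDerivAt (φ ∘ logPolar) ((fderiv ℝ φ (logPolar p)).comp (logPolarDeriv p)) p :=
    ((hφ.differentiable (by simp) _).hasFDerivAt).comp p (hasFDerivAt_logPolar p)
  have hlin : ∀ a b : ℝ, fderiv ℝ φ (logPolar p) (a, b) =
      a * fderiv ℝ φ (logPolar p) (1, 0) + b * fderiv ℝ φ (logPolar p) (0, 1) := by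
    intro a b
    have : ((a, b) : ℝ × ℝ) = a • (1, 0) + b • (0, 1) := by simp
    rw [this, map_add, map_smul, map_smul, Complex.real_smul, Complex.real_smul]
  have h : ((Real.sin p.2 : ℂ)) ^ 2 + (Real.cos p.2 : ℂ) ^ 2 = 1 := by
    exact_mod_cast Real.sin_sq_add_cos_sq p.2
  rw [h2, hd.fderiv]
  simp only [ContinuousLinearMap.comp_apply, logPolarDeriv_apply, mul_one, mul_zero, sub_zero,
    add_zero, zero_sub, zero_add]
  rw [hlin (Real.exp p.1 * Real.cos p.2), hlin (-(Real.exp p.1 * Real.sin p.2))]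
  ext i
  fin_cases i
  · simp only [rot, grad, PiLp.smul_apply, smul_eq_mul, Fin.zero_eta, Matrix.cons_val_zero]
    push_cast at h ⊢
    linear_combination -(Complex.exp p.1 * fderiv ℝ φ (logPolar p) (1, 0)) * h
  · simp only [rot, grad, PiLp.smul_apply, smul_eq_mul, Fin.mk_one, Matrix.cons_val_one]
    push_cast at h ⊢
    linear_combination -(Complex.exp p.1 * fderiv ℝ φ (logPolar p) (0, 1)) * h

theorem continuous_grad {φ : ℝ × ℝ → ℂ} (hφ : ContDiff ℝ ∞ φ) : Continuous (grad φ) := by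
  have h : Continuous (fderiv ℝ φ) := hφ.continuous_fderiv (by simp)
  refine (PiLp.continuous_toLp 2 _).comp (continuous_pi fun i => ?_)
  fin_cases i
  · exact h.clm_apply continuous_const
  · exact h.clm_apply continuous_const

theorem hasCompactSupport_grad {φ : ℝ × ℝ → ℂ} (hφ : HasCompactSupport φ) :
    HasCompactSupport (grad φ) := by
  refine (hφ.fderiv (𝕜 := ℝ)).mono' ?_
  intro x hx
  refine subset_tsupport _ fun h0 => hx ?_
  ext i
  fin_cases i <;> simp [grad, h0]

theorem exists_testJet {δ : ℝ} {φ : ℝ × ℝ → ℂ} (hφ : IsTest (dom δ) φ) :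
    ∃ w ∈ testJets (dom δ), w.fst =ᵐ[volume.restrict (dom δ)] φ ∧
      w.snd =ᵐ[volume.restrict (dom δ)] grad φ := by
  have m1 : MemLp φ 2 (volume.restrict (dom δ)) :=
    hφ.smooth.continuous.memLp_of_hasCompactSupport hφ.compact
  have m2 : MemLp (grad φ) 2 (volume.restrict (dom δ)) :=
    (continuous_grad hφ.smooth).memLp_of_hasCompactSupport (hasCompactSupport_grad hφ.compact)
  exact ⟨WithLp.toLp 2 (m1.toLp, m2.toLp), ⟨φ, hφ, m1.coeFn_toLp, m2.coeFn_toLp⟩,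
    m1.coeFn_toLp, m2.coeFn_toLp⟩

theorem isTest_comp_logPolarInv {δ : ℝ} (hδ : 0 < δ) {ψ : ℝ × ℝ → ℂ} (hψ : IsTest (rect δ) ψ) :
    IsTest (dom δ) (ψ ∘ logPolarInv) := by
  have hK : IsCompact (logPolar '' tsupport ψ) :=
    hψ.compact.isCompact.image contDiff_logPolar.continuous
  -- With the convention `log 0 = 0`, the origin is sent to a point outside the rectangle, since its
  -- first coordinate is not negative. The composition therefore vanishes at the origin.
  have h0 : logPolarInv 0 = 0 := by simp [logPolarInv]
  have hsub : Function.support (ψ ∘ logPolarInv) ⊆ logPolar '' tsupport ψ := by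
    intro x hx
    have hx' : logPolarInv x ∈ tsupport ψ := subset_tsupport _ hx
    refine ⟨_, hx', logPolar_logPolarInv ?_⟩
    rintro rfl
    rw [h0] at hx'
    exact lt_irrefl (0 : ℝ) (hψ.support hx').1.2
  have hts : tsupport (ψ ∘ logPolarInv) ⊆ logPolar '' tsupport ψ :=
    closure_minimal hsub hK.isClosed
  have hd : tsupport (ψ ∘ logPolarInv) ⊆ dom δ := by
    rw [← image_logPolar hδ]
    exact hts.trans (image_mono hψ.support)
  refine ⟨contDiff_iff_contDiffAt.2 fun x => ?_,
    HasCompactSupport.of_support_subset_isCompact hK hsub, hd⟩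
  by_cases hx : x ∈ tsupport (ψ ∘ logPolarInv)
  · exact hψ.smooth.contDiffAt.comp x (contDiffAt_logPolarInv (snd_pos_of_mem_dom hδ (hd hx)))
  · exact contDiffAt_const.congr_of_eventuallyEq (notMem_tsupport_iff_eventuallyEq.1 hx)

theorem exists_testJet_hasRep {δ : ℝ} (hδ : 0 < δ) {ψ : ℝ × ℝ → ℂ} (hψ : IsTest (rect δ) ψ) :
    ∃ w ∈ testJets (dom δ), HasRep w ψ (fun p => fderiv ℝ ψ p (1, 0))
      (fun p => fderiv ℝ ψ p (0, 1)) := by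
  have ht := isTest_comp_logPolarInv hδ hψ
  obtain ⟨w, hw, h1, h2⟩ := exists_testJet ht
  refine ⟨w, hw, ?_⟩
  have he : ∀ p ∈ rect δ, (ψ ∘ logPolarInv) ∘ logPolar =ᶠ[𝓝 p] ψ := by
    intro p hp
    filter_upwards [(isOpen_rect δ).mem_nhds hp] with q hq
    simp only [Function.comp_apply]
    rw [logPolarInv_logPolar (by linarith [hq.2.1, Real.pi_pos]) hq.2.2.le]
  refine (hasRep_of_isTest hδ ht.smooth h1 h2).congr (fun p hp => (he p hp).eq_of_nhds)
    (fun p hp => ?_) (fun p hp => ?_)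
  · rw [(he p hp).fderiv_eq]
  · rw [(he p hp).fderiv_eq]

/-! ### Smooth approximation on an interval -/

theorem exists_primitive_of_integral_eq_zero {a b : ℝ} (hab : a < b) {ζ : ℝ → ℂ}
    (hζ : ContDiff ℝ ∞ ζ) (hc : HasCompactSupport ζ) (hs : tsupport ζ ⊆ Ioo a b)
    (h0 : ∫ t in a..b, ζ t = 0) :
    ∃ ψ : ℝ → ℂ, ContDiff ℝ ∞ ψ ∧ HasCompactSupport ψ ∧ tsupport ψ ⊆ Ioo a b ∧ deriv ψ = ζ := by
  have hd : ∀ x, HasDerivAt (fun x => ∫ t in a..x, ζ t) (ζ x) x := fun x =>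
    intervalIntegral.integral_hasDerivAt_right (hζ.continuous.intervalIntegrable _ _)
      (hζ.continuous.stronglyMeasurableAtFilter _ _) hζ.continuous.continuousAt
  have hderiv : deriv (fun x => ∫ t in a..x, ζ t) = ζ := funext fun x => (hd x).deriv
  -- The midpoint only makes the compact set nonempty, so that it has a least and a greatest element
  -- when `ζ = 0`.
  have hK : IsCompact (tsupport ζ ∪ {(a + b) / 2}) := hc.isCompact.union isCompact_singleton
  have hKs : tsupport ζ ∪ {(a + b) / 2} ⊆ Ioo a b := by
    refine union_subset hs (singleton_subset_iff.2 ⟨?_, ?_⟩) <;> linarith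
  obtain ⟨a', ha', hal⟩ := hK.exists_isLeast ⟨_, Or.inr rfl⟩
  obtain ⟨b', hb', hbg⟩ := hK.exists_isGreatest ⟨_, Or.inr rfl⟩
  have hz1 : ∀ t < a', ζ t = 0 := fun t ht =>
    image_eq_zero_of_notMem_tsupport fun h => absurd (hal (Or.inl h)) (not_le.2 ht)
  have hz2 : ∀ t > b', ζ t = 0 := fun t ht =>
    image_eq_zero_of_notMem_tsupport fun h => absurd (hbg (Or.inl h)) (not_le.2 ht)
  have hsub : Function.support (fun x => ∫ t in a..x, ζ t) ⊆ Icc a' b' := by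
    intro x hx
    by_contra hx'
    apply hx
    rw [mem_Icc, not_and_or, not_le, not_le] at hx'
    rcases hx' with h | h
    · refine intervalIntegral.integral_zero_ae (Eventually.of_forall fun t ht => hz1 t ?_)
      rcases mem_uIoc.1 ht with ht | ht
      · exact ht.2.trans_lt h
      · exact ht.2.trans_lt (hKs ha').1
    · have h1 : ∫ t in x..b, ζ t = 0 := by
        refine intervalIntegral.integral_zero_ae (Eventually.of_forall fun t ht => hz2 t ?_)
        rcases mem_uIoc.1 ht with ht | ht
        · exact h.trans ht.1
        · exact (hKs hb').2.trans ht.1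
      have h2 := intervalIntegral.integral_add_adjacent_intervals
        (μ := volume) (hζ.continuous.intervalIntegrable a x)
        (hζ.continuous.intervalIntegrable x b)
      rw [h1, h0, add_zero] at h2
      exact h2
  refine ⟨fun x => ∫ t in a..x, ζ t, ?_, ?_, ?_, hderiv⟩
  · rw [contDiff_infty_iff_deriv, hderiv]
    exact ⟨fun x => (hd x).differentiableAt, hζ⟩
  · exact HasCompactSupport.of_support_subset_isCompact isCompact_Icc hsub
  · exact (closure_minimal hsub isClosed_Icc).trans (Icc_subset_Ioo (hKs ha').1 (hKs hb').2)

/-- The derivatives of test functions on an interval, as a subspace of `L²`. -/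
def testDerivs (a b : ℝ) : Submodule ℂ (Lp ℂ 2 (volume.restrict (Ioo a b))) where
  carrier := {w | ∃ ψ : ℝ → ℂ, ContDiff ℝ ∞ ψ ∧ HasCompactSupport ψ ∧ tsupport ψ ⊆ Ioo a b ∧
    w =ᵐ[volume.restrict (Ioo a b)] deriv ψ}
  zero_mem' := by
    refine ⟨0, contDiff_const, HasCompactSupport.zero, by simp [tsupport], ?_⟩
    simpa using Lp.coeFn_zero ℂ 2 (volume.restrict (Ioo a b))
  add_mem' := by
    rintro u v ⟨φ, h1, h2, h3, h4⟩ ⟨ψ, k1, k2, k3, k4⟩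
    refine ⟨φ + ψ, h1.add k1, h2.add k2, (tsupport_add φ ψ).trans (union_subset h3 k3), ?_⟩
    filter_upwards [Lp.coeFn_add u v, h4, k4] with x hx h h'
    rw [hx, Pi.add_apply, h, h', deriv_add (h1.differentiable (by simp) x)
      (k1.differentiable (by simp) x)]
  smul_mem' := by
    rintro c u ⟨φ, h1, h2, h3, h4⟩
    refine ⟨c • φ, h1.const_smul c, h2.smul_left (f := fun _ => c),
      (tsupport_smul_subset_right (fun _ => c) φ).trans h3, ?_⟩
    filter_upwards [Lp.coeFn_smul c u, h4] with x hx h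
    rw [hx, Pi.smul_apply, h, deriv_const_smul _ (h1.differentiable (by simp) x)]

theorem memLp_of_continuous_Ioo {a b : ℝ} {f : ℝ → ℂ} (hf : Continuous f) :
    MemLp f 2 (volume.restrict (Ioo a b)) := by
  obtain ⟨C, hC⟩ := isCompact_Icc.exists_bound_of_continuousOn (s := Icc a b) hf.continuousOn
  refine MemLp.of_bound hf.aestronglyMeasurable C ?_
  filter_upwards [ae_restrict_mem measurableSet_Ioo] with x hx
  exact hC x (Ioo_subset_Icc_self hx)

/-- Du Bois-Reymond's argument. For a bump `β` of mass one and any test function `ζ`, the difference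
`ζ - (∫ ζ) β` has mean zero and so is the derivative of a test function. Orthogonality then gives `∫
ζ h = (∫ ζ)(∫ β h)`. -/
theorem ae_eq_const_of_mem_testDerivs_orthogonal {a b : ℝ} (hab : a < b)
    {h : Lp ℂ 2 (volume.restrict (Ioo a b))} (hh : h ∈ (testDerivs a b)ᗮ) :
    ∃ c : ℂ, h =ᵐ[volume.restrict (Ioo a b)] fun _ => c := by
  have hi : Integrable h (volume.restrict (Ioo a b)) :=
    (Lp.memLp h).integrable (by norm_num)
  let β : ContDiffBump ((a + b) / 2) := ⟨(b - a) / 8, (b - a) / 4, by linarith, by linarith⟩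
  have hβs : tsupport (β.normed volume) ⊆ Ioo a b := by
    rw [β.tsupport_normed_eq, Real.closedBall_eq_Icc]
    refine Icc_subset_Ioo ?_ ?_ <;> simp only [β] <;> linarith
  have hβi : ∫ x, β.normed volume x = 1 := β.integral_normed
  refine ⟨∫ x in Ioo a b, β.normed volume x • h x, ?_⟩
  set c := ∫ x in Ioo a b, β.normed volume x • h x with hc
  have key := isOpen_Ioo.ae_eq_zero_of_integral_contDiff_smul_eq_zero (U := Ioo a b)
    (μ := volume.restrict (Ioo a b)) (f := fun x => h x - c)
    ((hi.sub (integrable_const c)).locallyIntegrable.locallyIntegrableOn _) ?_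
  · filter_upwards [key, ae_restrict_mem measurableSet_Ioo] with x hx hm
    exact sub_eq_zero.1 (hx hm)
  intro ζ hζ hζc hζs
  have hint : ∀ f : ℝ → ℝ, tsupport f ⊆ Ioo a b → ∫ x in a..b, f x = ∫ x, f x := by
    intro f hf
    rw [intervalIntegral.integral_of_le hab.le, integral_Ioc_eq_integral_Ioo]
    refine setIntegral_eq_integral_of_forall_compl_eq_zero fun x hx => ?_
    exact image_eq_zero_of_notMem_tsupport fun hx' => hx (hf hx')
  set I := ∫ x, ζ x with hI
  set η : ℝ → ℝ := fun x => ζ x - I * β.normed volume x with hη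
  have hηsmooth : ContDiff ℝ ∞ η := hζ.sub (contDiff_const.mul β.contDiff_normed)
  have hηs : Function.support η ⊆ tsupport ζ ∪ tsupport (β.normed volume) := by
    intro x hx
    by_contra hx'
    rw [mem_union, not_or] at hx'
    apply hx
    simp only [hη]
    rw [image_eq_zero_of_notMem_tsupport hx'.1, image_eq_zero_of_notMem_tsupport hx'.2]
    simp
  have hηt : tsupport η ⊆ tsupport ζ ∪ tsupport (β.normed volume) :=
    closure_minimal hηs ((isClosed_tsupport _).union (isClosed_tsupport _))
  have hηc : HasCompactSupport η := HasCompactSupport.of_support_subset_isCompact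
    (hζc.isCompact.union β.hasCompactSupport_normed.isCompact) hηs
  have hη0 : ∫ x in a..b, η x = 0 := by
    rw [hint η (hηt.trans (union_subset hζs hβs)), hη, integral_sub, integral_const_mul, hβi,
      mul_one, sub_self]
    · exact hζ.continuous.integrable_of_hasCompactSupport hζc
    · exact (β.integrable_normed (μ := volume)).const_mul I
  have hsupp : Function.support (fun x => (η x : ℂ)) = Function.support η := by
    ext x
    simp
  obtain ⟨ψ, h1, h2, h3, h4⟩ := exists_primitive_of_integral_eq_zero hab
    (ζ := fun x => (η x : ℂ)) (Complex.ofRealCLM.contDiff.comp hηsmooth)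
    (by rw [HasCompactSupport, tsupport, hsupp]; exact hηc)
    (by rw [tsupport, hsupp]; exact hηt.trans (union_subset hζs hβs))
    (by rw [intervalIntegral.integral_ofReal, hη0, Complex.ofReal_zero])
  have hm : MemLp (deriv ψ) 2 (volume.restrict (Ioo a b)) :=
    memLp_of_continuous_Ioo (h1.continuous_deriv (by simp))
  have horth := (Submodule.mem_orthogonal _ _).1 hh (hm.toLp _) ⟨ψ, h1, h2, h3, hm.coeFn_toLp⟩
  rw [L2.inner_def] at horth
  have hζh : Integrable (fun x => ζ x • h x) (volume.restrict (Ioo a b)) := by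
    obtain ⟨C, hC⟩ := hζc.exists_bound_of_continuous hζ.continuous
    exact hi.bdd_smul C hζ.continuous.aestronglyMeasurable (Eventually.of_forall hC)
  have hβh : Integrable (fun x => β.normed volume x • h x) (volume.restrict (Ioo a b)) := by
    obtain ⟨C, hC⟩ := β.hasCompactSupport_normed.exists_bound_of_continuous
      (β.continuous_normed (μ := volume))
    exact hi.bdd_smul C (β.continuous_normed (μ := volume)).aestronglyMeasurable
      (Eventually.of_forall hC)
  have e1 : ∫ x in Ioo a b, inner ℂ (hm.toLp (deriv ψ) x) (h x) =
      ∫ x in Ioo a b, (ζ x • h x - I • (β.normed volume x • h x)) := by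
    refine integral_congr_ae ?_
    filter_upwards [hm.coeFn_toLp] with x hx
    rw [hx, h4, RCLike.inner_apply, Complex.conj_ofReal]
    simp only [hη, Complex.real_smul, Complex.ofReal_sub, Complex.ofReal_mul]
    ring
  rw [e1, integral_sub hζh (hβh.fun_smul I), integral_smul, ← hc, sub_eq_zero] at horth
  have e2 : ∫ x in Ioo a b, ζ x = I := by
    rw [hI, ← hint ζ hζs, intervalIntegral.integral_of_le hab.le, integral_Ioc_eq_integral_Ioo]
  have hζi : Integrable ζ (volume.restrict (Ioo a b)) :=
    (hζ.continuous.integrable_of_hasCompactSupport hζc).restrict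
  simp_rw [smul_sub]
  rw [integral_sub hζh (hζi.smul_const c), horth, integral_smul_const, e2, sub_self]

/-- `f` is, on `[a, b]`, the primitive of the bounded function `g`, and vanishes at both ends. -/
structure IsPrim (a b : ℝ) (f g : ℝ → ℂ) : Prop where
  cont : Continuous f
  meas : Measurable g
  bdd : ∃ C, ∀ x ∈ Icc a b, ‖g x‖ ≤ C
  eq_integral : ∀ x ∈ Icc a b, f x = ∫ t in a..x, g t
  right : f b = 0

theorem IsPrim.memLp {a b : ℝ} {f g : ℝ → ℂ} (h : IsPrim a b f g) :
    MemLp g 2 (volume.restrict (Ioo a b)) := by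
  obtain ⟨C, hC⟩ := h.bdd
  refine MemLp.of_bound h.meas.aestronglyMeasurable C ?_
  filter_upwards [ae_restrict_mem measurableSet_Ioo] with x hx
  exact hC x (Ioo_subset_Icc_self hx)

/-- Cauchy–Schwarz against the constant `1`, read off from the discriminant of the nonnegative
quadratic `t ↦ ∫ (f - t)²`. -/
theorem sq_integral_le {α : Type*} [MeasurableSpace α] {μ : Measure α} [IsFiniteMeasure μ]
    {f : α → ℝ} (h1 : Integrable f μ) (h2 : Integrable (fun x => f x ^ 2) μ) :
    (∫ x, f x ∂μ) ^ 2 ≤ μ.real univ * ∫ x, f x ^ 2 ∂μ := by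
  have h : ∀ t : ℝ, 0 ≤ μ.real univ * (t * t) + (-2 * ∫ x, f x ∂μ) * t + ∫ x, f x ^ 2 ∂μ := by
    intro t
    have h0 : 0 ≤ ∫ x, (f x - t) ^ 2 ∂μ := integral_nonneg fun x => sq_nonneg _
    have e : ∫ x, (f x - t) ^ 2 ∂μ = ∫ x, (f x ^ 2 - 2 * t * f x + t ^ 2) ∂μ := by
      congr 1
      ext x
      ring
    rw [e, integral_add (f := fun x => f x ^ 2 - 2 * t * f x) (h2.sub (h1.const_mul _))
        (integrable_const _),
      integral_sub h2 (h1.const_mul _), integral_const_mul, integral_const, smul_eq_mul] at h0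
    linarith
  have := discrim_le_zero h
  rw [discrim] at this
  linarith

/-- Since `f` vanishes at both ends, `g` has mean zero and is orthogonal to the constants. The
orthogonal complement of the derivatives of test functions consists of constants, so `g` lies in
their closure. Integrating from `a` turns `L²` closeness of derivatives into uniform closeness of
primitives. -/
theorem IsPrim.exists_approx {a b : ℝ} (hab : a < b) {f g : ℝ → ℂ} (h : IsPrim a b f g)
    {ε : ℝ} (hε : 0 < ε) :
    ∃ ψ : ℝ → ℂ, ContDiff ℝ ∞ ψ ∧ HasCompactSupport ψ ∧ tsupport ψ ⊆ Ioo a b ∧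
      ∫ x in Ioo a b, ‖deriv ψ x - g x‖ ^ 2 ≤ ε ∧ ∀ x ∈ Ioo a b, ‖ψ x - f x‖ ^ 2 ≤ ε := by
  have hmem : h.memLp.toLp g ∈ closure (testDerivs a b : Set _) := by
    rw [← Submodule.topologicalClosure_coe, SetLike.mem_coe,
      ← Submodule.orthogonal_orthogonal_eq_closure, Submodule.mem_orthogonal]
    intro w hw
    obtain ⟨c, hc⟩ := ae_eq_const_of_mem_testDerivs_orthogonal hab hw
    rw [L2.inner_def]
    have e : ∫ x in Ioo a b, inner ℂ (w x) (h.memLp.toLp g x) =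
        ∫ x in Ioo a b, g x * starRingEnd ℂ c := by
      refine integral_congr_ae ?_
      filter_upwards [hc, h.memLp.coeFn_toLp] with x hx hx'
      rw [hx, hx', RCLike.inner_apply]
    rw [e, integral_mul_const, ← integral_Ioc_eq_integral_Ioo,
      ← intervalIntegral.integral_of_le hab.le, ← h.eq_integral b (right_mem_Icc.2 hab.le),
      h.right, zero_mul]
  -- The denominator secures both `κ ≤ ε`, for the derivatives, and `(b - a) κ ≤ ε`, for the
  -- Cauchy–Schwarz bound on the primitives.
  set κ := ε / (1 + (b - a)) with hκ
  have hba : 0 < b - a := sub_pos.2 hab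
  have hκ0 : 0 < κ := by positivity
  have hκε : κ ≤ ε := div_le_self hε.le (by linarith)
  have hκε' : (b - a) * κ ≤ ε := by
    rw [hκ, ← mul_div_assoc, div_le_iff₀ (by linarith)]
    nlinarith
  obtain ⟨w, ⟨ψ, h1, h2, h3, h4⟩, hw⟩ := Metric.mem_closure_iff.1 hmem (√κ) (Real.sqrt_pos.2 hκ0)
  have hdm : MemLp (fun x => deriv ψ x - g x) 2 (volume.restrict (Ioo a b)) :=
    (memLp_of_continuous_Ioo (h1.continuous_deriv (by simp))).sub h.memLp
  have hsq : ∫ x in Ioo a b, ‖deriv ψ x - g x‖ ^ 2 ≤ κ := by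
    have e := inner_self_eq_norm_sq_to_K (𝕜 := ℂ) (w - h.memLp.toLp g)
    rw [L2.inner_def] at e
    simp_rw [inner_self_eq_norm_sq_to_K] at e
    have h2 := integral_ofReal (𝕜 := ℂ) (f := fun x => ‖(w - h.memLp.toLp g : Lp ℂ 2 _) x‖ ^ 2)
      (μ := volume.restrict (Ioo a b))
    push_cast at h2
    have e3 : ∫ x in Ioo a b, ‖(w - h.memLp.toLp g : Lp ℂ 2 _) x‖ ^ 2 =
        ‖w - h.memLp.toLp g‖ ^ 2 := by
      exact_mod_cast (h2.symm.trans e)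
    have e4 : ∫ x in Ioo a b, ‖(w - h.memLp.toLp g : Lp ℂ 2 _) x‖ ^ 2 =
        ∫ x in Ioo a b, ‖deriv ψ x - g x‖ ^ 2 := by
      refine integral_congr_ae ?_
      filter_upwards [h4, h.memLp.coeFn_toLp, Lp.coeFn_sub w (h.memLp.toLp g)] with x a1 a2 a3
      rw [a3, Pi.sub_apply, a1, a2]
    rw [← e4, e3]
    rw [dist_comm, dist_eq_norm] at hw
    calc _ ≤ √κ ^ 2 := by gcongr
      _ = κ := Real.sq_sqrt hκ0.le
  refine ⟨ψ, h1, h2, h3, hsq.trans hκε, fun x hx => ?_⟩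
  have hgi : IntegrableOn g (Ioo a b) := h.memLp.integrable (by norm_num)
  have hdc : Continuous (deriv ψ) := h1.continuous_deriv (by simp)
  have hgi' : IntervalIntegrable g volume a x := by
    rw [intervalIntegrable_iff_integrableOn_Ioo_of_le hx.1.le]
    exact hgi.mono_set (Ioo_subset_Ioo_right hx.2.le)
  have ha : ψ a = 0 := image_eq_zero_of_notMem_tsupport fun hm => lt_irrefl _ (h3 hm).1
  have e : ψ x - f x = ∫ t in a..x, (deriv ψ t - g t) := by
    rw [intervalIntegral.integral_sub (hdc.intervalIntegrable _ _) hgi',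
      ← h.eq_integral x (Ioo_subset_Icc_self hx),
      intervalIntegral.integral_deriv_eq_sub (fun t _ => h1.differentiable (by simp) t)
        (hdc.intervalIntegrable _ _), ha, sub_zero]
  have hdi : IntegrableOn (fun t => deriv ψ t - g t) (Ioo a b) := hdm.integrable (by norm_num)
  have hle : ‖ψ x - f x‖ ≤ ∫ t in Ioo a b, ‖deriv ψ t - g t‖ := by
    rw [e, intervalIntegral.integral_of_le hx.1.le, integral_Ioc_eq_integral_Ioo]
    refine (norm_integral_le_integral_norm _).trans ?_
    exact setIntegral_mono_set hdi.norm (Eventually.of_forall fun t => norm_nonneg _)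
      (Ioo_subset_Ioo_right hx.2.le).eventuallyLE
  calc ‖ψ x - f x‖ ^ 2 ≤ (∫ t in Ioo a b, ‖deriv ψ t - g t‖) ^ 2 := by gcongr
    _ ≤ (volume.restrict (Ioo a b)).real univ * ∫ t in Ioo a b, ‖deriv ψ t - g t‖ ^ 2 :=
        sq_integral_le hdi.norm (hdm.integrable_norm_pow two_ne_zero)
    _ ≤ (b - a) * κ := by
        rw [measureReal_restrict_apply_univ, Real.volume_real_Ioo_of_le hab.le]
        gcongr
    _ ≤ ε := hκε'

/-! ### Products of functions of `s` and `θ` -/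

theorem isTest_prod {δ : ℝ} {ψ₁ ψ₂ : ℝ → ℂ} (h₁ : ContDiff ℝ ∞ ψ₁) (h₂ : ContDiff ℝ ∞ ψ₂)
    (c₁ : HasCompactSupport ψ₁) (c₂ : HasCompactSupport ψ₂)
    (s₁ : tsupport ψ₁ ⊆ Ioo (Real.log δ) 0) (s₂ : tsupport ψ₂ ⊆ Ioo 0 Real.pi) :
    IsTest (rect δ) (fun p => ψ₁ p.1 * ψ₂ p.2) := by
  have hK : IsCompact (tsupport ψ₁ ×ˢ tsupport ψ₂) := c₁.isCompact.prod c₂.isCompact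
  have hsub : Function.support (fun p : ℝ × ℝ => ψ₁ p.1 * ψ₂ p.2) ⊆
      tsupport ψ₁ ×ˢ tsupport ψ₂ := fun p hp =>
    ⟨subset_tsupport _ (left_ne_zero_of_mul hp), subset_tsupport _ (right_ne_zero_of_mul hp)⟩
  exact ⟨(h₁.comp contDiff_fst).mul (h₂.comp contDiff_snd),
    HasCompactSupport.of_support_subset_isCompact hK hsub,
    (closure_minimal hsub hK.isClosed).trans (Set.prod_mono s₁ s₂)⟩

theorem fderiv_prod_apply {ψ₁ ψ₂ : ℝ → ℂ} (h₁ : Differentiable ℝ ψ₁) (h₂ : Differentiable ℝ ψ₂)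
    (p v : ℝ × ℝ) : fderiv ℝ (fun p : ℝ × ℝ => ψ₁ p.1 * ψ₂ p.2) p v =
      v.1 * (deriv ψ₁ p.1 * ψ₂ p.2) + v.2 * (ψ₁ p.1 * deriv ψ₂ p.2) := by
  have e₁ := (h₁ p.1).hasFDerivAt.comp p (hasFDerivAt_fst (𝕜 := ℝ) (E := ℝ) (F := ℝ))
  have e₂ := (h₂ p.2).hasFDerivAt.comp p (hasFDerivAt_snd (𝕜 := ℝ) (E := ℝ) (F := ℝ))
  have e : HasFDerivAt (fun p : ℝ × ℝ => ψ₁ p.1 * ψ₂ p.2) _ p := e₁.mul e₂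
  rw [e.fderiv]
  simp [fderiv_eq_smul_deriv]
  ring

theorem norm_mul_sub_mul_sq_le {x y a b : ℂ} {B η : ℝ} (hy : ‖y‖ ^ 2 ≤ B) (ha : ‖a‖ ^ 2 ≤ B)
    (h : ‖y - b‖ ^ 2 ≤ η) : ‖x * y - a * b‖ ^ 2 ≤ 2 * B * ‖x - a‖ ^ 2 + 2 * B * η := by
  have e : x * y - a * b = (x - a) * y + a * (y - b) := by ring
  have h1 : ‖x * y - a * b‖ ≤ ‖x - a‖ * ‖y‖ + ‖a‖ * ‖y - b‖ := by
    rw [e, ← norm_mul, ← norm_mul]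
    exact norm_add_le _ _
  calc ‖x * y - a * b‖ ^ 2 ≤ (‖x - a‖ * ‖y‖ + ‖a‖ * ‖y - b‖) ^ 2 := by gcongr
    _ ≤ 2 * (‖x - a‖ ^ 2 * ‖y‖ ^ 2) + 2 * (‖a‖ ^ 2 * ‖y - b‖ ^ 2) := by
        nlinarith [sq_nonneg (‖x - a‖ * ‖y‖ - ‖a‖ * ‖y - b‖)]
    _ ≤ 2 * (‖x - a‖ ^ 2 * B) + 2 * (B * η) := by
        have : 0 ≤ B := (sq_nonneg _).trans ha
        gcongr
    _ = _ := by ring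

theorem integrableOn_rect_prod {𝕜 : Type*} [RCLike 𝕜] {δ : ℝ} {F G : ℝ → 𝕜}
    (hF : IntegrableOn F (Ioo (Real.log δ) 0))
    (hG : IntegrableOn G (Ioo 0 Real.pi)) :
    IntegrableOn (fun p : ℝ × ℝ => F p.1 * G p.2) (rect δ) := by
  rw [IntegrableOn, rect, Measure.volume_eq_prod, ← Measure.prod_restrict]
  exact hF.mul_prod hG

theorem IsPrim.exists_bound {a b : ℝ} {f g : ℝ → ℂ} (h : IsPrim a b f g) :
    ∃ M, 0 ≤ M ∧ (∀ x ∈ Ioo a b, ‖f x‖ ≤ M) ∧ ∀ x ∈ Ioo a b, ‖g x‖ ≤ M := by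
  obtain ⟨C, hC⟩ := h.bdd
  obtain ⟨D, hD⟩ := isCompact_Icc.exists_bound_of_continuousOn (s := Icc a b) h.cont.continuousOn
  refine ⟨max 0 (max C D), le_max_left _ _, fun x hx => ?_, fun x hx => ?_⟩
  · exact (hD x (Ioo_subset_Icc_self hx)).trans ((le_max_right _ _).trans (le_max_right _ _))
  · exact (hC x (Ioo_subset_Icc_self hx)).trans ((le_max_left _ _).trans (le_max_right _ _))

/-- Supplies elements of `H¹₀` whose angular derivative may jump at the interface. Each factor is
approximated by test functions of one variable, and products of these are test functions on the
rectangle. -/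
theorem exists_H10_prod {δ : ℝ} (hδ : δ ∈ Ioo (0 : ℝ) 1) {f g h k : ℝ → ℂ}
    (hf : IsPrim (Real.log δ) 0 f g) (hh : IsPrim 0 Real.pi h k) :
    ∃ u : H10 (dom δ), HasRep u.1 (fun p => f p.1 * h p.2) (fun p => g p.1 * h p.2)
      (fun p => f p.1 * k p.2) := by
  have hlog : Real.log δ < 0 := Real.log_neg hδ.1 hδ.2
  have hpi := Real.pi_pos
  obtain ⟨M₁, hM₁, bf, bg⟩ := hf.exists_bound
  obtain ⟨M₂, hM₂, bh, bk⟩ := hh.exists_bound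
  have bound : ∀ {x y : ℂ}, ‖x‖ ≤ M₁ → ‖y‖ ≤ M₂ → ‖x * y‖ ≤ M₁ * M₂ := by
    intro x y hx hy
    rw [norm_mul]
    gcongr
  obtain ⟨J, hJ⟩ := exists_hasRep_of_bounded hδ.1 (U := fun p => f p.1 * h p.2)
    (P := fun p => g p.1 * h p.2) (Q := fun p => f p.1 * k p.2)
    ((hf.cont.measurable.comp measurable_fst).mul (hh.cont.measurable.comp measurable_snd))
    ((hf.meas.comp measurable_fst).mul (hh.cont.measurable.comp measurable_snd))
    ((hf.cont.measurable.comp measurable_fst).mul (hh.meas.comp measurable_snd))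
    (fun p hp => bound (bf _ hp.1) (bh _ hp.2)) (fun p hp => bound (bg _ hp.1) (bh _ hp.2))
    (fun p hp => bound (bf _ hp.1) (bk _ hp.2))
  suffices hmem : J ∈ (testJets (dom δ)).topologicalClosure from ⟨⟨J, hmem⟩, hJ⟩
  rw [← SetLike.mem_coe, Submodule.topologicalClosure_coe, Metric.mem_closure_iff]
  intro ε hε
  -- The summand `1` lets `B` bound the approximants too: `η ≤ 1` puts them within distance `1` of
  -- the exact factors.
  set B := (M₁ + M₂ + 1) ^ 2 with hB
  -- `T * η` is the integrated error. The first two terms come from the two derivative errors; the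
  -- constant `8 B η` collects `4 B η` from the function and `2 B η` from each partial derivative.
  set T := 2 * B * Real.pi + 2 * B * -Real.log δ + 8 * B * (Real.pi * -Real.log δ) with hT
  have hB0 : 0 < B := by positivity
  have hT0 : 0 < T := by
    have : 0 < -Real.log δ := by linarith
    positivity
  set η := min 1 (ε ^ 2 / (2 * T)) with hη
  have hη0 : 0 < η := lt_min one_pos (by positivity)
  have hη1 : η ≤ 1 := min_le_left _ _
  have hηT : T * η < ε ^ 2 := by
    have : η ≤ ε ^ 2 / (2 * T) := min_le_right _ _
    rw [le_div_iff₀ (by positivity)] at this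
    nlinarith [pow_pos hε 2]
  obtain ⟨ψ₁, s₁, c₁, t₁, i₁, n₁⟩ := hf.exists_approx hlog hη0
  obtain ⟨ψ₂, s₂, c₂, t₂, i₂, n₂⟩ := hh.exists_approx hpi hη0
  obtain ⟨w, hw, hrep⟩ := exists_testJet_hasRep hδ.1 (isTest_prod s₁ s₂ c₁ c₂ t₁ t₂)
  refine ⟨w, hw, ?_⟩
  have d₁ : Differentiable ℝ ψ₁ := s₁.differentiable (by simp)
  have d₂ : Differentiable ℝ ψ₂ := s₂.differentiable (by simp)
  simp only [fderiv_prod_apply d₁ d₂, Complex.ofReal_one, Complex.ofReal_zero, one_mul, zero_mul,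
    add_zero, zero_add] at hrep
  have hrep' := hrep.sub hδ.1 hJ
  have I₁ : IntegrableOn (fun x => ‖deriv ψ₁ x - g x‖ ^ 2) (Ioo (Real.log δ) 0) :=
    ((memLp_of_continuous_Ioo (s₁.continuous_deriv (by simp))).sub hf.memLp).integrable_norm_pow
      two_ne_zero
  have I₂ : IntegrableOn (fun x => ‖deriv ψ₂ x - k x‖ ^ 2) (Ioo 0 Real.pi) :=
    ((memLp_of_continuous_Ioo (s₂.continuous_deriv (by simp))).sub hh.memLp).integrable_norm_pow
      two_ne_zero
  have c1 : IntegrableOn (fun _ => (1 : ℝ)) (Ioo (Real.log δ) 0) := integrableOn_const (by simp)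
  have c2 : IntegrableOn (fun _ => (1 : ℝ)) (Ioo 0 Real.pi) := integrableOn_const (by simp)
  have J₁ := (integrableOn_rect_prod (δ := δ) I₁ c2).const_mul (2 * B)
  have J₂ := (integrableOn_rect_prod (δ := δ) c1 I₂).const_mul (2 * B)
  have J₃ := (integrableOn_rect_prod (δ := δ) c1 c2).const_mul (8 * B * η)
  have small : ∀ {x y : ℂ} {M : ℝ}, 0 ≤ M → M ≤ M₁ + M₂ → ‖y‖ ≤ M → ‖x - y‖ ^ 2 ≤ η →
      ‖x‖ ^ 2 ≤ B := by
    intro x y M hM hMM hy hxy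
    have h1 : ‖x - y‖ ≤ 1 := by
      have := norm_nonneg (x - y)
      nlinarith
    have h2 : ‖x‖ ≤ M₁ + M₂ + 1 := by
      have := norm_le_norm_sub_add x y
      linarith
    rw [hB]
    gcongr
  have small' : ∀ {y : ℂ} {M : ℝ}, M ≤ M₁ + M₂ → ‖y‖ ≤ M → ‖y‖ ^ 2 ≤ B := by
    intro y M hMM hy
    rw [hB]
    gcongr
    linarith
  have key := hrep'.norm_sq_le hδ.1 ((J₁.add J₂).add J₃) ?_
  · rw [dist_comm, dist_eq_norm]
    refine lt_of_pow_lt_pow_left₀ 2 hε.le (lt_of_le_of_lt key (lt_of_le_of_lt ?_ hηT))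
    have p₁ := setIntegral_prod_mul (μ := volume) (ν := volume) (L := ℝ)
      (fun x => ‖deriv ψ₁ x - g x‖ ^ 2) (fun _ => (1 : ℝ)) (Ioo (Real.log δ) 0) (Ioo 0 Real.pi)
    have p₂ := setIntegral_prod_mul (μ := volume) (ν := volume) (L := ℝ)
      (fun _ => (1 : ℝ)) (fun x => ‖deriv ψ₂ x - k x‖ ^ 2) (Ioo (Real.log δ) 0) (Ioo 0 Real.pi)
    have p₃ := setIntegral_prod_mul (μ := volume) (ν := volume) (L := ℝ)
      (fun _ => (1 : ℝ)) (fun _ => (1 : ℝ)) (Ioo (Real.log δ) 0) (Ioo 0 Real.pi)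
    rw [← Measure.volume_eq_prod] at p₁ p₂ p₃
    rw [integral_add' (J₁.add J₂) J₃, integral_add' J₁ J₂, integral_const_mul (2 * B),
      integral_const_mul (2 * B), integral_const_mul (8 * B * η), rect, p₁, p₂, p₃]
    simp only [setIntegral_const, Real.volume_real_Ioo_of_le hlog.le,
      Real.volume_real_Ioo_of_le hpi.le, smul_eq_mul, mul_one, sub_zero, zero_sub]
    have q₁ := mul_le_mul_of_nonneg_left i₁ (a := 2 * B * Real.pi) (by positivity)
    have q₂ := mul_le_mul_of_nonneg_left i₂ (a := 2 * B * -Real.log δ)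
      (mul_nonneg (by positivity) (by linarith))
    rw [hT]
    nlinarith
  · intro p hp
    simp only [Pi.sub_apply, Pi.add_apply, mul_one, one_mul]
    have a₁ := n₁ p.1 hp.1
    have a₂ := n₂ p.2 hp.2
    have u₁ := norm_mul_sub_mul_sq_le (x := ψ₁ p.1) (small hM₂ (by linarith) (bh _ hp.2) a₂)
      (small' (by linarith) (bf _ hp.1)) a₂
    have u₂ := norm_mul_sub_mul_sq_le (x := deriv ψ₁ p.1)
      (small hM₂ (by linarith) (bh _ hp.2) a₂) (small' (by linarith) (bg _ hp.1)) a₂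
    have u₃ := norm_mul_sub_mul_sq_le (x := deriv ψ₂ p.2)
      (small hM₁ (by linarith) (bf _ hp.1) a₁) (small' (by linarith) (bk _ hp.2)) a₁
    rw [mul_comm (deriv ψ₂ p.2), mul_comm (k p.2)] at u₃
    have u₄ := mul_le_mul_of_nonneg_left a₁ (a := 2 * B) (by positivity)
    linarith

/-! ### The Poincaré inequality and uniqueness of the weak gradient -/

/-- The plane carries the sup norm here, so each partial derivative contributes at most `‖grad φ
x‖`; this accounts for the factor `2`. -/
theorem norm_fderiv_le_norm_grad (φ : ℝ × ℝ → ℂ) (x : ℝ × ℝ) :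
    ‖fderiv ℝ φ x‖ ≤ 2 * ‖grad φ x‖ := by
  refine ContinuousLinearMap.opNorm_le_bound _ (by positivity) fun v => ?_
  have e : v = v.1 • ((1 : ℝ), (0 : ℝ)) + v.2 • ((0 : ℝ), (1 : ℝ)) := by simp
  have h0 : ‖fderiv ℝ φ x (1, 0)‖ ≤ ‖grad φ x‖ := PiLp.norm_apply_le (grad φ x) 0
  have h1 : ‖fderiv ℝ φ x (0, 1)‖ ≤ ‖grad φ x‖ := PiLp.norm_apply_le (grad φ x) 1
  have hv1 : ‖v.1‖ ≤ ‖v‖ := norm_fst_le v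
  have hv2 : ‖v.2‖ ≤ ‖v‖ := norm_snd_le v
  calc ‖fderiv ℝ φ x v‖ = ‖v.1 • fderiv ℝ φ x (1, 0) + v.2 • fderiv ℝ φ x (0, 1)‖ := by
        conv_lhs => rw [e]
        rw [map_add, map_smul, map_smul]
    _ ≤ ‖v.1‖ * ‖fderiv ℝ φ x (1, 0)‖ + ‖v.2‖ * ‖fderiv ℝ φ x (0, 1)‖ := by
        rw [← norm_smul, ← norm_smul]
        exact norm_add_le _ _
    _ ≤ ‖v‖ * ‖grad φ x‖ + ‖v‖ * ‖grad φ x‖ := by gcongr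
    _ = _ := by ring

/-- Poincaré inequality from the planar Gagliardo–Nirenberg–Sobolev estimate `‖φ‖₂ ≤ K ‖∇φ‖₁`,
followed by Hölder on a domain of finite measure. -/
theorem exists_norm_fst_le_of_testJet {δ : ℝ} (hδ : 0 < δ) :
    ∃ C : ℝ, ∀ w ∈ testJets (dom δ), ‖w.fst‖ ≤ C * ‖w.snd‖ := by
  have : IsFiniteMeasure ((volume : Measure (ℝ × ℝ)).restrict (dom δ)) :=
    ⟨by rw [Measure.restrict_apply_univ]; exact volume_dom_lt_top δ hδ⟩
  set μ := (volume : Measure (ℝ × ℝ)).restrict (dom δ) with hμ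
  set K : NNReal := eLpNormLESNormFDerivOneConst (volume : Measure (ℝ × ℝ)) (2 : NNReal) with hK
  set R : ENNReal := (K : ENNReal) * (2 * μ univ ^ (1 / (1 : ENNReal).toReal - 1 / (2 : ENNReal).toReal))
  have hR : R ≠ ⊤ := by
    refine ENNReal.mul_ne_top ENNReal.coe_ne_top (ENNReal.mul_ne_top (by simp) ?_)
    exact ENNReal.rpow_ne_top_of_nonneg (by norm_num) (measure_ne_top _ _)
  refine ⟨R.toReal, ?_⟩
  rintro w ⟨φ, hφ, h1, h2⟩
  have hp : NNReal.HolderConjugate (Module.finrank ℝ (ℝ × ℝ)) 2 := by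
    rw [NNReal.holderConjugate_iff]
    simp
    norm_num
  have gns := eLpNorm_le_eLpNorm_fderiv_one (volume : Measure (ℝ × ℝ))
    (hφ.smooth.of_le (by simp)) hφ.compact hp
  have hsupp : Function.support (fderiv ℝ φ) ⊆ dom δ :=
    ((subset_tsupport _).trans (tsupport_fderiv_subset ℝ)).trans hφ.support
  have main : eLpNorm φ 2 μ ≤ R * eLpNorm (grad φ) 2 μ := by
    calc eLpNorm φ 2 μ ≤ eLpNorm φ 2 volume := eLpNorm_restrict_le _ _ _ _
      _ ≤ K * eLpNorm (fderiv ℝ φ) 1 volume := gns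
      _ = K * eLpNorm (fderiv ℝ φ) 1 μ := by
          rw [hμ, eLpNorm_restrict_eq_of_support_subset (f := fderiv ℝ φ) (p := 1) hsupp]
      _ ≤ K * (2 * eLpNorm (grad φ) 1 μ) := by
          gcongr
          have := eLpNorm_le_mul_eLpNorm_of_ae_le_mul (p := 1) (μ := μ) (f := fderiv ℝ φ)
            (g := grad φ) (c := 2) (Eventually.of_forall (norm_fderiv_le_norm_grad φ))
          simpa using this
      _ ≤ K * (2 * (eLpNorm (grad φ) 2 μ *
            μ univ ^ (1 / (1 : ENNReal).toReal - 1 / (2 : ENNReal).toReal))) := by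
          gcongr
          exact eLpNorm_le_eLpNorm_mul_rpow_measure_univ (by norm_num)
            (continuous_grad hφ.smooth).aestronglyMeasurable
      _ = R * eLpNorm (grad φ) 2 μ := by
          simp only [R]
          ring
  rw [Lp.norm_def, Lp.norm_def, ← ENNReal.toReal_mul, eLpNorm_congr_ae h1, eLpNorm_congr_ae h2]
  refine ENNReal.toReal_mono (ENNReal.mul_ne_top hR ?_) main
  rw [← eLpNorm_congr_ae h2]
  exact Lp.eLpNorm_ne_top _

/-- The weak gradient as a continuous linear map. -/
def wgradL (Ω : Set (ℝ × ℝ)) :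
    H10 Ω →L[ℂ] Lp (EuclideanSpace ℂ (Fin 2)) 2 (volume.restrict Ω) :=
  (WithLp.sndL 2 ℂ _ _).comp (testJets Ω).topologicalClosure.subtypeL

theorem exists_norm_le_wgrad {δ : ℝ} (hδ : 0 < δ) :
    ∃ C : ℝ, 0 < C ∧ ∀ u : H10 (dom δ), ‖u‖ ≤ C * ‖wgrad u‖ := by
  obtain ⟨C, hC⟩ := exists_norm_fst_le_of_testJet hδ
  refine ⟨|C| + 1, by positivity, fun u => ?_⟩
  have hu := u.2
  rw [← SetLike.mem_coe, Submodule.topologicalClosure_coe] at hu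
  have hcl : IsClosed {w : Jets (dom δ) | ‖w‖ ≤ (|C| + 1) * ‖w.snd‖} :=
    isClosed_le continuous_norm (continuous_const.mul (WithLp.sndL 2 ℂ _ _).continuous.norm)
  refine closure_minimal (fun w hw => ?_) hcl hu
  have h1 : ‖w.fst‖ ≤ |C| * ‖w.snd‖ :=
    (hC w hw).trans (mul_le_mul_of_nonneg_right (le_abs_self C) (norm_nonneg _))
  change ‖w‖ ≤ (|C| + 1) * ‖w.snd‖
  refine abs_le_of_sq_le_sq' ?_ (by positivity) |>.2
  rw [WithLp.prod_norm_sq_eq_of_L2]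
  nlinarith [norm_nonneg w.fst, norm_nonneg w.snd, abs_nonneg C,
    mul_nonneg (abs_nonneg C) (sq_nonneg ‖w.snd‖)]

theorem eq_zero_of_wgrad_eq_zero {δ : ℝ} (hδ : 0 < δ) {u : H10 (dom δ)} (h : wgrad u = 0) :
    u = 0 := by
  obtain ⟨C, -, hC⟩ := exists_norm_le_wgrad hδ
  have := hC u
  rw [h, norm_zero, mul_zero] at this
  exact norm_le_zero_iff.1 this

theorem integral_mul_fderiv_of_isTest {δ : ℝ} {φ : ℝ × ℝ → ℂ} (hφ : IsTest (dom δ) φ)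
    {ζ : ℝ × ℝ → ℝ} (hζ : ContDiff ℝ ∞ ζ) (v : ℝ × ℝ) :
    ∫ x in dom δ, (ζ x : ℂ) * fderiv ℝ φ x v = -∫ x in dom δ, (fderiv ℝ ζ x v : ℂ) * φ x := by
  have hζ' : ContDiff ℝ ∞ (fun x => (ζ x : ℂ)) := Complex.ofRealCLM.contDiff.comp hζ
  have hcφ := hφ.smooth.continuous
  have hcζ := hζ'.continuous
  have hd : ∀ x, fderiv ℝ (fun x => (ζ x : ℂ)) x v = (fderiv ℝ ζ x v : ℂ) := fun x => by
    have := (Complex.ofRealCLM.hasFDerivAt (x := ζ x)).comp x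
      (hζ.differentiable (by simp) x).hasFDerivAt
    have h2 : HasFDerivAt (fun x => (ζ x : ℂ)) _ x := this
    rw [h2.fderiv]
    rfl
  have hdφ : Continuous fun x => fderiv ℝ φ x v :=
    (hφ.smooth.continuous_fderiv (by simp)).clm_apply continuous_const
  have hdζ : Continuous fun x => fderiv ℝ (fun x => (ζ x : ℂ)) x v :=
    (hζ'.continuous_fderiv (by simp)).clm_apply continuous_const
  have hz : ∀ x ∉ dom δ, φ x = 0 ∧ fderiv ℝ φ x v = 0 := fun x hx => by
    have hx' : x ∉ tsupport φ := fun h => hx (hφ.support h)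
    refine ⟨image_eq_zero_of_notMem_tsupport hx', ?_⟩
    have := image_eq_zero_of_notMem_tsupport (f := fderiv ℝ φ)
      (fun h => hx' (tsupport_fderiv_subset ℝ h))
    rw [this]
    rfl
  rw [setIntegral_eq_integral_of_forall_compl_eq_zero (fun x hx => by rw [(hz x hx).2, mul_zero]),
    setIntegral_eq_integral_of_forall_compl_eq_zero (fun x hx => by rw [(hz x hx).1, mul_zero])]
  simp_rw [← hd]
  have hcsφ' : HasCompactSupport fun x => fderiv ℝ φ x v :=
    hφ.compact.fderiv_apply (𝕜 := ℝ) v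
  refine integral_mul_fderiv_eq_neg_fderiv_mul_of_integrable (𝕜 := ℂ) ?_ ?_ ?_ ?_ ?_
  · exact (hdζ.mul hcφ).integrable_of_hasCompactSupport hφ.compact.mul_left
  · exact (hcζ.mul hdφ).integrable_of_hasCompactSupport hcsφ'.mul_left
  · exact (hcζ.mul hcφ).integrable_of_hasCompactSupport hφ.compact.mul_left
  · exact fun x _ => hζ'.differentiable (by simp) x
  · exact fun x _ => hφ.smooth.differentiable (by simp) x

theorem inner_grad_direction (φ : ℝ × ℝ → ℂ) (x : ℝ × ℝ) (c : ℝ) (i : Fin 2) :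
    inner ℂ (EuclideanSpace.single i (c : ℂ)) (grad φ x) =
      c * fderiv ℝ φ x (if i = 0 then (1, 0) else (0, 1)) := by
  rw [EuclideanSpace.inner_single_left, Complex.conj_ofReal]
  fin_cases i <;> simp [grad]

/-- Elements are pairs, so it must be shown that the function determines its gradient. The identity
`∫ ζ ∂ᵢu = -∫ ∂ᵢζ u` holds for test jets and is a closed condition; for a vanishing function it
leaves `∫ ζ ∂ᵢu = 0` for all test functions `ζ`. -/
theorem eq_zero_of_fst_eq_zero {δ : ℝ} (hδ : 0 < δ) {u : H10 (dom δ)} (h : u.1.fst = 0) :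
    u = 0 := by
  refine eq_zero_of_wgrad_eq_zero hδ ?_
  have hi : Integrable (wgrad u) (volume.restrict (dom δ)) := by
    have : IsFiniteMeasure ((volume : Measure (ℝ × ℝ)).restrict (dom δ)) :=
      ⟨by rw [Measure.restrict_apply_univ]; exact volume_dom_lt_top δ hδ⟩
    exact (Lp.memLp _).integrable (by norm_num)
  have key : ∀ i : Fin 2, ∀ᵐ x ∂volume.restrict (dom δ), x ∈ dom δ → wgrad u x i = 0 := by
    intro i
    have hii : Integrable (fun x => wgrad u x i) (volume.restrict (dom δ)) :=
      (EuclideanSpace.proj (𝕜 := ℂ) i).integrable_comp hi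
    refine (isOpen_dom hδ).ae_eq_zero_of_integral_contDiff_smul_eq_zero
      (hii.locallyIntegrable.locallyIntegrableOn _) fun ζ hζ hc _ => ?_
    set v : ℝ × ℝ := if i = 0 then (1, 0) else (0, 1) with hv
    have hdζ : Continuous fun x => fderiv ℝ ζ x v :=
      (hζ.continuous_fderiv (by simp)).clm_apply continuous_const
    have hcD : HasCompactSupport fun x => (fderiv ℝ ζ x v : ℂ) :=
      (hc.fderiv_apply (𝕜 := ℝ) v).comp_left (g := fun t : ℝ => (t : ℂ)) rfl
    have mD : MemLp (fun x => (fderiv ℝ ζ x v : ℂ)) 2 (volume.restrict (dom δ)) :=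
      (Complex.continuous_ofReal.comp hdζ).memLp_of_hasCompactSupport hcD
    have hcZ : HasCompactSupport fun x => EuclideanSpace.single i (ζ x : ℂ) :=
      hc.comp_left (g := fun t : ℝ => EuclideanSpace.single i (t : ℂ)) (by simp)
    have hsing : Continuous fun t : ℝ => EuclideanSpace.single i (t : ℂ) := by
      have : (fun t : ℝ => EuclideanSpace.single i (t : ℂ)) =
          fun t : ℝ => (t : ℂ) • EuclideanSpace.single i (1 : ℂ) := by
        ext t j
        simp
      rw [this]
      fun_prop
    have mZ : MemLp (fun x => EuclideanSpace.single i (ζ x : ℂ)) 2 (volume.restrict (dom δ)) :=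
      (hsing.comp hζ.continuous).memLp_of_hasCompactSupport hcZ
    have hcl : IsClosed {w : Jets (dom δ) |
        inner ℂ (mZ.toLp _) w.snd = -inner ℂ (mD.toLp _) w.fst} :=
      isClosed_eq (continuous_const.inner (WithLp.sndL 2 ℂ _ _).continuous)
        (continuous_const.inner (WithLp.fstL 2 ℂ _ _).continuous).neg
    have hu := u.2
    rw [← SetLike.mem_coe, Submodule.topologicalClosure_coe] at hu
    have hmem := closure_minimal (fun w hw => ?_) hcl hu
    · simp only [mem_ofPred_eq, h, inner_zero_right, neg_zero] at hmem
      rw [L2.inner_def] at hmem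
      rw [← hmem]
      refine integral_congr_ae ?_
      filter_upwards [mZ.coeFn_toLp] with x hx
      rw [hx, EuclideanSpace.inner_single_left, Complex.conj_ofReal, Complex.real_smul]
      rfl
    · obtain ⟨φ, hφ, h1, h2⟩ := hw
      simp only [mem_ofPred_eq]
      rw [L2.inner_def, L2.inner_def]
      refine Eq.trans (integral_congr_ae ?_) ((integral_mul_fderiv_of_isTest hφ hζ v).trans
        (congrArg _ (integral_congr_ae ?_)))
      · filter_upwards [mZ.coeFn_toLp, h2] with x hx hx'
        rw [hx, hx', inner_grad_direction]
      · filter_upwards [mD.coeFn_toLp, h1] with x hx hx'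
        rw [hx, hx', RCLike.inner_apply, Complex.conj_ofReal, mul_comm]
  refine Lp.ext ?_
  filter_upwards [key 0, key 1, ae_restrict_mem (measurableSet_dom δ),
    Lp.coeFn_zero (EuclideanSpace ℂ (Fin 2)) 2 (volume.restrict (dom δ))] with x h0 h1 hx hz
  rw [hz]
  ext i
  fin_cases i
  · exact h0 hx
  · exact h1 hx

/-! ### Completeness of the sine system -/

/-- The Fourier coefficients of `F x - F (-x)` on `(-l, l)` are multiples of the sine coefficients
of `F`, so Parseval's identity makes this odd function vanish. -/
theorem ae_eq_comp_neg_of_sine_coeff_eq_zero {l : ℝ} (hl : 0 < l) {F : ℝ → ℂ}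
    (hF : MemLp F 2 volume)
    (h : ∀ n : ℕ, 1 ≤ n → ∫ x in (-l)..l, F x * Real.sin (n * Real.pi / l * x) = 0) :
    ∀ᵐ x ∂volume.restrict (Ioc (-l) l), F x = F (-x) := by
  have hab : -l < l := by linarith
  have hFn : MemLp (fun x => F (-x)) 2 volume :=
    hF.comp_measurePreserving (Measure.measurePreserving_neg volume)
  have hG : MemLp (fun x => F x - F (-x)) 2 (volume.restrict (Ioc (-l) l)) :=
    (hF.sub hFn).restrict _
  have hFi : IntervalIntegrable F volume (-l) l := by
    rw [intervalIntegrable_iff_integrableOn_Ioc_of_le hab.le]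
    exact (hF.restrict _).integrable (by norm_num)
  have hFni : IntervalIntegrable (fun x => F (-x)) volume (-l) l := by
    rw [intervalIntegrable_iff_integrableOn_Ioc_of_le hab.le]
    exact (hFn.restrict _).integrable (by norm_num)
  have hz : ∀ n : ℤ, ∫ x in (-l)..l, F x * Real.sin (n * Real.pi / l * x) = 0 := by
    have hn : ∀ n : ℕ, ∫ x in (-l)..l, F x * Real.sin (n * Real.pi / l * x) = 0 := by
      intro n
      rcases Nat.eq_zero_or_pos n with rfl | hn
      · simp
      · exact h n hn
    intro n
    obtain ⟨m, rfl | rfl⟩ := n.eq_nat_or_neg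
    · exact_mod_cast hn m
    · have : ∀ x : ℝ, F x * Real.sin (((-(m : ℤ) : ℤ) : ℝ) * Real.pi / l * x) =
          -(F x * Real.sin (m * Real.pi / l * x)) := by
        intro x
        have e : ((-(m : ℤ) : ℤ) : ℝ) * Real.pi / l * x = -(m * Real.pi / l * x) := by
          push_cast
          ring
        rw [e, Real.sin_neg]
        push_cast
        ring
      simp_rw [this]
      rw [intervalIntegral.integral_neg, hn m, neg_zero]
  have hcoeff : ∀ n : ℤ, fourierCoeffOn hab (fun x => F x - F (-x)) n = 0 := by
    intro n
    rw [fourierCoeffOn_eq_integral]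
    set e : ℝ → ℂ := fun x => Complex.exp (-(n * Real.pi / l * x : ℝ) * Complex.I) with he
    have hec : Continuous e := by
      simp only [he]
      fun_prop
    have hfour : ∀ x : ℝ, fourier (-n) (x : AddCircle (l - -l)) = e x := by
      intro x
      rw [fourier_coe_apply]
      simp only [he]
      congr 1
      have : (l : ℂ) ≠ 0 := by exact_mod_cast hl.ne'
      push_cast
      field_simp
      ring
    simp_rw [hfour, smul_eq_mul, mul_sub]
    have i1 := hFi.continuousOn_mul hec.continuousOn
    have i2 := hFni.continuousOn_mul hec.continuousOn
    rw [intervalIntegral.integral_sub i1 i2]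
    have hsub := intervalIntegral.integral_comp_neg (a := -l) (b := l) (fun x => e (-x) * F x)
    simp only [neg_neg] at hsub
    have i3 := hFi.continuousOn_mul (hec.comp continuous_neg).continuousOn
    rw [hsub]
    have e2 := intervalIntegral.integral_sub (μ := volume) i1 i3
    simp only [Function.comp_apply] at e2
    rw [← e2]
    have e3 : ∀ x, e x * F x - e (-x) * F x =
        (-2 * Complex.I) * (F x * Real.sin (n * Real.pi / l * x)) := by
      intro x
      simp only [he]
      have : (((n : ℝ) * Real.pi / l * -x : ℝ) : ℂ) = -((n : ℝ) * Real.pi / l * x : ℝ) := by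
        push_cast
        ring
      rw [this, neg_neg, Complex.ofReal_sin, Complex.sin]
      linear_combination (F x * (Complex.exp (-((n : ℝ) * Real.pi / l * x : ℝ) * Complex.I) -
        Complex.exp (((n : ℝ) * Real.pi / l * x : ℝ) * Complex.I))) * Complex.I_sq
    simp_rw [e3]
    rw [intervalIntegral.integral_const_mul, hz n, mul_zero, smul_zero]
  have hs := hasSum_sq_fourierCoeffOn hab hG
  simp only [hcoeff, norm_zero, ne_eq, OfNat.ofNat_ne_zero, not_false_eq_true, zero_pow] at hs
  have h0 := hs.unique hasSum_zero
  rw [smul_eq_mul, mul_eq_zero, inv_eq_zero] at h0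
  have h1 := h0.resolve_left (by linarith)
  rw [intervalIntegral.integral_of_le hab.le,
    integral_eq_zero_iff_of_nonneg (fun x => sq_nonneg _) (hG.integrable_norm_pow two_ne_zero)] at h1
  filter_upwards [h1] with x hx
  simpa [sub_eq_zero] using hx

/-- Extended by zero, `F` agrees with its reflection, which vanishes on `S` because `S` is disjoint
from `-S`. A general `S` covers both `(log δ, 0)` and `(0, π)`. -/
theorem ae_eq_zero_of_sine_coeff_eq_zero {l : ℝ} (hl : 0 < l) {S : Set ℝ} (hS : MeasurableSet S)
    (hSl : S ⊆ Ioo (-l) l) (hneg : ∀ x ∈ S, -x ∉ S) {F : ℝ → ℂ} (hF : MemLp F 2 (volume.restrict S))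
    (h : ∀ n : ℕ, 1 ≤ n → ∫ x in S, F x * Real.sin (n * Real.pi / l * x) = 0) :
    ∀ᵐ x ∂volume.restrict S, F x = 0 := by
  have key := ae_eq_comp_neg_of_sine_coeff_eq_zero hl (F := S.indicator F)
    ((memLp_indicator_iff_restrict hS).2 hF) fun n hn => by
      rw [← h n hn, intervalIntegral.integral_of_le (by linarith), ← integral_indicator hS,
        ← integral_indicator measurableSet_Ioc]
      congr 1
      ext x
      by_cases hx : x ∈ S
      · rw [indicator_of_mem (Ioo_subset_Ioc_self (hSl hx)), indicator_of_mem hx,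
          indicator_of_mem hx]
      · simp [hx]
  have hsub : S ⊆ Ioc (-l) l := hSl.trans Ioo_subset_Ioc_self
  filter_upwards [ae_restrict_of_ae_restrict_of_subset hsub key, ae_restrict_mem hS] with x hx hm
  rwa [indicator_of_mem hm, indicator_of_notMem (hneg x hm)] at hx

/-- The frequency `kπ / |log δ|`. -/
def freq (δ : ℝ) (k : ℕ) : ℝ := k * Real.pi / -Real.log δ

/-- Fubini reduces to one variable at a time: first the `j`-th angular coefficient vanishes for
almost every `s`, then almost every slice vanishes. -/
theorem ae_eq_zero_of_sine_coeff_rect {δ : ℝ} (hδ : δ ∈ Ioo (0 : ℝ) 1) {U : ℝ × ℝ → ℂ}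
    (hU : MemLp U 2 (volume.restrict (rect δ)))
    (h : ∀ k j : ℕ, 1 ≤ k → 1 ≤ j → ∫ p in rect δ,
      U p * (Real.sin (freq δ k * p.1) * Real.sin (j * p.2) : ℂ) = 0) :
    ∀ᵐ p ∂volume.restrict (rect δ), U p = 0 := by
  have hlog : Real.log δ < 0 := Real.log_neg hδ.1 hδ.2
  have hpi := Real.pi_pos
  rw [rect, Measure.volume_eq_prod, ← Measure.prod_restrict] at *
  set μ := (volume : Measure ℝ).restrict (Ioo (Real.log δ) 0) with hμ
  set ν := (volume : Measure ℝ).restrict (Ioo 0 Real.pi) with hν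
  have hUi : Integrable U (μ.prod ν) := hU.integrable (by norm_num)
  have hU2 : Integrable (fun p => ‖U p‖ ^ 2) (μ.prod ν) := hU.integrable_norm_pow two_ne_zero
  have hmem : ∀ᵐ s ∂μ, MemLp (fun θ => U (s, θ)) 2 ν := by
    filter_upwards [hU2.prod_right_ae, hU.aestronglyMeasurable.prodMk_left] with s h1 h2
    exact (memLp_two_iff_integrable_sq_norm h2).2 h1
  have hsin : ∀ (c : ℝ), Continuous fun x : ℝ => (Real.sin (c * x) : ℂ) := fun c => by fun_prop
  have hb : ∀ x : ℝ, ‖(Real.sin x : ℂ)‖ ≤ 1 := fun x => by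
    rw [Complex.norm_real]
    exact Real.abs_sin_le_one x
  have hUj : ∀ j : ℕ, Integrable (fun p : ℝ × ℝ => U p * (Real.sin (j * p.2) : ℂ)) (μ.prod ν) :=
    fun j => hUi.mul_bdd (c := 1) ((hsin j).comp continuous_snd).aestronglyMeasurable
      (Eventually.of_forall fun p => hb _)
  have hzero : ∀ j : ℕ, 1 ≤ j → ∀ᵐ s ∂μ, ∫ θ, U (s, θ) * (Real.sin (j * θ) : ℂ) ∂ν = 0 := by
    intro j hj
    have hl : 0 < -Real.log δ := by linarith
    refine ae_eq_zero_of_sine_coeff_eq_zero hl measurableSet_Ioo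
      (Ioo_subset_Ioo (by linarith) (by linarith))
      (fun x hx hx' => by linarith [hx.1, hx.2, hx'.1, hx'.2]) ?_ ?_
    · have hm : AEStronglyMeasurable (fun s => ∫ θ, U (s, θ) * (Real.sin (j * θ) : ℂ) ∂ν) μ :=
        (hUj j).aestronglyMeasurable.integral_prod_right'
      refine (memLp_two_iff_integrable_sq_norm hm).2 ?_
      refine Integrable.mono' ((hU2.integral_prod_left).const_mul (ν.real univ)) (hm.norm.pow 2) ?_
      filter_upwards [hmem] with s hs
      rw [norm_pow, norm_norm]
      have hsi : Integrable (fun θ => ‖U (s, θ)‖) ν := (hs.integrable (by norm_num)).norm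
      calc ‖∫ θ, U (s, θ) * (Real.sin (j * θ) : ℂ) ∂ν‖ ^ 2 ≤ (∫ θ, ‖U (s, θ)‖ ∂ν) ^ 2 := by
            gcongr
            refine norm_integral_le_of_norm_le hsi (Eventually.of_forall fun θ => ?_)
            rw [norm_mul]
            exact mul_le_of_le_one_right (norm_nonneg _) (hb _)
        _ ≤ ν.real univ * ∫ θ, ‖U (s, θ)‖ ^ 2 ∂ν :=
            sq_integral_le hsi (hs.integrable_norm_pow two_ne_zero)
    · intro k hk
      have hint : Integrable (fun p : ℝ × ℝ =>
          U p * (Real.sin (freq δ k * p.1) * Real.sin (j * p.2) : ℂ)) (μ.prod ν) := by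
        refine hUi.mul_bdd (c := 1) ?_ (Eventually.of_forall fun p => ?_)
        · exact (((hsin _).comp continuous_fst).mul
            ((hsin _).comp continuous_snd)).aestronglyMeasurable
        · rw [norm_mul]
          exact mul_le_one₀ (hb _) (norm_nonneg _) (hb _)
      rw [← h k j hk hj, integral_prod _ hint]
      refine integral_congr_ae (Eventually.of_forall fun s => ?_)
      simp only
      rw [← integral_mul_const]
      refine integral_congr_ae (Eventually.of_forall fun θ => ?_)
      simp only [freq]
      ring
  have hall : ∀ᵐ s ∂μ, ∀ j : ℕ, 1 ≤ j → ∫ θ, U (s, θ) * (Real.sin (j * θ) : ℂ) ∂ν = 0 := by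
    rw [ae_all_iff]
    intro j
    by_cases hj : 1 ≤ j
    · filter_upwards [hzero j hj] with s hs _ using hs
    · exact Eventually.of_forall fun s h => absurd h hj
  have hfin : ∀ᵐ s ∂μ, ∫ θ, ‖U (s, θ)‖ ^ 2 ∂ν = 0 := by
    filter_upwards [hall, hmem] with s h1 h2
    have := ae_eq_zero_of_sine_coeff_eq_zero hpi measurableSet_Ioo
      (Ioo_subset_Ioo (by linarith) le_rfl)
      (fun x hx hx' => by linarith [hx.1, hx.2, hx'.1, hx'.2]) h2 fun n hn => by
        rw [← h1 n hn]
        refine integral_congr_ae (Eventually.of_forall fun θ => ?_)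
        simp only
        rw [mul_div_assoc, div_self hpi.ne', mul_one]
    refine integral_eq_zero_of_ae ?_
    filter_upwards [this] with θ hθ
    rw [hθ]
    simp
  have h0 : ∫ p, ‖U p‖ ^ 2 ∂(μ.prod ν) = 0 := by
    rw [integral_prod _ hU2]
    exact integral_eq_zero_of_ae hfin
  rw [integral_eq_zero_iff_of_nonneg (fun p => sq_nonneg _) hU2] at h0
  filter_upwards [h0] with p hp
  simpa using hp

/-! ### Separated functions -/

/-- `w` is continuous and `w'` is measurable and bounded on `[0, π]`. -/
structure IsPair (w w' : ℝ → ℂ) : Prop where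
  cont : Continuous w
  meas : Measurable w'
  bdd : ∃ C, ∀ x ∈ Icc 0 Real.pi, ‖w' x‖ ≤ C

/-- `w` is an angular profile with derivative `w'`: it vanishes at `0` and `π`, and it is
differentiable on both sides of the interface `θ = π / 4`. -/
structure IsAngular (w w' : ℝ → ℂ) : Prop extends IsPair w w' where
  deriv : ∀ x ∈ Ioo 0 Real.pi, x ≠ Real.pi / 4 → HasDerivAt w (w' x) x
  left : w 0 = 0
  right : w Real.pi = 0

theorem IsPair.add {w w' v v' : ℝ → ℂ} (h : IsPair w w') (k : IsPair v v') :
    IsPair (w + v) (w' + v') where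
  cont := h.cont.add k.cont
  meas := h.meas.add k.meas
  bdd := by
    obtain ⟨C, hC⟩ := h.bdd
    obtain ⟨D, hD⟩ := k.bdd
    exact ⟨C + D, fun x hx => (norm_add_le _ _).trans (add_le_add (hC x hx) (hD x hx))⟩

theorem IsPair.smul {w w' : ℝ → ℂ} (c : ℂ) (h : IsPair w w') : IsPair (c • w) (c • w') where
  cont := h.cont.const_smul c
  meas := h.meas.const_smul c
  bdd := by
    obtain ⟨C, hC⟩ := h.bdd
    refine ⟨‖c‖ * C, fun x hx => ?_⟩
    rw [Pi.smul_apply, norm_smul]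
    exact mul_le_mul_of_nonneg_left (hC x hx) (norm_nonneg _)

theorem isPair_of_continuous {w w' : ℝ → ℂ} (h : Continuous w) (h' : Continuous w') :
    IsPair w w' :=
  ⟨h, h'.measurable, isCompact_Icc.exists_bound_of_continuousOn h'.continuousOn⟩

theorem intervalIntegrable_of_bounded {f : ℝ → ℂ} (hf : Measurable f) {C : ℝ}
    (hC : ∀ x ∈ Icc 0 Real.pi, ‖f x‖ ≤ C) {a b : ℝ} (ha : a ∈ Icc 0 Real.pi)
    (hb : b ∈ Icc 0 Real.pi) : IntervalIntegrable f volume a b := by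
  refine (intervalIntegrable_const (c := C)).mono_fun' hf.aestronglyMeasurable ?_
  filter_upwards [ae_restrict_mem measurableSet_uIoc] with x hx
  exact hC x (uIcc_subset_Icc ha hb (uIoc_subset_uIcc hx))

theorem IsPair.intervalIntegrable {w w' : ℝ → ℂ} (h : IsPair w w') {a b : ℝ}
    (ha : a ∈ Icc 0 Real.pi) (hb : b ∈ Icc 0 Real.pi) : IntervalIntegrable w' volume a b := by
  obtain ⟨C, hC⟩ := h.bdd
  exact intervalIntegrable_of_bounded h.meas hC ha hb

theorem IsAngular.isPrim {w w' : ℝ → ℂ} (h : IsAngular w w') : IsPrim 0 Real.pi w w' where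
  cont := h.cont
  meas := h.meas
  bdd := h.bdd
  right := h.right
  eq_integral := by
    intro x hx
    rw [integral_eq_of_hasDerivAt_off_countable w w' (countable_singleton (Real.pi / 4))
      h.cont.continuousOn ?_ (h.intervalIntegrable (left_mem_Icc.2 Real.pi_pos.le) hx), h.left, sub_zero]
    rintro y ⟨hy, hy'⟩
    rw [min_eq_left hx.1, max_eq_right hx.1] at hy
    exact h.deriv y ⟨hy.1, hy.2.trans_le hx.2⟩ hy'

theorem IsAngular.add {w w' v v' : ℝ → ℂ} (h : IsAngular w w') (k : IsAngular v v') :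
    IsAngular (w + v) (w' + v') where
  toIsPair := h.toIsPair.add k.toIsPair
  deriv x hx hx' := (h.deriv x hx hx').add (k.deriv x hx hx')
  left := by simp [h.left, k.left]
  right := by simp [h.right, k.right]

theorem IsAngular.smul {w w' : ℝ → ℂ} (c : ℂ) (h : IsAngular w w') :
    IsAngular (c • w) (c • w') where
  toIsPair := h.toIsPair.smul c
  deriv x hx hx' := (h.deriv x hx hx').const_smul c
  left := by simp [h.left]
  right := by simp [h.right]

theorem IsAngular.zero : IsAngular 0 0 where
  toIsPair := isPair_of_continuous continuous_zero continuous_zero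
  deriv x _ _ := hasDerivAt_const x 0
  left := rfl
  right := rfl

theorem hasDerivAt_sin_ofReal (c x : ℝ) :
    HasDerivAt (fun x : ℝ => (Real.sin (c * x) : ℂ)) (c * Real.cos (c * x) : ℂ) x := by
  have h : HasDerivAt (fun x : ℝ => Real.sin (c * x)) (Real.cos (c * x) * (c * 1)) x :=
    ((hasDerivAt_id x).const_mul c).sin
  convert h.ofReal_comp using 1
  push_cast
  ring

theorem hasDerivAt_cos_ofReal (c x : ℝ) :
    HasDerivAt (fun x : ℝ => (Real.cos (c * x) : ℂ)) (-(c * Real.sin (c * x)) : ℂ) x := by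
  have h : HasDerivAt (fun x : ℝ => Real.cos (c * x)) (-Real.sin (c * x) * (c * 1)) x :=
    ((hasDerivAt_id x).const_mul c).cos
  convert h.ofReal_comp using 1
  push_cast
  ring

theorem isAngular_sin (j : ℕ) : IsAngular (fun θ => (Real.sin (j * θ) : ℂ))
    (fun θ => (j * Real.cos (j * θ) : ℂ)) where
  toIsPair := isPair_of_continuous (by fun_prop) (by fun_prop)
  deriv x _ _ := by simpa using hasDerivAt_sin_ofReal j x
  left := by simp
  right := by rw [Real.sin_nat_mul_pi, Complex.ofReal_zero]

theorem freq_mul_log {δ : ℝ} (hδ : δ ∈ Ioo (0 : ℝ) 1) (k : ℕ) :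
    freq δ k * Real.log δ = -(k * Real.pi) := by
  have hlog : Real.log δ < 0 := Real.log_neg hδ.1 hδ.2
  rw [freq, div_neg, neg_mul, div_mul_cancel₀ _ hlog.ne]

theorem isPrim_sin_freq {δ : ℝ} (hδ : δ ∈ Ioo (0 : ℝ) 1) (k : ℕ) :
    IsPrim (Real.log δ) 0 (fun s => (Real.sin (freq δ k * s) : ℂ))
      (fun s => (freq δ k * Real.cos (freq δ k * s) : ℂ)) where
  cont := by fun_prop
  meas := Continuous.measurable (by fun_prop)
  bdd := isCompact_Icc.exists_bound_of_continuousOn (Continuous.continuousOn (by fun_prop))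
  right := by simp
  eq_integral x _ := by
    rw [intervalIntegral.integral_eq_sub_of_hasDerivAt (fun t _ => hasDerivAt_sin_ofReal _ t)
      (Continuous.intervalIntegrable (by fun_prop) _ _), freq_mul_log hδ, Real.sin_neg,
      Real.sin_nat_mul_pi]
    simp

/-- `sin(μ_k s) w(θ)` is the representation of `u` in logarithmic polar coordinates. -/
def IsMode {δ : ℝ} (k : ℕ) (u : H10 (dom δ)) (w w' : ℝ → ℂ) : Prop :=
  HasRep u.1 (fun p => Real.sin (freq δ k * p.1) * w p.2)
    (fun p => freq δ k * Real.cos (freq δ k * p.1) * w p.2)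
    (fun p => Real.sin (freq δ k * p.1) * w' p.2)

theorem exists_isMode {δ : ℝ} (hδ : δ ∈ Ioo (0 : ℝ) 1) (k : ℕ) {w w' : ℝ → ℂ}
    (h : IsAngular w w') : ∃ u : H10 (dom δ), IsMode k u w w' :=
  exists_H10_prod hδ (isPrim_sin_freq hδ k) h.isPrim

/-- The functions of the form `sin(μ_k s) w(θ)`. -/
def modeSpace {δ : ℝ} (hδ : δ ∈ Ioo (0 : ℝ) 1) (k : ℕ) : Submodule ℂ (H10 (dom δ)) where
  carrier := {u | ∃ w w', IsAngular w w' ∧ IsMode k u w w'}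
  zero_mem' := ⟨0, 0, IsAngular.zero, (HasRep.zero hδ.1).congr (by simp) (by simp) (by simp)⟩
  add_mem' := by
    rintro u v ⟨w, w', h, r⟩ ⟨x, x', k, r'⟩
    refine ⟨w + x, w' + x', h.add k, (r.add hδ.1 r').congr ?_ ?_ ?_⟩ <;> intro p _ <;>
      simp <;> ring
  smul_mem' := by
    rintro c u ⟨w, w', h, r⟩
    refine ⟨c • w, c • w', h.smul c, (r.smul hδ.1 c).congr ?_ ?_ ?_⟩ <;> intro p _ <;>
      simp <;> ring

/-! ### Integration by parts against separated functions -/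

theorem integrableOn_rect_of_continuous {δ : ℝ} {G : ℝ × ℝ → ℂ} (hG : Continuous G) :
    IntegrableOn G (rect δ) :=
  (hG.continuousOn.integrableOn_compact (isCompact_Icc.prod isCompact_Icc)).mono_set
    (Set.prod_mono Ioo_subset_Icc_self Ioo_subset_Icc_self)

theorem integral_rect_eq {δ : ℝ} (hδ : δ ∈ Ioo (0 : ℝ) 1) {G : ℝ × ℝ → ℂ} (hG : Continuous G) :
    ∫ p in rect δ, G p = ∫ s in (Real.log δ)..0, ∫ θ in 0..Real.pi, G (s, θ) := by
  have h := integrableOn_rect_of_continuous (δ := δ) hG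
  have hlog : Real.log δ < 0 := Real.log_neg hδ.1 hδ.2
  rw [IntegrableOn, rect, Measure.volume_eq_prod, ← Measure.prod_restrict] at h
  rw [rect, Measure.volume_eq_prod, ← Measure.prod_restrict, integral_prod _ h,
    intervalIntegral.integral_of_le hlog.le, integral_Ioc_eq_integral_Ioo]
  simp_rw [intervalIntegral.integral_of_le Real.pi_pos.le, integral_Ioc_eq_integral_Ioo]

theorem integral_rect_eq_symm {δ : ℝ} (hδ : δ ∈ Ioo (0 : ℝ) 1) {G : ℝ × ℝ → ℂ}
    (hG : Continuous G) :
    ∫ p in rect δ, G p = ∫ θ in 0..Real.pi, ∫ s in (Real.log δ)..0, G (s, θ) := by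
  have h := integrableOn_rect_of_continuous (δ := δ) hG
  have hlog : Real.log δ < 0 := Real.log_neg hδ.1 hδ.2
  rw [IntegrableOn, rect, Measure.volume_eq_prod, ← Measure.prod_restrict] at h
  rw [rect, Measure.volume_eq_prod, ← Measure.prod_restrict, integral_prod_symm _ h,
    intervalIntegral.integral_of_le Real.pi_pos.le, integral_Ioc_eq_integral_Ioo]
  simp_rw [intervalIntegral.integral_of_le hlog.le, integral_Ioc_eq_integral_Ioo]

theorem integral_deriv_mul_cos {a b c : ℝ} {U U' : ℝ → ℂ} (hU : ∀ x, HasDerivAt U (U' x) x)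
    (hU' : Continuous U') (ha : U a = 0) (hb : U b = 0) :
    ∫ x in a..b, U' x * (c * Real.cos (c * x) : ℂ) =
      c ^ 2 * ∫ x in a..b, U x * (Real.sin (c * x) : ℂ) := by
  have h := intervalIntegral.integral_mul_deriv_eq_deriv_mul (a := a) (b := b)
    (u := fun x : ℝ => (Real.cos (c * x) : ℂ)) (v := U)
    (fun x _ => hasDerivAt_cos_ofReal c x) (fun x _ => hU x)
    (Continuous.intervalIntegrable (by fun_prop) _ _) (hU'.intervalIntegrable _ _)
  rw [ha, hb, mul_zero, mul_zero, sub_zero, zero_sub] at h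
  calc ∫ x in a..b, U' x * (c * Real.cos (c * x) : ℂ)
      = c * ∫ x in a..b, (Real.cos (c * x) : ℂ) * U' x := by
        rw [← intervalIntegral.integral_const_mul]
        congr 1
        ext x
        ring
    _ = _ := by
        rw [h, ← intervalIntegral.integral_neg, ← intervalIntegral.integral_const_mul,
          ← intervalIntegral.integral_const_mul]
        congr 1
        ext x
        ring

theorem sq_add_sq_of_mem_dom {δ : ℝ} {x : ℝ × ℝ} (hδ : 0 < δ) (hx : x ∈ dom δ) :
    δ ^ 2 < x.1 ^ 2 + x.2 ^ 2 ∧ x.1 ^ 2 + x.2 ^ 2 < 1 := by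
  obtain ⟨⟨r, θ⟩, ⟨hr, hθ⟩, rfl⟩ := hx
  have e : (r * Real.cos θ) ^ 2 + (r * Real.sin θ) ^ 2 = r ^ 2 := by
    linear_combination r ^ 2 * Real.sin_sq_add_cos_sq θ
  have h1 : δ < r := hr.1
  have h2 : r < 1 := hr.2
  simp only
  rw [e]
  constructor <;> nlinarith

theorem logPolar_notMem_dom {δ : ℝ} (hδ : 0 < δ) {p : ℝ × ℝ}
    (hp : p.1 = Real.log δ ∨ p.1 = 0 ∨ p.2 = 0 ∨ p.2 = Real.pi) : logPolar p ∉ dom δ := by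
  intro h
  have h1 := sq_add_sq_of_mem_dom hδ h
  have h2 := snd_pos_of_mem_dom hδ h
  have e : (logPolar p).1 ^ 2 + (logPolar p).2 ^ 2 = Real.exp p.1 ^ 2 := by
    simp only [logPolar]
    linear_combination Real.exp p.1 ^ 2 * Real.sin_sq_add_cos_sq p.2
  rw [e] at h1
  rcases hp with hp | hp | hp | hp
  · rw [hp, Real.exp_log hδ] at h1
    exact lt_irrefl _ h1.1
  · rw [hp, Real.exp_zero] at h1
    norm_num at h1
  · simp [logPolar, hp] at h2
  · simp [logPolar, hp] at h2

/-- Green's formula against an eigenfunction of `-Δ` with eigenvalue `c² + d²`. The boundary of the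
rectangle is mapped outside the domain, so `φ ∘ logPolar` kills all boundary terms and `c`, `d` are
arbitrary. -/
theorem integral_grad_mul_grad_sin {δ : ℝ} (hδ : δ ∈ Ioo (0 : ℝ) 1) {φ : ℝ × ℝ → ℂ}
    (hφ : IsTest (dom δ) φ) (c d : ℝ) :
    ∫ p in rect δ, (fderiv ℝ (φ ∘ logPolar) p (1, 0) *
        (c * Real.cos (c * p.1) * Real.sin (d * p.2) : ℂ) +
      fderiv ℝ (φ ∘ logPolar) p (0, 1) * (Real.sin (c * p.1) * (d * Real.cos (d * p.2)) : ℂ)) =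
    (c ^ 2 + d ^ 2 : ℂ) *
      ∫ p in rect δ, (φ ∘ logPolar) p * (Real.sin (c * p.1) * Real.sin (d * p.2) : ℂ) := by
  set V := φ ∘ logPolar with hV
  have hVs : ContDiff ℝ ∞ V := hφ.smooth.comp contDiff_logPolar
  have hVc : Continuous V := hVs.continuous
  have hf : Continuous (fderiv ℝ V) := hVs.continuous_fderiv (by simp)
  have hf1 : Continuous fun p => fderiv ℝ V p (1, 0) := hf.clm_apply continuous_const
  have hf2 : Continuous fun p => fderiv ℝ V p (0, 1) := hf.clm_apply continuous_const
  have hd : Differentiable ℝ V := hVs.differentiable (by simp)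
  have hz : ∀ p : ℝ × ℝ, (p.1 = Real.log δ ∨ p.1 = 0 ∨ p.2 = 0 ∨ p.2 = Real.pi) → V p = 0 :=
    fun p hp => image_eq_zero_of_notMem_tsupport (f := φ) fun h =>
      logPolar_notMem_dom hδ.1 hp (hφ.support h)
  have d1 : ∀ s θ : ℝ, HasDerivAt (fun s => V (s, θ)) (fderiv ℝ V (s, θ) (1, 0)) s := fun s θ =>
    HasFDerivAt.comp_hasDerivAt (l := V) (f := fun s : ℝ => (s, θ)) s (hd (s, θ)).hasFDerivAt
      ((hasDerivAt_id s).prodMk (hasDerivAt_const s θ))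
  have d2 : ∀ s θ : ℝ, HasDerivAt (fun θ => V (s, θ)) (fderiv ℝ V (s, θ) (0, 1)) θ := fun s θ =>
    HasFDerivAt.comp_hasDerivAt (l := V) (f := fun θ : ℝ => (s, θ)) θ (hd (s, θ)).hasFDerivAt
      ((hasDerivAt_const θ s).prodMk (hasDerivAt_id θ))
  have G1 : Continuous fun p : ℝ × ℝ => fderiv ℝ V p (1, 0) *
      (c * Real.cos (c * p.1) * Real.sin (d * p.2) : ℂ) := hf1.mul (by fun_prop)
  have G2 : Continuous fun p : ℝ × ℝ => fderiv ℝ V p (0, 1) *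
      (Real.sin (c * p.1) * (d * Real.cos (d * p.2)) : ℂ) := hf2.mul (by fun_prop)
  have G3 : Continuous fun p : ℝ × ℝ => V p *
      (Real.sin (c * p.1) * Real.sin (d * p.2) : ℂ) := hVc.mul (by fun_prop)
  rw [integral_add (integrableOn_rect_of_continuous G1) (integrableOn_rect_of_continuous G2),
    add_mul]
  congr 1
  · rw [integral_rect_eq_symm hδ G1, integral_rect_eq_symm hδ G3,
      ← intervalIntegral.integral_const_mul]
    refine intervalIntegral.integral_congr fun θ _ => ?_
    have h := integral_deriv_mul_cos (c := c) (fun s => d1 s θ)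
      (hf1.comp (by fun_prop : Continuous fun s : ℝ => (s, θ)))
      (hz (Real.log δ, θ) (Or.inl rfl)) (hz (0, θ) (Or.inr (Or.inl rfl)))
    simp only
    simp_rw [← mul_assoc]
    simp only [← mul_assoc] at h
    rw [intervalIntegral.integral_mul_const, intervalIntegral.integral_mul_const, h]
    ring
  · rw [integral_rect_eq hδ G2, integral_rect_eq hδ G3, ← intervalIntegral.integral_const_mul]
    refine intervalIntegral.integral_congr fun s _ => ?_
    have h := integral_deriv_mul_cos (c := d) (fun θ => d2 s θ)
      (hf2.comp (by fun_prop : Continuous fun θ : ℝ => (s, θ)))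
      (hz (s, 0) (by simp)) (hz (s, Real.pi) (by simp))
    simp only
    simp_rw [mul_left_comm _ (Real.sin (c * s) : ℂ)]
    rw [intervalIntegral.integral_const_mul, intervalIntegral.integral_const_mul]
    rw [h]
    ring

/-! ### Density of the sums of modes -/

theorem quasiMeasurePreserving_logPolar {δ : ℝ} (hδ : 0 < δ) :
    Measure.QuasiMeasurePreserving logPolar (volume.restrict (rect δ)) (volume.restrict (dom δ)) where
  measurable := contDiff_logPolar.continuous.measurable
  absolutelyContinuous := by
    refine Measure.AbsolutelyContinuous.mk fun s hs h0 => ?_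
    rw [Measure.map_apply contDiff_logPolar.continuous.measurable hs]
    have := ae_rect_of_ae_dom hδ (P := fun x => x ∉ s) (measure_eq_zero_iff_ae_notMem.1 h0)
    exact measure_eq_zero_iff_ae_notMem.2 this

theorem memLp_comp_logPolar {δ : ℝ} (hδ : 0 < δ) (f : Lp ℂ 2 (volume.restrict (dom δ))) :
    MemLp (fun p => f (logPolar p)) 2 (volume.restrict (rect δ)) := by
  have hm : AEStronglyMeasurable (fun p => f (logPolar p)) (volume.restrict (rect δ)) :=
    (Lp.aestronglyMeasurable f).comp_quasiMeasurePreserving (quasiMeasurePreserving_logPolar hδ)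
  rw [memLp_two_iff_integrable_sq_norm hm]
  have h1 : IntegrableOn (fun x => ‖f x‖ ^ 2) (logPolar '' rect δ) := by
    rw [image_logPolar hδ]
    exact (Lp.memLp f).integrable_norm_pow two_ne_zero
  rw [integrableOn_image_iff_integrableOn_abs_det_fderiv_smul volume (measurableSet_rect δ)
    (fun p _ => (hasFDerivAt_logPolar p).hasFDerivWithinAt) (injOn_logPolar δ)] at h1
  refine Integrable.mono' (h1.const_mul ((δ ^ 2)⁻¹)) (hm.norm.pow 2) ?_
  filter_upwards [ae_restrict_mem (measurableSet_rect δ)] with p hp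
  have hle : δ ^ 2 ≤ Real.exp p.1 ^ 2 := by
    have : δ ≤ Real.exp p.1 := ((Real.log_lt_iff_lt_exp hδ).1 hp.1.1).le
    gcongr
  rw [det_logPolarDeriv, norm_pow, norm_norm, smul_eq_mul, abs_of_nonneg (by positivity),
    ← mul_assoc]
  refine le_mul_of_one_le_left (by positivity) ?_
  rw [inv_mul_eq_div, one_le_div (by positivity)]
  exact hle

/-- The modes with profile `sin(jθ)` already suffice: Green's formula, extended from test jets by
closure, turns gradient orthogonality into vanishing double sine coefficients of `u`. -/
theorem eq_zero_of_orthogonal_modes {δ : ℝ} (hδ : δ ∈ Ioo (0 : ℝ) 1) {u : H10 (dom δ)}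
    (h : ∀ k : ℕ, ∀ v ∈ modeSpace hδ (k + 1), inner ℂ (wgrad v) (wgrad u) = 0) : u = 0 := by
  have hpi := Real.pi_pos
  have hl : 0 < -Real.log δ := by linarith [Real.log_neg hδ.1 hδ.2]
  refine eq_zero_of_fst_eq_zero hδ.1 ?_
  have key : ∀ᵐ p ∂volume.restrict (rect δ), u.1.fst (logPolar p) = 0 := by
    refine ae_eq_zero_of_sine_coeff_rect hδ (memLp_comp_logPolar hδ.1 _) fun k j hk hj => ?_
    obtain ⟨k, rfl⟩ := Nat.exists_eq_add_of_le' hk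
    set c := freq δ (k + 1) with hc
    have hc0 : 0 < c := by
      rw [hc, freq]
      positivity
    obtain ⟨v, hv⟩ := exists_isMode hδ (k + 1) (isAngular_sin j)
    have hvu := h k v ⟨_, _, isAngular_sin j, hv⟩
    have hb : ∀ x : ℝ, ‖(Real.sin x : ℂ)‖ ≤ 1 := fun x => by
      rw [Complex.norm_real]
      exact Real.abs_sin_le_one x
    -- The factor `e^{-2s}` cancels the Jacobian, so that pairing with `z.fst` on the domain is the
    -- unweighted sine coefficient on the rectangle. The derivative components play no role.
    obtain ⟨z, hz⟩ := exists_hasRep_of_bounded hδ.1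
      (U := fun p => ((Real.exp p.1 ^ 2)⁻¹ : ℝ) * (Real.sin (c * p.1) * Real.sin (j * p.2) : ℂ))
      (P := 0) (Q := 0) (C := (δ ^ 2)⁻¹) (Measurable.mul (by fun_prop) (by fun_prop))
      measurable_const measurable_const (fun p hp => by
        have hle : δ ^ 2 ≤ Real.exp p.1 ^ 2 := by
          have := hδ.1
          have : δ ≤ Real.exp p.1 := ((Real.log_lt_iff_lt_exp hδ.1).1 hp.1.1).le
          gcongr
        rw [norm_mul, norm_mul, Complex.norm_real, Real.norm_eq_abs, abs_of_nonneg (by positivity)]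
        refine (mul_le_of_le_one_right (by positivity)
          (mul_le_one₀ (hb _) (norm_nonneg _) (hb _))).trans ?_
        have := hδ.1
        gcongr) (fun p _ => by simpa using (sq_nonneg δ)) (fun p _ => by simpa using (sq_nonneg δ))
    have hcl : IsClosed {w : Jets (dom δ) |
        inner ℂ v.1.snd w.snd = ((c ^ 2 + (j : ℝ) ^ 2 : ℝ) : ℂ) * inner ℂ z.fst w.fst} :=
      isClosed_eq (continuous_const.inner (WithLp.sndL 2 ℂ _ _).continuous)
        (continuous_const.mul (continuous_const.inner (WithLp.fstL 2 ℂ _ _).continuous))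
    have hu := u.2
    rw [← SetLike.mem_coe, Submodule.topologicalClosure_coe] at hu
    have hmem := closure_minimal (fun w hw => ?_) hcl hu
    · simp only [mem_ofPred_eq] at hmem
      have hvu' : inner ℂ v.1.snd u.1.snd = 0 := hvu
      rw [hvu', eq_comm, mul_eq_zero] at hmem
      have h0 := hmem.resolve_left (by
        rw [Complex.ofReal_eq_zero]
        positivity)
      rw [L2.inner_def, integral_dom hδ.1] at h0
      rw [← h0]
      refine integral_congr_ae ?_
      filter_upwards [hz] with p hp
      rw [hp.1, RCLike.inner_apply, Complex.real_smul]
      have : ((Real.exp p.1 : ℝ) : ℂ) ≠ 0 := by exact_mod_cast (Real.exp_pos p.1).ne'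
      simp only [map_mul, Complex.conj_ofReal]
      push_cast at this ⊢
      field_simp
    · obtain ⟨φ, hφ, h1, h2⟩ := hw
      have hr := hasRep_of_isTest hδ.1 hφ.smooth h1 h2
      simp only [mem_ofPred_eq]
      rw [hr.inner_eq hδ.1 hv, hr.inner_fst hδ.1 hz]
      have e := integral_grad_mul_grad_sin hδ hφ c j
      refine Eq.trans ?_ (e.trans ?_)
      · congr 1
        ext p
        simp only [map_mul, Complex.conj_ofReal, map_natCast, ← hc]
        push_cast
        rfl
      · rw [Complex.ofReal_add, Complex.ofReal_pow, Complex.ofReal_pow]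
        congr 1
        congr 1
        ext p
        have : Complex.exp (p.1 : ℂ) ≠ 0 := Complex.exp_ne_zero _
        simp only [map_mul, Complex.conj_ofReal]
        push_cast
        field_simp
  have := ae_dom_of_ae_rect hδ.1 (P := fun x => u.1.fst x = 0) key
  refine Lp.ext ?_
  filter_upwards [this, Lp.coeFn_zero ℂ 2 (volume.restrict (dom δ))] with x hx hx'
  rw [hx, hx']
  rfl

/-- Orthogonality is available for the gradient inner product rather than that of `H¹₀`, so the
projection takes place among gradients in `L²`. The Poincaré inequality makes the image of the
closed span closed there. -/
theorem dense_iSup_modeSpace {δ : ℝ} (hδ : δ ∈ Ioo (0 : ℝ) 1) :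
    (⨆ k : ℕ, modeSpace hδ (k + 1)).topologicalClosure = ⊤ := by
  set M := (⨆ k : ℕ, modeSpace hδ (k + 1)).topologicalClosure with hM
  obtain ⟨C, hC0, hC⟩ := exists_norm_le_wgrad hδ.1
  have hanti : AntilipschitzWith ⟨C, hC0.le⟩ (wgradL (dom δ)) :=
    (wgradL (dom δ)).antilipschitz_of_bound hC
  have hclosed : IsClosed ((M.map (wgradL (dom δ)).toLinearMap : Submodule ℂ _) :
      Set (Lp (EuclideanSpace ℂ (Fin 2)) 2 (volume.restrict (dom δ)))) := by
    rw [Submodule.map_coe]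
    exact (hanti.isClosedEmbedding (wgradL (dom δ)).uniformContinuous).isClosedMap _
      (Submodule.isClosed_topologicalClosure _)
  have : CompleteSpace (M.map (wgradL (dom δ)).toLinearMap) := hclosed.completeSpace_coe
  rw [eq_top_iff]
  intro u _
  obtain ⟨m, hm, hmu⟩ := (M.map (wgradL (dom δ)).toLinearMap).starProjection_apply_mem (wgrad u)
  have horth := (M.map (wgradL (dom δ)).toLinearMap).sub_starProjection_mem_orthogonal (wgrad u)
  rw [← hmu] at horth
  have hz : u - m = 0 := by
    refine eq_zero_of_orthogonal_modes hδ fun k v hv => ?_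
    refine (Submodule.mem_orthogonal _ _).1 horth (wgrad v) ⟨v, ?_, rfl⟩
    exact Submodule.le_topologicalClosure _ (Submodule.mem_iSup_of_mem k hv)
  rw [sub_eq_zero.1 hz]
  exact hm

/-! ### The angular energy -/

/-- `∫_a^b (w' conj x' + μ² w conj x)` -/
def energy (μ a b : ℝ) (w w' x x' : ℝ → ℂ) : ℂ :=
  ∫ θ in a..b, (w' θ * starRingEnd ℂ (x' θ) + (μ : ℂ) ^ 2 * (w θ * starRingEnd ℂ (x θ)))

theorem measurable_conj : Measurable (starRingEnd ℂ) := Complex.continuous_conj.measurable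

theorem IsPair.exists_bound_mul_conj {w w' x x' : ℝ → ℂ} (h : IsPair w w') (k : IsPair x x') :
    ∃ C, ∀ θ ∈ Icc 0 Real.pi, ‖w' θ * starRingEnd ℂ (x' θ)‖ ≤ C ∧
      ‖w θ * starRingEnd ℂ (x θ)‖ ≤ C := by
  obtain ⟨C, hC⟩ := h.bdd
  obtain ⟨D, hD⟩ := k.bdd
  obtain ⟨E, hE⟩ := isCompact_Icc.exists_bound_of_continuousOn (s := Icc 0 Real.pi)
    (h.cont.mul (Complex.continuous_conj.comp k.cont)).continuousOn
  refine ⟨max (C * D) E, fun θ hθ => ⟨?_, (hE θ hθ).trans (le_max_right _ _)⟩⟩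
  refine le_trans ?_ (le_max_left _ _)
  rw [norm_mul, RCLike.norm_conj]
  exact mul_le_mul (hC θ hθ) (hD θ hθ) (norm_nonneg _) ((norm_nonneg _).trans (hC θ hθ))

theorem IsPair.measurable_mul_conj {w w' x x' : ℝ → ℂ} (h : IsPair w w') (k : IsPair x x') :
    Measurable (fun θ => w' θ * starRingEnd ℂ (x' θ)) ∧
      Measurable (fun θ => w θ * starRingEnd ℂ (x θ)) :=
  ⟨h.meas.mul (measurable_conj.comp k.meas),
    h.cont.measurable.mul (measurable_conj.comp k.cont.measurable)⟩

theorem IsPair.intervalIntegrable_mul_conj {w w' x x' : ℝ → ℂ} (h : IsPair w w')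
    (k : IsPair x x') {a b : ℝ} (ha : a ∈ Icc 0 Real.pi) (hb : b ∈ Icc 0 Real.pi) :
    IntervalIntegrable (fun θ => w' θ * starRingEnd ℂ (x' θ)) volume a b ∧
      IntervalIntegrable (fun θ => w θ * starRingEnd ℂ (x θ)) volume a b := by
  obtain ⟨C, hC⟩ := h.exists_bound_mul_conj k
  exact ⟨intervalIntegrable_of_bounded (h.measurable_mul_conj k).1 (fun x hx => (hC x hx).1) ha hb,
    intervalIntegrable_of_bounded (h.measurable_mul_conj k).2 (fun x hx => (hC x hx).2) ha hb⟩

theorem IsPair.intervalIntegrable_energy {w w' x x' : ℝ → ℂ} (h : IsPair w w')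
    (k : IsPair x x') (μ : ℝ) {a b : ℝ} (ha : a ∈ Icc 0 Real.pi) (hb : b ∈ Icc 0 Real.pi) :
    IntervalIntegrable (fun θ => w' θ * starRingEnd ℂ (x' θ) +
      (μ : ℂ) ^ 2 * (w θ * starRingEnd ℂ (x θ))) volume a b :=
  (h.intervalIntegrable_mul_conj k ha hb).1.add
    ((h.intervalIntegrable_mul_conj k ha hb).2.const_mul _)

theorem energy_conj (μ a b : ℝ) (w w' x x' : ℝ → ℂ) :
    energy μ a b x x' w w' = starRingEnd ℂ (energy μ a b w w' x x') := by
  rw [energy, energy, intervalIntegral.intervalIntegral_eq_integral_uIoc,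
    intervalIntegral.intervalIntegral_eq_integral_uIoc, Complex.real_smul, Complex.real_smul,
    map_mul, Complex.conj_ofReal, ← integral_conj]
  congr 2
  ext θ
  simp only [map_add, map_mul, map_pow, Complex.conj_ofReal, Complex.conj_conj]
  ring

theorem energy_linear_right {w w' x x' y y' : ℝ → ℂ} (h : IsPair w w') (k : IsPair x x')
    (l : IsPair y y') (α β : ℂ) (μ : ℝ) {a b : ℝ} (ha : a ∈ Icc 0 Real.pi)
    (hb : b ∈ Icc 0 Real.pi) :
    energy μ a b w w' (α • x + β • y) (α • x' + β • y') =
      starRingEnd ℂ α * energy μ a b w w' x x' + starRingEnd ℂ β * energy μ a b w w' y y' := by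
  rw [energy, energy, energy, ← intervalIntegral.integral_const_mul,
    ← intervalIntegral.integral_const_mul, ← intervalIntegral.integral_add
    ((h.intervalIntegrable_energy k μ ha hb).const_mul _)
    ((h.intervalIntegrable_energy l μ ha hb).const_mul _)]
  congr 1
  ext θ
  simp only [Pi.add_apply, Pi.smul_apply, smul_eq_mul, map_add, map_mul]
  ring

theorem energy_linear_self {x x' y y' : ℝ → ℂ} (k : IsPair x x')
    (l : IsPair y y') (α β : ℂ) (μ : ℝ) {a b : ℝ} (ha : a ∈ Icc 0 Real.pi)
    (hb : b ∈ Icc 0 Real.pi) :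
    energy μ a b (α • x + β • y) (α • x' + β • y') (α • x + β • y) (α • x' + β • y') =
      α * starRingEnd ℂ α * energy μ a b x x' x x' +
      α * starRingEnd ℂ β * energy μ a b x x' y y' +
      β * starRingEnd ℂ α * starRingEnd ℂ (energy μ a b x x' y y') +
      β * starRingEnd ℂ β * energy μ a b y y' y y' := by
  have hz := (k.smul α).add (l.smul β)
  rw [energy_linear_right hz k l α β μ ha hb, energy_conj μ a b x x' (α • x + β • y),
    energy_conj μ a b y y' (α • x + β • y), energy_linear_right k k l α β μ ha hb,
    energy_linear_right l k l α β μ ha hb, energy_conj μ a b x x' y y']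
  simp only [map_add, map_mul, Complex.conj_conj, ← energy_conj μ a b x x' x x',
    ← energy_conj μ a b y y' y y']
  ring

theorem energy_congr {μ a b : ℝ} {w w' x x' v v' y y' : ℝ → ℂ} (hab : a ≤ b)
    (h1 : ∀ θ ∈ Ioo a b, w θ = v θ) (h2 : ∀ θ ∈ Ioo a b, w' θ = v' θ)
    (h3 : ∀ θ ∈ Ioo a b, x θ = y θ) (h4 : ∀ θ ∈ Ioo a b, x' θ = y' θ) :
    energy μ a b w w' x x' = energy μ a b v v' y y' := by
  rw [energy, energy, intervalIntegral.integral_of_le hab, intervalIntegral.integral_of_le hab,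
    integral_Ioc_eq_integral_Ioo, integral_Ioc_eq_integral_Ioo]
  refine setIntegral_congr_fun measurableSet_Ioo fun θ hθ => ?_
  rw [h1 θ hθ, h2 θ hθ, h3 θ hθ, h4 θ hθ]

theorem energy_self_eq_re {μ a b : ℝ} (w w' : ℝ → ℂ) :
    energy μ a b w w' w w' = ((energy μ a b w w' w w').re : ℂ) :=
  (Complex.conj_eq_iff_re.1 (energy_conj μ a b w w' w w').symm).symm

theorem energy_self_nonneg {μ a b : ℝ} (hab : a ≤ b) (w w' : ℝ → ℂ) :
    0 ≤ (energy μ a b w w' w w').re := by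
  have e : energy μ a b w w' w w' =
      ((∫ θ in a..b, (‖w' θ‖ ^ 2 + μ ^ 2 * ‖w θ‖ ^ 2) : ℝ) : ℂ) := by
    rw [energy, ← intervalIntegral.integral_ofReal]
    congr 1
    ext θ
    rw [Complex.mul_conj, Complex.mul_conj, Complex.normSq_eq_norm_sq, Complex.normSq_eq_norm_sq]
    push_cast
    rfl
  rw [e, Complex.ofReal_re]
  exact intervalIntegral.integral_nonneg hab fun θ _ => by positivity

/-! ### Harmonic lifts of the value on the interface -/

/-- `sinh(μ θ) / sinh(μ π / 4)` -/
def liftL (μ θ : ℝ) : ℂ := (Real.sinh (μ * θ) / Real.sinh (μ * (Real.pi / 4)) : ℝ)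

/-- The derivative of `liftL`. -/
def liftL' (μ θ : ℝ) : ℂ := (μ * Real.cosh (μ * θ) / Real.sinh (μ * (Real.pi / 4)) : ℝ)

/-- `sinh(μ (π - θ)) / sinh(3 μ π / 4)` -/
def liftR (μ θ : ℝ) : ℂ :=
  (Real.sinh (μ * (Real.pi - θ)) / Real.sinh (μ * (Real.pi - Real.pi / 4)) : ℝ)

/-- The derivative of `liftR`. -/
def liftR' (μ θ : ℝ) : ℂ :=
  (-(μ * Real.cosh (μ * (Real.pi - θ))) / Real.sinh (μ * (Real.pi - Real.pi / 4)) : ℝ)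

/-- The energy `μ coth(μ π / 4)` of `liftL`. -/
def energyL (μ : ℝ) : ℝ :=
  μ * Real.cosh (μ * (Real.pi / 4)) / Real.sinh (μ * (Real.pi / 4))

/-- The energy `μ coth(3 μ π / 4)` of `liftR`. -/
def energyR (μ : ℝ) : ℝ :=
  μ * Real.cosh (μ * (Real.pi - Real.pi / 4)) / Real.sinh (μ * (Real.pi - Real.pi / 4))

theorem isPair_liftL (μ : ℝ) : IsPair (liftL μ) (liftL' μ) := by
  refine isPair_of_continuous ?_ ?_
  · unfold liftL
    fun_prop
  · unfold liftL'
    fun_prop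

theorem isPair_liftR (μ : ℝ) : IsPair (liftR μ) (liftR' μ) := by
  refine isPair_of_continuous ?_ ?_
  · unfold liftR
    fun_prop
  · unfold liftR'
    fun_prop

theorem hasDerivAt_liftL (μ θ : ℝ) : HasDerivAt (liftL μ) (liftL' μ θ) θ := by
  have h : HasDerivAt (fun θ : ℝ => Real.sinh (μ * θ)) (Real.cosh (μ * θ) * (μ * 1)) θ :=
    ((hasDerivAt_id θ).const_mul μ).sinh
  refine HasDerivAt.congr_deriv (f := liftL μ) (h.div_const (Real.sinh (μ * (Real.pi / 4)))).ofReal_comp ?_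
  rw [liftL']
  congr 1
  ring

theorem hasDerivAt_liftL' (μ θ : ℝ) : HasDerivAt (liftL' μ) ((μ : ℂ) ^ 2 * liftL μ θ) θ := by
  have h : HasDerivAt (fun θ : ℝ => μ * Real.cosh (μ * θ)) (μ * (Real.sinh (μ * θ) * (μ * 1))) θ :=
    (((hasDerivAt_id θ).const_mul μ).cosh).const_mul μ
  refine HasDerivAt.congr_deriv (f := liftL' μ) (h.div_const (Real.sinh (μ * (Real.pi / 4)))).ofReal_comp ?_
  rw [liftL]
  push_cast
  ring

theorem hasDerivAt_liftR (μ θ : ℝ) : HasDerivAt (liftR μ) (liftR' μ θ) θ := by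
  have h : HasDerivAt (fun θ : ℝ => Real.sinh (μ * (Real.pi - θ)))
      (Real.cosh (μ * (Real.pi - θ)) * (μ * (-1))) θ :=
    (((hasDerivAt_id θ).const_sub Real.pi).const_mul μ).sinh
  refine HasDerivAt.congr_deriv (f := liftR μ) (h.div_const (Real.sinh (μ * (Real.pi - Real.pi / 4)))).ofReal_comp ?_
  rw [liftR']
  congr 1
  ring

theorem hasDerivAt_liftR' (μ θ : ℝ) : HasDerivAt (liftR' μ) ((μ : ℂ) ^ 2 * liftR μ θ) θ := by
  have h : HasDerivAt (fun θ : ℝ => -(μ * Real.cosh (μ * (Real.pi - θ))))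
      (-(μ * (Real.sinh (μ * (Real.pi - θ)) * (μ * (-1))))) θ :=
    ((((hasDerivAt_id θ).const_sub Real.pi).const_mul μ).cosh.const_mul μ).neg
  refine HasDerivAt.congr_deriv (f := liftR' μ) (h.div_const (Real.sinh (μ * (Real.pi - Real.pi / 4)))).ofReal_comp ?_
  rw [liftR]
  push_cast
  ring

theorem conj_liftL (μ θ : ℝ) : starRingEnd ℂ (liftL μ θ) = liftL μ θ := Complex.conj_ofReal _

theorem conj_liftL' (μ θ : ℝ) : starRingEnd ℂ (liftL' μ θ) = liftL' μ θ := Complex.conj_ofReal _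

theorem conj_liftR (μ θ : ℝ) : starRingEnd ℂ (liftR μ θ) = liftR μ θ := Complex.conj_ofReal _

theorem conj_liftR' (μ θ : ℝ) : starRingEnd ℂ (liftR' μ θ) = liftR' μ θ := Complex.conj_ofReal _

theorem zero_mem_Icc_pi : (0 : ℝ) ∈ Icc 0 Real.pi := left_mem_Icc.2 Real.pi_pos.le

theorem pi_mem_Icc_pi : Real.pi ∈ Icc 0 Real.pi := right_mem_Icc.2 Real.pi_pos.le

theorem quarter_pi_mem : Real.pi / 4 ∈ Icc 0 Real.pi := by
  constructor <;> linarith [Real.pi_pos]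

/-- The lift solves `y'' = μ² y`, so the integrand is the derivative of `w · liftL'` and only the
interface term survives. In particular the lift is orthogonal to every profile vanishing at the
interface. -/
theorem energy_liftL (μ : ℝ) {w w' : ℝ → ℂ} (h : IsPair w w')
    (hd : ∀ x ∈ Ioo 0 (Real.pi / 4), HasDerivAt w (w' x) x) (h0 : w 0 = 0) :
    energy μ 0 (Real.pi / 4) w w' (liftL μ) (liftL' μ) = w (Real.pi / 4) * energyL μ := by
  have hpi := Real.pi_pos
  rw [energy, intervalIntegral.integral_eq_sub_of_hasDerivAt_of_le (f := fun θ => w θ * liftL' μ θ)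
    (by linarith) ?_ ?_ (h.intervalIntegrable_energy (isPair_liftL μ) μ zero_mem_Icc_pi
      quarter_pi_mem), h0, zero_mul, sub_zero]
  · rfl
  · exact (h.cont.mul (continuous_iff_continuousAt.2 fun x => (hasDerivAt_liftL' μ x).continuousAt)).continuousOn
  · intro x hx
    refine ((hd x hx).mul (hasDerivAt_liftL' μ x)).congr_deriv ?_
    rw [conj_liftL, conj_liftL']
    ring

theorem energy_liftR (μ : ℝ) {w w' : ℝ → ℂ} (h : IsPair w w')
    (hd : ∀ x ∈ Ioo (Real.pi / 4) Real.pi, HasDerivAt w (w' x) x) (h0 : w Real.pi = 0) :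
    energy μ (Real.pi / 4) Real.pi w w' (liftR μ) (liftR' μ) = w (Real.pi / 4) * energyR μ := by
  have hpi := Real.pi_pos
  rw [energy, intervalIntegral.integral_eq_sub_of_hasDerivAt_of_le (f := fun θ => w θ * liftR' μ θ)
    (by linarith) ?_ ?_ (h.intervalIntegrable_energy (isPair_liftR μ) μ quarter_pi_mem
      pi_mem_Icc_pi), h0, zero_mul, zero_sub]
  · rw [liftR', energyR]
    push_cast
    ring
  · exact (h.cont.mul (continuous_iff_continuousAt.2 fun x => (hasDerivAt_liftR' μ x).continuousAt)).continuousOn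
  · intro x hx
    refine ((hd x hx).mul (hasDerivAt_liftR' μ x)).congr_deriv ?_
    rw [conj_liftR, conj_liftR']
    ring

theorem liftL_quarter_pi {μ : ℝ} (hμ : 0 < μ) : liftL μ (Real.pi / 4) = 1 := by
  have hpi := Real.pi_pos
  rw [liftL, div_self (Real.sinh_pos_iff.2 (by positivity)).ne', Complex.ofReal_one]

theorem liftR_quarter_pi {μ : ℝ} (hμ : 0 < μ) : liftR μ (Real.pi / 4) = 1 := by
  have hpi : 0 < Real.pi - Real.pi / 4 := by linarith [Real.pi_pos]
  rw [liftR, div_self (Real.sinh_pos_iff.2 (by positivity)).ne', Complex.ofReal_one]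

theorem liftL_zero (μ : ℝ) : liftL μ 0 = 0 := by simp [liftL]

theorem liftR_pi (μ : ℝ) : liftR μ Real.pi = 0 := by simp [liftR]

theorem energyL_pos {μ : ℝ} (hμ : 0 < μ) : 0 < energyL μ := by
  have hpi := Real.pi_pos
  have := Real.sinh_pos_iff.2 (by positivity : 0 < μ * (Real.pi / 4))
  have := Real.cosh_pos (μ * (Real.pi / 4))
  rw [energyL]
  positivity

theorem energyR_pos {μ : ℝ} (hμ : 0 < μ) : 0 < energyR μ := by
  have hpi : 0 < Real.pi - Real.pi / 4 := by linarith [Real.pi_pos]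
  have := Real.sinh_pos_iff.2 (by positivity : 0 < μ * (Real.pi - Real.pi / 4))
  have := Real.cosh_pos (μ * (Real.pi - Real.pi / 4))
  rw [energyR]
  positivity

/-- Dirichlet's principle: the gap between the two sides is the energy of `w - w(π/4) · liftL`,
which is nonnegative. -/
theorem energyL_le {μ : ℝ} (hμ : 0 < μ) {w w' : ℝ → ℂ} (h : IsPair w w')
    (hd : ∀ x ∈ Ioo 0 (Real.pi / 4), HasDerivAt w (w' x) x) (h0 : w 0 = 0) :
    ‖w (Real.pi / 4)‖ ^ 2 * energyL μ ≤ (energy μ 0 (Real.pi / 4) w w' w w').re := by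
  have e1 := energy_liftL μ h hd h0
  have e2 := energy_liftL μ (isPair_liftL μ) (fun x _ => hasDerivAt_liftL μ x) (liftL_zero μ)
  rw [liftL_quarter_pi hμ, one_mul] at e2
  have e3 := energy_linear_self h (isPair_liftL μ) 1 (-w (Real.pi / 4)) μ zero_mem_Icc_pi
    quarter_pi_mem
  have e4 := energy_self_nonneg (μ := μ) (a := 0) (b := Real.pi / 4) (by linarith [Real.pi_pos])
    ((1 : ℂ) • w + (-w (Real.pi / 4)) • liftL μ) ((1 : ℂ) • w' + (-w (Real.pi / 4)) • liftL' μ)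
  rw [e3, e1, e2] at e4
  have hn : w (Real.pi / 4) * starRingEnd ℂ (w (Real.pi / 4)) = ((‖w (Real.pi / 4)‖ ^ 2 : ℝ) : ℂ) := by
    rw [Complex.mul_conj, Complex.normSq_eq_norm_sq]
  have e5 : 1 * starRingEnd ℂ 1 * energy μ 0 (Real.pi / 4) w w' w w' +
      1 * starRingEnd ℂ (-w (Real.pi / 4)) * (w (Real.pi / 4) * energyL μ) +
      -w (Real.pi / 4) * starRingEnd ℂ 1 * starRingEnd ℂ (w (Real.pi / 4) * energyL μ) +
      -w (Real.pi / 4) * starRingEnd ℂ (-w (Real.pi / 4)) * energyL μ =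
      energy μ 0 (Real.pi / 4) w w' w w' - ((‖w (Real.pi / 4)‖ ^ 2 * energyL μ : ℝ) : ℂ) := by
    rw [Complex.ofReal_mul, ← hn]
    simp only [map_one, map_neg, map_mul, Complex.conj_ofReal]
    ring
  rw [e5, Complex.sub_re, Complex.ofReal_re] at e4
  linarith

theorem energyR_le {μ : ℝ} (hμ : 0 < μ) {w w' : ℝ → ℂ} (h : IsPair w w')
    (hd : ∀ x ∈ Ioo (Real.pi / 4) Real.pi, HasDerivAt w (w' x) x) (h0 : w Real.pi = 0) :
    ‖w (Real.pi / 4)‖ ^ 2 * energyR μ ≤ (energy μ (Real.pi / 4) Real.pi w w' w w').re := by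
  have e1 := energy_liftR μ h hd h0
  have e2 := energy_liftR μ (isPair_liftR μ) (fun x _ => hasDerivAt_liftR μ x) (liftR_pi μ)
  rw [liftR_quarter_pi hμ, one_mul] at e2
  have e3 := energy_linear_self h (isPair_liftR μ) 1 (-w (Real.pi / 4)) μ quarter_pi_mem
    pi_mem_Icc_pi
  have e4 := energy_self_nonneg (μ := μ) (a := Real.pi / 4) (b := Real.pi)
    (by linarith [Real.pi_pos])
    ((1 : ℂ) • w + (-w (Real.pi / 4)) • liftR μ) ((1 : ℂ) • w' + (-w (Real.pi / 4)) • liftR' μ)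
  rw [e3, e1, e2] at e4
  have hn : w (Real.pi / 4) * starRingEnd ℂ (w (Real.pi / 4)) = ((‖w (Real.pi / 4)‖ ^ 2 : ℝ) : ℂ) := by
    rw [Complex.mul_conj, Complex.normSq_eq_norm_sq]
  have e5 : 1 * starRingEnd ℂ 1 * energy μ (Real.pi / 4) Real.pi w w' w w' +
      1 * starRingEnd ℂ (-w (Real.pi / 4)) * (w (Real.pi / 4) * energyR μ) +
      -w (Real.pi / 4) * starRingEnd ℂ 1 * starRingEnd ℂ (w (Real.pi / 4) * energyR μ) +
      -w (Real.pi / 4) * starRingEnd ℂ (-w (Real.pi / 4)) * energyR μ =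
      energy μ (Real.pi / 4) Real.pi w w' w w' -
        ((‖w (Real.pi / 4)‖ ^ 2 * energyR μ : ℝ) : ℂ) := by
    rw [Complex.ofReal_mul, ← hn]
    simp only [map_one, map_neg, map_mul, Complex.conj_ofReal]
    ring
  rw [e5, Complex.sub_re, Complex.ofReal_re] at e4
  linarith

/-! ### Gluing along the interface -/

/-- The function equal to `f` for `θ ≤ π / 4` and to `g` for `θ > π / 4`. -/
def glue (f g : ℝ → ℂ) (θ : ℝ) : ℂ := if θ ≤ Real.pi / 4 then f θ else g θ

theorem glue_of_mem_left {f g : ℝ → ℂ} {θ : ℝ} (h : θ ∈ Ioo 0 (Real.pi / 4)) :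
    glue f g θ = f θ := if_pos h.2.le

theorem glue_of_mem_right {f g : ℝ → ℂ} {θ : ℝ} (h : θ ∈ Ioo (Real.pi / 4) Real.pi) :
    glue f g θ = g θ := if_neg (not_le.2 h.1)

theorem isAngular_glue {f f' g g' : ℝ → ℂ} (hf : IsPair f f') (hg : IsPair g g')
    (df : ∀ x ∈ Ioo 0 (Real.pi / 4), HasDerivAt f (f' x) x)
    (dg : ∀ x ∈ Ioo (Real.pi / 4) Real.pi, HasDerivAt g (g' x) x) (f0 : f 0 = 0)
    (g0 : g Real.pi = 0) (hfg : f (Real.pi / 4) = g (Real.pi / 4)) :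
    IsAngular (glue f g) (glue f' g') where
  cont := by
    refine Continuous.if_le hf.cont hg.cont continuous_id continuous_const fun x hx => ?_
    rw [show x = Real.pi / 4 from hx, hfg]
  meas := Measurable.ite measurableSet_Iic hf.meas hg.meas
  bdd := by
    obtain ⟨C, hC⟩ := hf.bdd
    obtain ⟨D, hD⟩ := hg.bdd
    refine ⟨max C D, fun x hx => ?_⟩
    rw [glue]
    split_ifs
    · exact (hC x hx).trans (le_max_left _ _)
    · exact (hD x hx).trans (le_max_right _ _)
  deriv x hx hx' := by
    rcases lt_or_gt_of_ne hx' with h | h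
    · rw [glue_of_mem_left ⟨hx.1, h⟩]
      refine (df x ⟨hx.1, h⟩).congr_of_eventuallyEq ?_
      filter_upwards [isOpen_Ioo.mem_nhds (⟨hx.1, h⟩ : x ∈ Ioo 0 (Real.pi / 4))] with y hy
      exact glue_of_mem_left hy
    · rw [glue_of_mem_right ⟨h, hx.2⟩]
      refine (dg x ⟨h, hx.2⟩).congr_of_eventuallyEq ?_
      filter_upwards [isOpen_Ioo.mem_nhds (⟨h, hx.2⟩ : x ∈ Ioo (Real.pi / 4) Real.pi)] with y hy
      exact glue_of_mem_right hy
  left := by rw [glue, if_pos (by linarith [Real.pi_pos]), f0]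
  right := by rw [glue, if_neg (by linarith [Real.pi_pos]), g0]

theorem isAngular_lift {μ : ℝ} (hμ : 0 < μ) :
    IsAngular (glue (liftL μ) (liftR μ)) (glue (liftL' μ) (liftR' μ)) :=
  isAngular_glue (isPair_liftL μ) (isPair_liftR μ) (fun x _ => hasDerivAt_liftL μ x)
    (fun x _ => hasDerivAt_liftR μ x) (liftL_zero μ) (liftR_pi μ)
    (by rw [liftL_quarter_pi hμ, liftR_quarter_pi hμ])

theorem IsAngular.deriv_left {w w' : ℝ → ℂ} (h : IsAngular w w') :
    ∀ x ∈ Ioo 0 (Real.pi / 4), HasDerivAt w (w' x) x :=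
  fun x hx => h.deriv x ⟨hx.1, by linarith [hx.2, Real.pi_pos]⟩ hx.2.ne

theorem IsAngular.deriv_right {w w' : ℝ → ℂ} (h : IsAngular w w') :
    ∀ x ∈ Ioo (Real.pi / 4) Real.pi, HasDerivAt w (w' x) x :=
  fun x hx => h.deriv x ⟨by linarith [hx.1, Real.pi_pos], hx.2⟩ hx.1.ne'

/-- The sign change that makes the angular form coercive: the part of `w` that vanishes on the
interface is multiplied by `-1` on the left and by `1` on the right, and the harmonic lift of the
value on the interface is multiplied by `ε`. -/
theorem IsAngular.exists_flip {μ : ℝ} (hμ : 0 < μ) {w w' : ℝ → ℂ} (h : IsAngular w w') {ε : ℝ}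
    (hε : ε ^ 2 = 1) :
    ∃ v v', IsAngular v v' ∧
      energy μ 0 (Real.pi / 4) v v' v v' = energy μ 0 (Real.pi / 4) w w' w w' ∧
      energy μ (Real.pi / 4) Real.pi v v' v v' = energy μ (Real.pi / 4) Real.pi w w' w w' ∧
      energy μ 0 (Real.pi / 4) w w' v v' = -energy μ 0 (Real.pi / 4) w w' w w' +
        ((1 + ε) * (‖w (Real.pi / 4)‖ ^ 2 * energyL μ) : ℝ) ∧
      energy μ (Real.pi / 4) Real.pi w w' v v' = energy μ (Real.pi / 4) Real.pi w w' w w' +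
        ((ε - 1) * (‖w (Real.pi / 4)‖ ^ 2 * energyR μ) : ℝ) := by
  have hpi := Real.pi_pos
  set c := w (Real.pi / 4) with hc
  have hL := isPair_liftL μ
  have hR := isPair_liftR μ
  have hw := h.toIsPair
  have eL1 := energy_liftL μ hw h.deriv_left h.left
  have eL2 := energy_liftL μ hL (fun x _ => hasDerivAt_liftL μ x) (liftL_zero μ)
  have eR1 := energy_liftR μ hw h.deriv_right h.right
  have eR2 := energy_liftR μ hR (fun x _ => hasDerivAt_liftR μ x) (liftR_pi μ)
  rw [liftL_quarter_pi hμ, one_mul] at eL2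
  rw [liftR_quarter_pi hμ, one_mul] at eR2
  have hn : c * starRingEnd ℂ c = ((‖c‖ ^ 2 : ℝ) : ℂ) := by
    rw [Complex.mul_conj, Complex.normSq_eq_norm_sq]
  have hεc : (ε : ℂ) ^ 2 = 1 := by exact_mod_cast hε
  -- Write `w = w₀ + c · lift` on each side. Then `-w₀ + ε c · liftL = -w + (1 + ε) c · liftL`, and
  -- `w₀ + ε c · liftR = w + (ε - 1) c · liftR`. Both sides take the value `ε c` at the interface,
  -- so they glue.
  refine ⟨glue ((-1 : ℂ) • w + ((1 + ε) * c) • liftL μ) ((1 : ℂ) • w + ((ε - 1) * c) • liftR μ),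
    glue ((-1 : ℂ) • w' + ((1 + ε) * c) • liftL' μ) ((1 : ℂ) • w' + ((ε - 1) * c) • liftR' μ),
    ?_, ?_, ?_, ?_, ?_⟩
  · refine isAngular_glue ((hw.smul _).add (hL.smul _)) ((hw.smul _).add (hR.smul _)) ?_ ?_ ?_ ?_ ?_
    · exact fun x hx => ((h.deriv_left x hx).const_smul _).add ((hasDerivAt_liftL μ x).const_smul _)
    · exact fun x hx => ((h.deriv_right x hx).const_smul _).add ((hasDerivAt_liftR μ x).const_smul _)
    · simp [h.left, liftL_zero]
    · simp [h.right, liftR_pi]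
    · simp only [Pi.add_apply, Pi.smul_apply, liftL_quarter_pi hμ, liftR_quarter_pi hμ, smul_eq_mul,
        ← hc]
      ring
  · rw [energy_congr (by linarith) (fun _ => glue_of_mem_left) (fun _ => glue_of_mem_left)
      (fun _ => glue_of_mem_left) (fun _ => glue_of_mem_left),
      energy_linear_self hw hL _ _ μ zero_mem_Icc_pi quarter_pi_mem, eL1, eL2]
    simp only [map_one, map_neg, map_mul, map_add, Complex.conj_ofReal]
    linear_combination c * starRingEnd ℂ c * energyL μ * hεc
  · rw [energy_congr (by linarith) (fun _ => glue_of_mem_right) (fun _ => glue_of_mem_right)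
      (fun _ => glue_of_mem_right) (fun _ => glue_of_mem_right),
      energy_linear_self hw hR _ _ μ quarter_pi_mem pi_mem_Icc_pi, eR1, eR2]
    simp only [map_one, map_mul, map_sub, Complex.conj_ofReal]
    linear_combination c * starRingEnd ℂ c * energyR μ * hεc
  · rw [energy_congr (v := w) (v' := w') (by linarith) (fun _ _ => rfl) (fun _ _ => rfl)
      (fun _ => glue_of_mem_left) (fun _ => glue_of_mem_left),
      energy_linear_right hw hw hL _ _ μ zero_mem_Icc_pi quarter_pi_mem, eL1]
    rw [Complex.ofReal_mul, Complex.ofReal_mul, ← hn]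
    simp only [map_one, map_neg, map_mul, map_add, Complex.conj_ofReal]
    push_cast
    ring
  · rw [energy_congr (v := w) (v' := w') (by linarith) (fun _ _ => rfl) (fun _ _ => rfl)
      (fun _ => glue_of_mem_right) (fun _ => glue_of_mem_right),
      energy_linear_right hw hw hR _ _ μ quarter_pi_mem pi_mem_Icc_pi, eR1]
    rw [Complex.ofReal_mul, Complex.ofReal_mul, ← hn]
    simp only [map_one, map_mul, map_sub, Complex.conj_ofReal]
    push_cast
    ring

/-! ### The form on modes -/

theorem integral_cos_eq_zero {a c : ℝ} (hc : c ≠ 0) (h : Real.sin (c * a) = 0) :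
    ∫ s in a..0, Real.cos (c * s) = 0 := by
  rw [intervalIntegral.integral_comp_mul_left _ hc, integral_cos, mul_zero, Real.sin_zero, h]
  simp

theorem freq_pos {δ : ℝ} (hδ : δ ∈ Ioo (0 : ℝ) 1) {k : ℕ} (hk : 1 ≤ k) : 0 < freq δ k := by
  have hl : 0 < -Real.log δ := by linarith [Real.log_neg hδ.1 hδ.2]
  have hpi := Real.pi_pos
  have : (0 : ℝ) < k := by exact_mod_cast hk
  rw [freq]
  positivity

theorem integral_cos_freq_sub {δ : ℝ} (hδ : δ ∈ Ioo (0 : ℝ) 1) (k l : ℕ) :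
    ∫ s in (Real.log δ)..0, Real.cos ((freq δ k - freq δ l) * s) =
      if k = l then -Real.log δ else 0 := by
  have hl : 0 < -Real.log δ := by linarith [Real.log_neg hδ.1 hδ.2]
  split_ifs with h
  · simp [h]
  · refine integral_cos_eq_zero ?_ ?_
    · rw [freq, freq, ← sub_div, ← sub_mul]
      have : (k : ℝ) - l ≠ 0 := sub_ne_zero.2 (by exact_mod_cast h)
      have := Real.pi_ne_zero
      positivity
    · have e : (freq δ k - freq δ l) * Real.log δ = ((l - k : ℤ) : ℝ) * Real.pi := by
        rw [sub_mul, freq_mul_log hδ, freq_mul_log hδ]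
        push_cast
        ring
      rw [e, Real.sin_int_mul_pi]

theorem integral_cos_freq_add {δ : ℝ} (hδ : δ ∈ Ioo (0 : ℝ) 1) {k l : ℕ} (hk : 1 ≤ k)
    (hl : 1 ≤ l) : ∫ s in (Real.log δ)..0, Real.cos ((freq δ k + freq δ l) * s) = 0 := by
  refine integral_cos_eq_zero (add_pos (freq_pos hδ hk) (freq_pos hδ hl)).ne' ?_
  have e : (freq δ k + freq δ l) * Real.log δ = ((-(l + k) : ℤ) : ℝ) * Real.pi := by
    rw [add_mul, freq_mul_log hδ, freq_mul_log hδ]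
    push_cast
    ring
  rw [e, Real.sin_int_mul_pi]

theorem integral_cos_mul_cos {δ : ℝ} (hδ : δ ∈ Ioo (0 : ℝ) 1) {k l : ℕ} (hk : 1 ≤ k)
    (hl : 1 ≤ l) :
    ∫ s in Ioo (Real.log δ) 0, Real.cos (freq δ k * s) * Real.cos (freq δ l * s) =
      if k = l then -Real.log δ / 2 else 0 := by
  have hlog : Real.log δ < 0 := Real.log_neg hδ.1 hδ.2
  rw [← integral_Ioc_eq_integral_Ioo, ← intervalIntegral.integral_of_le hlog.le]
  have e : ∀ s, Real.cos (freq δ k * s) * Real.cos (freq δ l * s) =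
      (1 / 2) * (Real.cos ((freq δ k - freq δ l) * s) + Real.cos ((freq δ k + freq δ l) * s)) := by
    intro s
    rw [sub_mul, add_mul, Real.cos_sub, Real.cos_add]
    ring
  simp_rw [e]
  rw [intervalIntegral.integral_const_mul, intervalIntegral.integral_add
    (Continuous.intervalIntegrable (by fun_prop) _ _)
    (Continuous.intervalIntegrable (by fun_prop) _ _), integral_cos_freq_sub hδ,
    integral_cos_freq_add hδ hk hl]
  split_ifs <;> ring

theorem integral_sin_mul_sin {δ : ℝ} (hδ : δ ∈ Ioo (0 : ℝ) 1) {k l : ℕ} (hk : 1 ≤ k)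
    (hl : 1 ≤ l) :
    ∫ s in Ioo (Real.log δ) 0, Real.sin (freq δ k * s) * Real.sin (freq δ l * s) =
      if k = l then -Real.log δ / 2 else 0 := by
  have hlog : Real.log δ < 0 := Real.log_neg hδ.1 hδ.2
  rw [← integral_Ioc_eq_integral_Ioo, ← intervalIntegral.integral_of_le hlog.le]
  have e : ∀ s, Real.sin (freq δ k * s) * Real.sin (freq δ l * s) =
      (1 / 2) * (Real.cos ((freq δ k - freq δ l) * s) - Real.cos ((freq δ k + freq δ l) * s)) := by
    intro s
    rw [sub_mul, add_mul, Real.cos_sub, Real.cos_add]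
    ring
  simp_rw [e]
  rw [intervalIntegral.integral_const_mul, intervalIntegral.integral_sub
    (Continuous.intervalIntegrable (by fun_prop) _ _)
    (Continuous.intervalIntegrable (by fun_prop) _ _), integral_cos_freq_sub hδ,
    integral_cos_freq_add hδ hk hl]
  split_ifs <;> ring

theorem integral_piecewise_mul (σp σm : ℝ) {g : ℝ → ℂ} (hg : ∀ a ∈ Icc 0 Real.pi,
    ∀ b ∈ Icc 0 Real.pi, IntervalIntegrable g volume a b) :
    IntegrableOn (fun θ => ((if θ < Real.pi / 4 then σm else σp : ℝ) : ℂ) * g θ) (Ioo 0 Real.pi) ∧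
    ∫ θ in Ioo 0 Real.pi, ((if θ < Real.pi / 4 then σm else σp : ℝ) : ℂ) * g θ =
      σm * (∫ θ in 0..(Real.pi / 4), g θ) + σp * ∫ θ in (Real.pi / 4)..Real.pi, g θ := by
  have hpi := Real.pi_pos
  have hi : IntegrableOn g (Ioo 0 Real.pi) :=
    (intervalIntegrable_iff_integrableOn_Ioo_of_le hpi.le).1
      (hg _ zero_mem_Icc_pi _ pi_mem_Icc_pi)
  have hI : IntegrableOn (fun θ => ((if θ < Real.pi / 4 then σm else σp : ℝ) : ℂ) * g θ)
      (Ioo 0 Real.pi) := by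
    refine Integrable.bdd_mul (c := |σm| + |σp|) hi ?_ (Eventually.of_forall fun θ => ?_)
    · refine (Complex.measurable_ofReal.comp ?_).aestronglyMeasurable
      exact Measurable.ite measurableSet_Iio measurable_const measurable_const
    · rw [Complex.norm_real, Real.norm_eq_abs]
      split_ifs
      · linarith [abs_nonneg σp]
      · linarith [abs_nonneg σm]
  refine ⟨hI, ?_⟩
  have hI' : ∀ a ∈ Icc 0 Real.pi, ∀ b ∈ Icc 0 Real.pi, IntervalIntegrable
      (fun θ => ((if θ < Real.pi / 4 then σm else σp : ℝ) : ℂ) * g θ) volume a b := by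
    intro a ha b hb
    have h := (intervalIntegrable_iff_integrableOn_Ioo_of_le hpi.le).2 hI
    exact h.mono_set (by rw [uIcc_of_le hpi.le]; exact uIcc_subset_Icc ha hb)
  rw [← integral_Ioc_eq_integral_Ioo, ← intervalIntegral.integral_of_le hpi.le,
    ← intervalIntegral.integral_add_adjacent_intervals (hI' _ zero_mem_Icc_pi _ quarter_pi_mem)
      (hI' _ quarter_pi_mem _ pi_mem_Icc_pi), ← intervalIntegral.integral_const_mul,
    ← intervalIntegral.integral_const_mul]
  congr 1
  · rw [intervalIntegral.integral_of_le (by linarith), intervalIntegral.integral_of_le (by linarith),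
      integral_Ioc_eq_integral_Ioo, integral_Ioc_eq_integral_Ioo]
    refine setIntegral_congr_fun measurableSet_Ioo fun θ hθ => ?_
    rw [if_pos hθ.2]
  · rw [intervalIntegral.integral_of_le (by linarith), intervalIntegral.integral_of_le (by linarith)]
    refine setIntegral_congr_fun measurableSet_Ioc fun θ hθ => ?_
    rw [if_neg (not_lt.2 hθ.1.le)]

/-- Sines and cosines of distinct frequencies are orthogonal on `(log δ, 0)`, and both have squared
norm `-log δ / 2`. The product of frequencies from the `s`-derivatives becomes the `μ²` of the
angular energy. -/
theorem form_of_isMode {δ : ℝ} (hδ : δ ∈ Ioo (0 : ℝ) 1) (σp σm : ℝ) {k l : ℕ} (hk : 1 ≤ k)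
    (hl : 1 ≤ l) {u v : H10 (dom δ)} {w w' x x' : ℝ → ℂ} (hw : IsPair w w') (hx : IsPair x x')
    (hu : IsMode k u w w') (hv : IsMode l v x x') :
    form δ σp σm u v = ((if k = l then -Real.log δ / 2 else 0 : ℝ) : ℂ) *
      (σm * energy (freq δ k) 0 (Real.pi / 4) w w' x x' +
        σp * energy (freq δ k) (Real.pi / 4) Real.pi w w' x x') := by
  have hI1 : ∀ a ∈ Icc 0 Real.pi, ∀ b ∈ Icc 0 Real.pi,
      IntervalIntegrable (fun θ => w' θ * starRingEnd ℂ (x' θ)) volume a b := fun a ha b hb =>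
    (hw.intervalIntegrable_mul_conj hx ha hb).1
  have hI2 : ∀ a ∈ Icc 0 Real.pi, ∀ b ∈ Icc 0 Real.pi,
      IntervalIntegrable (fun θ => w θ * starRingEnd ℂ (x θ)) volume a b := fun a ha b hb =>
    (hw.intervalIntegrable_mul_conj hx ha hb).2
  obtain ⟨J1, E1⟩ := integral_piecewise_mul σp σm hI1
  obtain ⟨J2, E2⟩ := integral_piecewise_mul σp σm hI2
  have hcont : ∀ f : ℝ → ℂ, Continuous f → IntegrableOn f (Ioo (Real.log δ) 0) := fun f hf =>
    (hf.continuousOn.integrableOn_compact isCompact_Icc).mono_set Ioo_subset_Icc_self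
  have K1 := hcont (fun s => ((Real.sin (freq δ k * s) * Real.sin (freq δ l * s) : ℝ) : ℂ))
    (by fun_prop)
  have K2 := hcont (fun s => ((freq δ k * freq δ l *
    (Real.cos (freq δ k * s) * Real.cos (freq δ l * s)) : ℝ) : ℂ)) (by fun_prop)
  have M1 := integrableOn_rect_prod (δ := δ) K1 J1
  have M2 := integrableOn_rect_prod (δ := δ) K2 J2
  have p1 := setIntegral_prod_mul (μ := volume) (ν := volume) (L := ℂ)
    (fun s => ((Real.sin (freq δ k * s) * Real.sin (freq δ l * s) : ℝ) : ℂ))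
    (fun θ => ((if θ < Real.pi / 4 then σm else σp : ℝ) : ℂ) * (w' θ * starRingEnd ℂ (x' θ)))
    (Ioo (Real.log δ) 0) (Ioo 0 Real.pi)
  have p2 := setIntegral_prod_mul (μ := volume) (ν := volume) (L := ℂ)
    (fun s => ((freq δ k * freq δ l *
      (Real.cos (freq δ k * s) * Real.cos (freq δ l * s)) : ℝ) : ℂ))
    (fun θ => ((if θ < Real.pi / 4 then σm else σp : ℝ) : ℂ) * (w θ * starRingEnd ℂ (x θ)))
    (Ioo (Real.log δ) 0) (Ioo 0 Real.pi)
  rw [← Measure.volume_eq_prod] at p1 p2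
  have q1 := integral_ofReal (𝕜 := ℂ) (μ := volume.restrict (Ioo (Real.log δ) 0))
    (f := fun s => Real.sin (freq δ k * s) * Real.sin (freq δ l * s))
  have q2 := integral_ofReal (𝕜 := ℂ) (μ := volume.restrict (Ioo (Real.log δ) 0))
    (f := fun s => freq δ k * freq δ l * (Real.cos (freq δ k * s) * Real.cos (freq δ l * s)))
  rw [integral_sin_mul_sin hδ hk hl] at q1
  rw [integral_const_mul, integral_cos_mul_cos hδ hk hl] at q2
  have key : form δ σp σm u v = ∫ p in rect δ,
      (((Real.sin (freq δ k * p.1) * Real.sin (freq δ l * p.1) : ℝ) : ℂ) *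
        (((if p.2 < Real.pi / 4 then σm else σp : ℝ) : ℂ) * (w' p.2 * starRingEnd ℂ (x' p.2))) +
      ((freq δ k * freq δ l * (Real.cos (freq δ k * p.1) * Real.cos (freq δ l * p.1)) : ℝ) : ℂ) *
        (((if p.2 < Real.pi / 4 then σm else σp : ℝ) : ℂ) *
          (w p.2 * starRingEnd ℂ (x p.2)))) := by
    rw [hu.form_eq hδ.1 σp σm hv]
    congr 1
    ext p
    simp only [map_mul, Complex.conj_ofReal, Complex.ofReal_mul]
    ring
  rw [key, integral_add M1 M2, rect, p1, p2, E1, E2]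
  erw [q1, q2]
  rw [energy, energy, intervalIntegral.integral_add (hI1 _ zero_mem_Icc_pi _ quarter_pi_mem)
    ((hI2 _ zero_mem_Icc_pi _ quarter_pi_mem).const_mul _),
    intervalIntegral.integral_add (hI1 _ quarter_pi_mem _ pi_mem_Icc_pi)
    ((hI2 _ quarter_pi_mem _ pi_mem_Icc_pi).const_mul _), intervalIntegral.integral_const_mul,
    intervalIntegral.integral_const_mul]
  by_cases hkl : k = l
  · subst hkl
    simp only [if_true, Complex.ofReal_mul, Complex.coe_algebraMap]
    ring
  · simp [hkl]

theorem form_eq_zero_of_modeSpace_ne {δ : ℝ} (hδ : δ ∈ Ioo (0 : ℝ) 1) (σp σm : ℝ) {k l : ℕ}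
    (hk : 1 ≤ k) (hl : 1 ≤ l) (hkl : k ≠ l) {u v : H10 (dom δ)} (hu : u ∈ modeSpace hδ k)
    (hv : v ∈ modeSpace hδ l) : form δ σp σm u v = 0 := by
  obtain ⟨w, w', hw, hu⟩ := hu
  obtain ⟨x, x', hx, hv⟩ := hv
  rw [form_of_isMode hδ σp σm hk hl hw.toIsPair hx.toIsPair hu hv, if_neg hkl]
  simp

/-- With `X`, `Y` the energies of `w` on the two sides and `N = |w(π/4)|²`, the flipped form is
proportional to `-σ₋ (X - N E_L) + σ₊ (Y - N E_R) + N |σ₋ E_L + σ₊ E_R|`. The three hypotheses on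
`c` bound the three terms separately, with sum `c (X + Y)`. -/
theorem exists_flip_of_mem_modeSpace {δ : ℝ} (hδ : δ ∈ Ioo (0 : ℝ) 1) {σp σm : ℝ} {k : ℕ}
    (hk : 1 ≤ k) {c : ℝ} (hp : c ≤ σp) (hm : c ≤ -σm)
    (hc : c * (energyL (freq δ k) + energyR (freq δ k)) ≤
      |σm * energyL (freq δ k) + σp * energyR (freq δ k)|)
    {u : H10 (dom δ)} (hu : u ∈ modeSpace hδ k) :
    ∃ v ∈ modeSpace hδ k, form δ 1 1 v v = form δ 1 1 u u ∧
      c * (form δ 1 1 u u).re ≤ (form δ σp σm u v).re := by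
  obtain ⟨w, w', hw, hu⟩ := hu
  have hμ := freq_pos hδ hk
  have hl : 0 < -Real.log δ := by linarith [Real.log_neg hδ.1 hδ.2]
  set μ := freq δ k with hμdef
  set d := σm * energyL μ + σp * energyR μ with hd
  -- `ε` is the sign of the form on the lift; it may differ from one mode to another.
  obtain ⟨ε, hε, hεd⟩ : ∃ ε : ℝ, ε ^ 2 = 1 ∧ ε * d = |d| := by
    rcases le_total 0 d with h | h
    · exact ⟨1, by norm_num, by rw [abs_of_nonneg h, one_mul]⟩
    · exact ⟨-1, by norm_num, by rw [abs_of_nonpos h]; ring⟩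
  obtain ⟨v, v', hv, e1, e2, e3, e4⟩ := hw.exists_flip hμ hε
  obtain ⟨z, hz⟩ := exists_isMode hδ k hv
  refine ⟨z, ⟨v, v', hv, hz⟩, ?_, ?_⟩
  · rw [form_of_isMode hδ 1 1 hk hk hv.toIsPair hv.toIsPair hz hz,
      form_of_isMode hδ 1 1 hk hk hw.toIsPair hw.toIsPair hu hu, ← hμdef, e1, e2]
  · rw [form_of_isMode hδ 1 1 hk hk hw.toIsPair hw.toIsPair hu hu,
      form_of_isMode hδ σp σm hk hk hw.toIsPair hv.toIsPair hu hz, ← hμdef, e3, e4, if_pos rfl]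
    have n1 := energyL_le hμ hw.toIsPair hw.deriv_left hw.left
    have n2 := energyR_le hμ hw.toIsPair hw.deriv_right hw.right
    rw [energy_self_eq_re (a := 0) w w', energy_self_eq_re (b := Real.pi) w w']
    set X := (energy μ 0 (Real.pi / 4) w w' w w').re
    set Y := (energy μ (Real.pi / 4) Real.pi w w' w w').re
    set N := ‖w (Real.pi / 4)‖ ^ 2 with hN
    have hN0 : 0 ≤ N := by positivity
    have r1 : ((-Real.log δ / 2 : ℝ) : ℂ) * (((1 : ℝ) : ℂ) * X + ((1 : ℝ) : ℂ) * Y) =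
        ((-Real.log δ / 2 * (X + Y) : ℝ) : ℂ) := by
      push_cast
      ring
    have r2 : ((-Real.log δ / 2 : ℝ) : ℂ) * ((σm : ℂ) * (-(X : ℂ) +
        ((1 + ε) * (N * energyL μ) : ℝ)) + (σp : ℂ) * ((Y : ℂ) +
        ((ε - 1) * (N * energyR μ) : ℝ))) =
        ((-Real.log δ / 2 * (σm * (-X + (1 + ε) * (N * energyL μ)) +
          σp * (Y + (ε - 1) * (N * energyR μ))) : ℝ) : ℂ) := by
      push_cast
      ring
    rw [r1, r2, Complex.ofReal_re, Complex.ofReal_re, mul_left_comm]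
    refine mul_le_mul_of_nonneg_left ?_ (by positivity)
    have f1 := mul_le_mul_of_nonneg_right hm (sub_nonneg.2 n1)
    have f2 := mul_le_mul_of_nonneg_right hp (sub_nonneg.2 n2)
    have f3 := mul_le_mul_of_nonneg_left hc hN0
    rw [← hεd, hd] at f3
    nlinarith

/-! ### Lower bound for the operator -/

theorem form_eq_A (δ σp σm : ℝ) (u v : H10 (dom δ)) : form δ σp σm u v = A δ σp σm u v := rfl

theorem form_one_one_self {δ : ℝ} (hδ : δ ∈ Ioo (0 : ℝ) 1) (u : H10 (dom δ)) :
    form δ 1 1 u u = ((‖wgrad u‖ ^ 2 : ℝ) : ℂ) := by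
  have h : form δ 1 1 u u = inner ℂ (wgrad u) (wgrad u) := by
    rw [L2.inner_def, form]
    refine integral_congr_ae ?_
    refine ae_dom_of_ae_rect hδ.1 (P := fun x => ((coeff δ 1 1 x : ℝ) : ℂ) * inner ℂ (wgrad u x) (wgrad u x)
      = inner ℂ (wgrad u x) (wgrad u x)) ?_
    filter_upwards [ae_rect_snd_ne δ (Real.pi / 4), ae_restrict_mem (measurableSet_rect δ)]
      with p hne hmem
    rw [coeff_logPolar hδ.1 1 1 hmem hne]
    simp
  rw [h, inner_self_eq_norm_sq_to_K]
  push_cast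
  rfl

/-- A finite sum of modes is flipped mode by mode. Different modes are orthogonal both for the form
and for the gradient inner product, so norms and lower bounds add up. -/
theorem exists_lower_bound_of_mem_iSup {δ : ℝ} (hδ : δ ∈ Ioo (0 : ℝ) 1) {σp σm : ℝ}
    {c : ℝ} (hp : c ≤ σp) (hm : c ≤ -σm)
    (hc : ∀ k : ℕ, 1 ≤ k → c * (energyL (freq δ k) + energyR (freq δ k)) ≤
      |σm * energyL (freq δ k) + σp * energyR (freq δ k)|)
    {u : H10 (dom δ)} (hu : u ∈ ⨆ k : ℕ, modeSpace hδ (k + 1)) :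
    ∃ v : H10 (dom δ), ‖wgrad v‖ = ‖wgrad u‖ ∧ c * ‖wgrad u‖ ^ 2 ≤ (A δ σp σm u v).re := by
  classical
  obtain ⟨f, hf, rfl⟩ := (Submodule.mem_iSup_iff_exists_finsupp _ _).1 hu
  choose g hg g1 g2 using fun k : ℕ =>
    exists_flip_of_mem_modeSpace hδ (σp := σp) (σm := σm) (Nat.le_add_left 1 k) hp hm
      (hc (k + 1) (Nat.le_add_left 1 k)) (hf k)
  have diag : ∀ (τp τm : ℝ) (x y : ℕ → H10 (dom δ)), (∀ k, x k ∈ modeSpace hδ (k + 1)) →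
      (∀ k, y k ∈ modeSpace hδ (k + 1)) →
      A δ τp τm (∑ k ∈ f.support, x k) (∑ k ∈ f.support, y k) =
        ∑ k ∈ f.support, form δ τp τm (x k) (y k) := by
    intro τp τm x y hx hy
    rw [map_sum]
    refine Finset.sum_congr rfl fun l hl => ?_
    rw [map_sum, sum_apply]
    refine Finset.sum_eq_single l (fun k _ hkl => ?_) (fun h => absurd hl h)
    exact form_eq_zero_of_modeSpace_ne hδ τp τm (Nat.le_add_left 1 k) (Nat.le_add_left 1 l)
      (by omega) (hx k) (hy l)
  have hsum : (f.sum fun _ x => x) = ∑ k ∈ f.support, f k := rfl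
  rw [hsum]
  set u := ∑ k ∈ f.support, f k with hu
  have hB : ∀ x : ℕ → H10 (dom δ), (∀ k, x k ∈ modeSpace hδ (k + 1)) →
      ‖wgrad (∑ k ∈ f.support, x k)‖ ^ 2 = (∑ k ∈ f.support, form δ 1 1 (x k) (x k)).re := by
    intro x hx
    rw [← diag 1 1 x x hx hx, ← form_eq_A, form_one_one_self hδ, Complex.ofReal_re]
  refine ⟨∑ k ∈ f.support, g k, ?_, ?_⟩
  · have : ‖wgrad (∑ k ∈ f.support, g k)‖ ^ 2 = ‖wgrad u‖ ^ 2 := by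
      rw [hB g hg, hu, hB f hf, Finset.sum_congr rfl fun k _ => g1 k]
    exact (pow_left_inj₀ (norm_nonneg _) (norm_nonneg _) two_ne_zero).1 this
  · rw [hu, hB f hf, diag σp σm f g hf hg, Complex.re_sum, Complex.re_sum, Finset.mul_sum]
    exact Finset.sum_le_sum fun k _ => g2 k

/-- The estimate is a closed condition on `u`, so it passes from finite sums of modes to all of
`H¹₀`. No flip operator on the whole space is needed. -/
theorem exists_norm_le_norm_A {δ : ℝ} (hδ : δ ∈ Ioo (0 : ℝ) 1) {σp σm : ℝ}
    {c : ℝ} (hc0 : 0 < c) (hp : c ≤ σp) (hm : c ≤ -σm)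
    (hc : ∀ k : ℕ, 1 ≤ k → c * (energyL (freq δ k) + energyR (freq δ k)) ≤
      |σm * energyL (freq δ k) + σp * energyR (freq δ k)|) :
    ∃ K : ℝ, 0 < K ∧ ∀ u : H10 (dom δ), ‖u‖ ≤ K * ‖A δ σp σm u‖ := by
  obtain ⟨C, hC0, hC⟩ := exists_norm_le_wgrad hδ.1
  refine ⟨C * (C / c), by positivity, fun u => ?_⟩
  have hcl : IsClosed {u : H10 (dom δ) | ‖u‖ ≤ C * (C / c) * ‖A δ σp σm u‖} :=
    have hA : Continuous fun u => ‖A δ σp σm u‖ :=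
      (continuous_norm (E := HNeg1 (dom δ))).comp (A δ σp σm).continuous
    isClosed_le continuous_norm (continuous_const.mul hA)
  have hu : u ∈ closure ((⨆ k : ℕ, modeSpace hδ (k + 1) : Submodule ℂ (H10 (dom δ))) : Set _) := by
    rw [← Submodule.topologicalClosure_coe, dense_iSup_modeSpace hδ]
    trivial
  refine closure_minimal (fun u hu => ?_) hcl hu
  obtain ⟨v, hv, hle⟩ := exists_lower_bound_of_mem_iSup hδ hp hm hc hu
  have h1 : (A δ σp σm u v).re ≤ ‖A δ σp σm u‖ * (C * ‖wgrad u‖) :=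
    calc (A δ σp σm u v).re ≤ ‖A δ σp σm u v‖ := Complex.re_le_norm _
      _ ≤ ‖A δ σp σm u‖ * ‖v‖ := ContinuousLinearMap.le_opNorm _ _
      _ ≤ ‖A δ σp σm u‖ * (C * ‖wgrad v‖) := by
          gcongr
          exact hC v
      _ = _ := by rw [hv]
  have h2 : ‖wgrad u‖ ≤ C / c * ‖A δ σp σm u‖ := by
    rcases (norm_nonneg (wgrad u)).eq_or_lt with h0 | h0
    · rw [← h0]
      positivity
    · rw [div_mul_eq_mul_div, le_div_iff₀ hc0]
      nlinarith
  calc ‖u‖ ≤ C * ‖wgrad u‖ := hC u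
    _ ≤ C * (C / c * ‖A δ σp σm u‖) := by gcongr
    _ = _ := by ring

/-! ### Invertibility -/

theorem A_conj (δ σp σm : ℝ) (u v : H10 (dom δ)) :
    A δ σp σm u v = starRingEnd ℂ (A δ σp σm v u) := by
  rw [A_apply, A_apply, ← integral_conj]
  congr 1
  ext x
  rw [map_mul, Complex.conj_ofReal, inner_conj_symm]

theorem eq_zero_of_A_eq_zero {δ σp σm K : ℝ}
    (h : ∀ u : H10 (dom δ), ‖u‖ ≤ K * ‖A δ σp σm u‖) (u : H10 (dom δ))
    (hu : A δ σp σm u = 0) : u = 0 := by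
  have := h u
  rw [hu, ContinuousLinearMap.opNorm_zero, mul_zero] at this
  exact norm_le_zero_iff.1 this

/-- A Hermitian sesquilinear form on a Hilbert space that is bounded below induces an invertible
operator to the space of continuous antilinear forms. -/
theorem _root_.ContinuousLinearMap.isInvertible_of_hermitian_of_bound {H : Type*}
    [NormedAddCommGroup H] [InnerProductSpace ℂ H] [CompleteSpace H] {T : H →L[ℂ] H →L⋆[ℂ] ℂ}
    (hT : ∀ u v, T u v = starRingEnd ℂ (T v u)) {K : ℝ} (h : ∀ u, ‖u‖ ≤ K * ‖T u‖) :
    T.IsInvertible := by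
  have hinj : ∀ u : H, T u = 0 → u = 0 := fun u hu => by
    have := h u
    rw [hu, norm_zero, mul_zero] at this
    exact norm_le_zero_iff.1 this
  set B : H →L[ℂ] H :=
    InnerProductSpace.continuousLinearMapOfBilin T.flip with hB
  have hBA : ∀ u v : H, inner ℂ (B u) v = T v u := fun u v =>
    InnerProductSpace.continuousLinearMapOfBilin_apply _ u v
  have hAB : ∀ u : H, ‖T u‖ ≤ ‖B u‖ := fun u => by
    refine ContinuousLinearMap.opNorm_le_bound _ (norm_nonneg _) fun v => ?_
    rw [hT, Complex.norm_conj, ← hBA]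
    exact norm_inner_le_norm (𝕜 := ℂ) (B u) v
  have hbd : ∀ u : H, ‖u‖ ≤ |K| * ‖B u‖ := fun u =>
    calc ‖u‖ ≤ K * ‖T u‖ := h u
      _ ≤ |K| * ‖T u‖ := mul_le_mul_of_nonneg_right (le_abs_self K)
          (ContinuousLinearMap.opNorm_nonneg _)
      _ ≤ |K| * ‖B u‖ := mul_le_mul_of_nonneg_left (hAB u) (abs_nonneg K)
  have hanti : AntilipschitzWith ⟨|K|, abs_nonneg K⟩ B := B.antilipschitz_of_bound hbd
  have hclosed : IsClosed (LinearMap.range B.toLinearMap : Set H) :=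
    hanti.isClosed_range B.uniformContinuous
  -- If `z` is orthogonal to the range, then `T z v = ⟨B v, z⟩ = 0` for all `v`, so `z = 0` by
  -- injectivity. The range is thus dense, and it is closed.
  have hrange : LinearMap.range B.toLinearMap = ⊤ := by
    rw [← hclosed.submodule_topologicalClosure_eq, Submodule.topologicalClosure_eq_top_iff,
      Submodule.eq_bot_iff]
    intro z hz
    refine hinj z (ContinuousLinearMap.ext fun v => ?_)
    have := (Submodule.mem_orthogonal _ _).1 hz (B v) ⟨v, rfl⟩
    rw [hBA] at this
    exact this
  have hsurj : Function.Surjective T := by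
    intro ℓ
    -- Riesz representation applies to linear functionals, so the antilinear `ℓ` is conjugated
    -- first.
    let ℓ' : H →L[ℂ] ℂ :=
      (((starₗᵢ ℂ : ℂ ≃ₗᵢ⋆[ℂ] ℂ).toContinuousLinearEquiv : ℂ →L⋆[ℂ] ℂ)).comp ℓ
    obtain ⟨y, hy⟩ : (InnerProductSpace.toDual ℂ H).symm ℓ' ∈
        LinearMap.range B.toLinearMap := by
      rw [hrange]
      trivial
    refine ⟨y, ContinuousLinearMap.ext fun v => ?_⟩
    have h1 : inner ℂ (B y) v = ℓ' v := by
      have hy' : B y = (InnerProductSpace.toDual ℂ H).symm ℓ' := hy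
      rw [hy', InnerProductSpace.toDual_symm_apply]
    rw [hT, ← hBA, h1]
    exact Complex.conj_conj (ℓ v)
  refine ⟨ContinuousLinearEquiv.ofBijective T (LinearMap.ker_eq_bot'.2 hinj)
    (LinearMap.range_eq_top.2 hsurj), ContinuousLinearEquiv.coe_ofBijective _ _ _⟩

theorem isInvertible_A {δ σp σm K : ℝ} (h : ∀ u : H10 (dom δ), ‖u‖ ≤ K * ‖A δ σp σm u‖) :
    (A δ σp σm).IsInvertible :=
  ContinuousLinearMap.isInvertible_of_hermitian_of_bound (A_conj δ σp σm) h

/-! ### The kernel at a resonance -/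

/-- The kernel element is `sin(μ_k s)` times the glued lift. Against a mode of the same frequency
with profile `x` the form is a multiple of `conj x(π/4)` times the resonance expression; other
frequencies are orthogonal, and density concludes. -/
theorem exists_ne_zero_A_eq_zero {δ : ℝ} (hδ : δ ∈ Ioo (0 : ℝ) 1) {σp σm : ℝ} {k : ℕ}
    (hk : 1 ≤ k) (h : σm * energyL (freq δ k) + σp * energyR (freq δ k) = 0) :
    ∃ u : H10 (dom δ), u ≠ 0 ∧ A δ σp σm u = 0 := by
  have hpi := Real.pi_pos
  have hμ := freq_pos hδ hk
  have hlog : Real.log δ < 0 := Real.log_neg hδ.1 hδ.2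
  have hφ := isAngular_lift hμ
  obtain ⟨u, hu⟩ := exists_isMode hδ k hφ
  set μ := freq δ k with hμdef
  have eL : ∀ {x x' : ℝ → ℂ}, IsAngular x x' → energy μ 0 (Real.pi / 4)
      (glue (liftL μ) (liftR μ)) (glue (liftL' μ) (liftR' μ)) x x' =
      starRingEnd ℂ (x (Real.pi / 4)) * energyL μ := by
    intro x x' hx
    rw [energy_congr (y := x) (y' := x') (by linarith) (fun _ => glue_of_mem_left)
      (fun _ => glue_of_mem_left) (fun _ _ => rfl) (fun _ _ => rfl), energy_conj,
      energy_liftL μ hx.toIsPair hx.deriv_left hx.left, map_mul, Complex.conj_ofReal]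
  have eR : ∀ {x x' : ℝ → ℂ}, IsAngular x x' → energy μ (Real.pi / 4) Real.pi
      (glue (liftL μ) (liftR μ)) (glue (liftL' μ) (liftR' μ)) x x' =
      starRingEnd ℂ (x (Real.pi / 4)) * energyR μ := by
    intro x x' hx
    rw [energy_congr (y := x) (y' := x') (by linarith) (fun _ => glue_of_mem_right)
      (fun _ => glue_of_mem_right) (fun _ _ => rfl) (fun _ _ => rfl), energy_conj,
      energy_liftR μ hx.toIsPair hx.deriv_right hx.right, map_mul, Complex.conj_ofReal]
  refine ⟨u, ?_, ?_⟩
  · rintro rfl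
    have e := form_of_isMode hδ 1 1 hk hk hφ.toIsPair hφ.toIsPair hu hu
    rw [← hμdef, eL hφ, eR hφ, form_eq_A, map_zero, if_pos rfl, glue, if_pos le_rfl,
      liftL_quarter_pi hμ, map_one, eq_comm] at e
    have e' : ((-Real.log δ / 2 * (energyL μ + energyR μ) : ℝ) : ℂ) = 0 := by
      rw [show (0 : ℂ) = _ from e.symm]
      push_cast
      ring
    have := energyL_pos hμ
    have := energyR_pos hμ
    have : 0 < -Real.log δ / 2 * (energyL μ + energyR μ) :=
      mul_pos (by linarith) (by linarith)
    exact this.ne' (Complex.ofReal_eq_zero.1 e')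
  · have hle : (⨆ l : ℕ, modeSpace hδ (l + 1)) ≤ LinearMap.ker (A δ σp σm u).toLinearMap := by
      refine iSup_le fun l v hv => ?_
      rw [LinearMap.mem_ker]
      change form δ σp σm u v = 0
      obtain ⟨x, x', hx, hv⟩ := hv
      rw [form_of_isMode hδ σp σm hk (Nat.le_add_left 1 l) hφ.toIsPair hx.toIsPair hu hv,
        ← hμdef, eL hx, eR hx]
      have h' : (σm : ℂ) * energyL μ + σp * energyR μ = 0 := by exact_mod_cast h
      linear_combination ((if k = l + 1 then -Real.log δ / 2 else 0 : ℝ) : ℂ) *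
        starRingEnd ℂ (x (Real.pi / 4)) * h'
    have hcl := Submodule.topologicalClosure_minimal _ hle (A δ σp σm u).isClosed_ker
    rw [dense_iSup_modeSpace hδ] at hcl
    exact ContinuousLinearMap.ext fun v => hcl (Submodule.mem_top (x := v))

/-! ### The resonance condition -/

/-- For `a = μπ/4`, the identities `sinh 3a = sinh a (2 cosh 2a + 1)` and `cosh 3a = cosh a (2 cosh
2a - 1)` give the ratio of `coth 3a` to `coth a`. -/
theorem energyR_mul_eq {μ : ℝ} (hμ : 0 < μ) :
    energyR μ * (2 * Real.cosh (μ * (Real.pi / 2)) + 1) =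
      energyL μ * (2 * Real.cosh (μ * (Real.pi / 2)) - 1) := by
  have hpi := Real.pi_pos
  have hs := Real.sinh_pos_iff.2 (by positivity : 0 < μ * (Real.pi / 4))
  rw [energyR, energyL, show μ * (Real.pi - Real.pi / 4) = 3 * (μ * (Real.pi / 4)) by ring,
    show μ * (Real.pi / 2) = 2 * (μ * (Real.pi / 4)) by ring, Real.sinh_three_mul,
    Real.cosh_three_mul, Real.cosh_two_mul]
  set s := Real.sinh (μ * (Real.pi / 4))
  set c := Real.cosh (μ * (Real.pi / 4))
  have hcs : c ^ 2 = s ^ 2 + 1 := Real.cosh_sq _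
  have h3 : 4 * s ^ 3 + 3 * s ≠ 0 := by positivity
  rw [div_mul_eq_mul_div, div_mul_eq_mul_div, div_eq_div_iff h3 hs.ne']
  linear_combination (8 * μ * c * s * (c ^ 2 + s ^ 2)) * hcs

theorem resonance_mul_eq {μ : ℝ} (hμ : 0 < μ) (σp σm : ℝ) :
    (σm * energyL μ + σp * energyR μ) * (2 * Real.cosh (μ * (Real.pi / 2)) + 1) =
      energyL μ * (2 * Real.cosh (μ * (Real.pi / 2)) * (σp + σm) - (σp - σm)) := by
  linear_combination σp * energyR_mul_eq hμ

theorem resonance_iff {μ : ℝ} (hμ : 0 < μ) (σp σm : ℝ) :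
    σm * energyL μ + σp * energyR μ = 0 ↔
      2 * Real.cosh (μ * (Real.pi / 2)) * (σp + σm) - (σp - σm) = 0 := by
  have h1 := (energyL_pos hμ).ne'
  have h2 : 2 * Real.cosh (μ * (Real.pi / 2)) + 1 ≠ 0 := by
    have := Real.cosh_pos (μ * (Real.pi / 2))
    positivity
  rw [← mul_eq_zero_iff_right h2, resonance_mul_eq hμ, mul_eq_zero_iff_left h1]

theorem exists_pos_le_of_tendsto {r : ℕ → ℝ} (hr : ∀ k, 0 < r k) {l : ℝ} (hl : 0 < l)
    (h : Tendsto r atTop (𝓝 l)) : ∃ c, 0 < c ∧ ∀ k, c ≤ r k := by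
  obtain ⟨B, hB⟩ := (h.inv₀ hl.ne').bddAbove_range
  have hB' : ∀ k, (r k)⁻¹ ≤ B := fun k => hB ⟨k, rfl⟩
  have hB0 : 0 < B := (inv_pos.2 (hr 0)).trans_le (hB' 0)
  exact ⟨B⁻¹, inv_pos.2 hB0, fun k => inv_le_of_inv_le₀ (hr k) (hB' k)⟩

theorem tendsto_cosh_freq {δ : ℝ} (hδ : δ ∈ Ioo (0 : ℝ) 1) :
    Tendsto (fun k : ℕ => Real.cosh (freq δ (k + 1) * (Real.pi / 2))) atTop atTop := by
  have hl : 0 < -Real.log δ := by linarith [Real.log_neg hδ.1 hδ.2]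
  have hpi := Real.pi_pos
  have h1 : Tendsto (fun k : ℕ => (Real.pi / -Real.log δ * (Real.pi / 2) / 2) * (k : ℝ))
      atTop atTop :=
    tendsto_natCast_atTop_atTop.const_mul_atTop (by positivity)
  refine tendsto_atTop_mono (fun k => ?_) h1
  have e : freq δ (k + 1) * (Real.pi / 2) =
      (Real.pi / -Real.log δ * (Real.pi / 2)) * (k + 1) := by
    rw [freq]
    push_cast
    ring
  have h2 := Real.add_one_le_exp (freq δ (k + 1) * (Real.pi / 2))
  have h3 := Real.exp_pos (-(freq δ (k + 1) * (Real.pi / 2)))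
  have h4 : 0 < Real.pi / -Real.log δ * (Real.pi / 2) := by positivity
  rw [Real.cosh_eq]
  nlinarith

/-- The ratio of the two sides is positive for each `k` by non-resonance and tends to `|σ₊ + σ₋| / 2
> 0`, hence is bounded away from zero. -/
theorem exists_coercivity_const {δ : ℝ} (hδ : δ ∈ Ioo (0 : ℝ) 1) {σp σm : ℝ} (hp : 0 < σp)
    (hm : σm < 0) (hs : σp + σm ≠ 0)
    (h : ∀ k : ℕ, 1 ≤ k → σm * energyL (freq δ k) + σp * energyR (freq δ k) ≠ 0) :
    ∃ c, 0 < c ∧ c ≤ σp ∧ c ≤ -σm ∧ ∀ k : ℕ, 1 ≤ k →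
      c * (energyL (freq δ k) + energyR (freq δ k)) ≤
        |σm * energyL (freq δ k) + σp * energyR (freq δ k)| := by
  set C : ℕ → ℝ := fun k => Real.cosh (freq δ (k + 1) * (Real.pi / 2)) with hC
  -- This is `|σ₋ E_L + σ₊ E_R| / (E_L + E_R)`, with `E_R` eliminated by `energyR_mul_eq`.
  set r : ℕ → ℝ := fun k => |(σp + σm) / 2 - (σp - σm) / 4 * (C k)⁻¹| with hr
  have hC0 : ∀ k, 0 < C k := fun k => Real.cosh_pos _
  have hμ : ∀ k : ℕ, 0 < freq δ (k + 1) := fun k => freq_pos hδ (Nat.le_add_left 1 k)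
  have e1 : ∀ k, (σp + σm) / 2 - (σp - σm) / 4 * (C k)⁻¹ =
      (2 * C k * (σp + σm) - (σp - σm)) / (4 * C k) := by
    intro k
    have := (hC0 k).ne'
    field_simp
    ring
  have hpos : ∀ k, 0 < r k := by
    intro k
    rw [hr]
    simp only [abs_pos, e1]
    refine div_ne_zero ?_ (by have := hC0 k; positivity)
    exact fun h0 => h (k + 1) (Nat.le_add_left 1 k) ((resonance_iff (hμ k) σp σm).2 h0)
  have hlim : Tendsto r atTop (𝓝 |(σp + σm) / 2|) := by
    have h1 := (tendsto_inv_atTop_zero.comp (tendsto_cosh_freq hδ)).const_mul ((σp - σm) / 4)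
    rw [mul_zero] at h1
    have h2 := (h1.const_sub ((σp + σm) / 2)).abs
    rw [sub_zero] at h2
    exact h2
  obtain ⟨c, hc0, hc⟩ := exists_pos_le_of_tendsto hpos
    (abs_pos.2 (div_ne_zero hs two_ne_zero)) hlim
  refine ⟨min c (min σp (-σm)), lt_min hc0 (lt_min hp (by linarith)),
    (min_le_right _ _).trans (min_le_left _ _), (min_le_right _ _).trans (min_le_right _ _), ?_⟩
  intro k hk
  obtain ⟨k, rfl⟩ := Nat.exists_eq_add_of_le' hk
  have hL := energyL_pos (hμ k)
  have hR := energyR_pos (hμ k)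
  have hCk := hC0 k
  refine (mul_le_mul_of_nonneg_right (min_le_left _ _) (by positivity)).trans ?_
  have hD : 0 < 2 * C k + 1 := by positivity
  rw [← mul_le_mul_iff_left₀ hD]
  have e2 := congrArg abs (resonance_mul_eq (hμ k) σp σm)
  rw [abs_mul, abs_mul, abs_of_pos hL] at e2
  have e3 : |2 * Real.cosh (freq δ (k + 1) * (Real.pi / 2)) + 1| = 2 * C k + 1 := abs_of_pos hD
  rw [e3] at e2
  have e4 : |2 * Real.cosh (freq δ (k + 1) * (Real.pi / 2)) * (σp + σm) - (σp - σm)| =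
      4 * C k * r k := by
    rw [hr]
    simp only [e1]
    rw [abs_div, abs_of_pos (by positivity : 0 < 4 * C k)]
    exact (mul_div_cancel₀ _ (by positivity : 4 * C k ≠ 0)).symm
  rw [e4] at e2
  rw [e2]
  have e5 := energyR_mul_eq (hμ k)
  have e6 : c * (energyL (freq δ (k + 1)) + energyR (freq δ (k + 1))) * (2 * C k + 1) =
      energyL (freq δ (k + 1)) * (4 * C k * c) := by
    linear_combination c * e5
  rw [e6]
  have := hc k
  gcongr

theorem exists_norm_le_norm_A_of_nonresonant {δ : ℝ} (hδ : δ ∈ Ioo (0 : ℝ) 1) {σp σm : ℝ}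
    (hp : 0 < σp) (hm : σm < 0) (hs : σp + σm ≠ 0)
    (h : ∀ k : ℕ, 1 ≤ k → σm * energyL (freq δ k) + σp * energyR (freq δ k) ≠ 0) :
    ∃ K : ℝ, 0 < K ∧ ∀ u : H10 (dom δ), ‖u‖ ≤ K * ‖A δ σp σm u‖ := by
  obtain ⟨c, hc0, h1, h2, h3⟩ := exists_coercivity_const hδ hp hm hs h
  exact exists_norm_le_norm_A hδ hc0 h1 h2 h3

/-! ### Critical radii -/

/-- Once `1 + κ > 0`, the inequality is equivalent to `κ < -1/3`. It makes the `arcosh` positive, so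
the critical radii are well defined. -/
theorem one_lt_of_mem_Ioo {κ : ℝ} (hκ : κ ∈ Ioo (-1 : ℝ) (-1 / 3)) :
    1 < (1 - κ) / (2 * (1 + κ)) := by
  have h1 := hκ.1
  have h2 := hκ.2
  rw [lt_div_iff₀ (by linarith)]
  linarith

theorem eq_critDelta_iff {δ κ : ℝ} (hδ : δ ∈ Ioo (0 : ℝ) 1) (hκ : κ ∈ Ioo (-1 : ℝ) (-1 / 3))
    {k : ℕ} (hk : 1 ≤ k) :
    δ = critDelta κ k ↔ Real.cosh (freq δ k * (Real.pi / 2)) = (1 - κ) / (2 * (1 + κ)) := by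
  have hX := one_lt_of_mem_Ioo hκ
  have hpi := Real.pi_pos
  have ha := Real.arcosh_pos hX
  have hl : 0 < -Real.log δ := by linarith [Real.log_neg hδ.1 hδ.2]
  have hμ := freq_pos hδ hk
  rw [critDelta]
  set X := (1 - κ) / (2 * (1 + κ)) with hXdef
  have e1 : Real.cosh (freq δ k * (Real.pi / 2)) = X ↔
      freq δ k * (Real.pi / 2) = Real.arcosh X := by
    constructor
    · intro h
      rw [← h, Real.arcosh_cosh (by positivity)]
    · intro h
      rw [h, Real.cosh_arcosh hX.le]
  have e2 : δ = Real.exp (-(k * Real.pi ^ 2 / (2 * Real.arcosh X))) ↔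
      -Real.log δ = k * Real.pi ^ 2 / (2 * Real.arcosh X) := by
    constructor
    · intro h
      conv_lhs => rw [h, Real.log_exp, neg_neg]
    · intro h
      rw [← h, neg_neg, Real.exp_log hδ.1]
  rw [e1, e2, freq, eq_div_iff (by positivity), div_mul_eq_mul_div, div_eq_iff hl.ne']
  constructor <;> intro h <;> linarith

theorem critDelta_mem_Ioo {κ : ℝ} (hκ : κ ∈ Ioo (-1 : ℝ) (-1 / 3)) {n : ℕ} (hn : 1 ≤ n) :
    critDelta κ n ∈ Ioo (0 : ℝ) 1 := by
  have ha := Real.arcosh_pos (one_lt_of_mem_Ioo hκ)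
  have hpi := Real.pi_pos
  have : (0 : ℝ) < n := by exact_mod_cast hn
  refine ⟨Real.exp_pos _, Real.exp_lt_one_iff.2 (neg_neg_of_pos ?_)⟩
  positivity

theorem tendsto_critDelta {κ : ℝ} (hκ : κ ∈ Ioo (-1 : ℝ) (-1 / 3)) :
    Tendsto (critDelta κ) atTop (𝓝 0) := by
  have ha := Real.arcosh_pos (one_lt_of_mem_Ioo hκ)
  have hpi := Real.pi_pos
  refine Real.tendsto_exp_atBot.comp (tendsto_neg_atTop_atBot.comp ?_)
  exact (tendsto_natCast_atTop_atTop.atTop_mul_const (by positivity)).atTop_div_const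
    (by positivity)

theorem resonance_iff_eq_critDelta {δ σp σm : ℝ} (hδ : δ ∈ Ioo (0 : ℝ) 1) (hp : 0 < σp)
    (hκ : σm / σp ∈ Ioo (-1 : ℝ) (-1 / 3)) {k : ℕ} (hk : 1 ≤ k) :
    σm * energyL (freq δ k) + σp * energyR (freq δ k) = 0 ↔ δ = critDelta (σm / σp) k := by
  rw [eq_critDelta_iff hδ hκ hk, resonance_iff (freq_pos hδ hk)]
  have hs : 0 < σp + σm := by
    have := (lt_div_iff₀ hp).1 hκ.1
    linarith
  have e : (1 - σm / σp) / (2 * (1 + σm / σp)) = (σp - σm) / (2 * (σp + σm)) := by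
    have : 1 + σm / σp ≠ 0 := by linarith [hκ.1]
    field_simp
  rw [e, eq_div_iff (by positivity)]
  constructor <;> intro h <;> linarith

/-- For `κ < -1` the left side of `2 cosh(μπ/2) (σ₊ + σ₋) = σ₊ - σ₋` is negative and the right side
positive. For `κ > -1/3` already `2 (σ₊ + σ₋) > σ₊ - σ₋`, and `cosh > 1` only enlarges the left
side. -/
theorem not_resonance_of_notMem_Icc {μ σp σm : ℝ} (hμ : 0 < μ) (hp : 0 < σp)
    (hκ : σm / σp ∉ Icc (-1 : ℝ) (-1 / 3)) : σm * energyL μ + σp * energyR μ ≠ 0 := by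
  rw [Ne, resonance_iff hμ]
  have hC : 1 < Real.cosh (μ * (Real.pi / 2)) :=
    Real.one_lt_cosh.2 (mul_pos hμ (by linarith [Real.pi_pos])).ne'
  rw [mem_Icc, not_and_or, not_le, not_le, div_lt_iff₀ hp, lt_div_iff₀ hp] at hκ
  rcases hκ with h | h
  · nlinarith
  · nlinarith

end HalfAnnulus

end

/-! ### The spectral dichotomy -/

theorem mainTheorem9 (σp σm : ℝ) (hp : 0 < σp) (hm : σm < 0) :
    (σm / σp ∈ Ioo (-1 : ℝ) (-1 / 3) →
      (∀ n : ℕ, 1 ≤ n → HalfAnnulus.critDelta (σm / σp) n ∈ Ioo (0 : ℝ) 1) ∧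
      Tendsto (HalfAnnulus.critDelta (σm / σp)) atTop (𝓝 0) ∧
      ∀ δ ∈ Ioo (0 : ℝ) 1,
        ((∃ u : HalfAnnulus.H10 (HalfAnnulus.dom δ), u ≠ 0 ∧ HalfAnnulus.A δ σp σm u = 0) ↔
          ∃ n : ℕ, 1 ≤ n ∧ δ = HalfAnnulus.critDelta (σm / σp) n) ∧
        ((HalfAnnulus.A δ σp σm).IsInvertible ↔
          ¬ ∃ n : ℕ, 1 ≤ n ∧ δ = HalfAnnulus.critDelta (σm / σp) n)) ∧
    (σm / σp ∉ Icc (-1 : ℝ) (-1 / 3) →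
      ∀ δ ∈ Ioo (0 : ℝ) 1, Function.Injective (HalfAnnulus.A δ σp σm)) := by
  refine ⟨fun hκ => ⟨fun n hn => HalfAnnulus.critDelta_mem_Ioo hκ hn,
    HalfAnnulus.tendsto_critDelta hκ, fun δ hδ => ?_⟩, fun hκ δ hδ => ?_⟩
  · have hs : σp + σm ≠ 0 := by
      have := (lt_div_iff₀ hp).1 hκ.1
      linarith
    have bound : (¬ ∃ n : ℕ, 1 ≤ n ∧ δ = HalfAnnulus.critDelta (σm / σp) n) →
        ∃ K : ℝ, 0 < K ∧ ∀ u : HalfAnnulus.H10 (HalfAnnulus.dom δ),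
          ‖u‖ ≤ K * ‖HalfAnnulus.A δ σp σm u‖ := fun h =>
      HalfAnnulus.exists_norm_le_norm_A_of_nonresonant hδ hp hm hs fun k hk h0 =>
        h ⟨k, hk, (HalfAnnulus.resonance_iff_eq_critDelta hδ hp hκ hk).1 h0⟩
    have kernel : (∃ n : ℕ, 1 ≤ n ∧ δ = HalfAnnulus.critDelta (σm / σp) n) →
        ∃ u : HalfAnnulus.H10 (HalfAnnulus.dom δ), u ≠ 0 ∧ HalfAnnulus.A δ σp σm u = 0 := by
      rintro ⟨n, hn, h⟩
      exact HalfAnnulus.exists_ne_zero_A_eq_zero hδ hn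
        ((HalfAnnulus.resonance_iff_eq_critDelta hδ hp hκ hn).2 h)
    refine ⟨⟨?_, kernel⟩, ⟨?_, ?_⟩⟩
    · rintro ⟨u, hu, hAu⟩
      by_contra h
      obtain ⟨K, -, hK⟩ := bound h
      exact hu (HalfAnnulus.eq_zero_of_A_eq_zero hK u hAu)
    · rintro ⟨e, he⟩ h
      obtain ⟨u, hu, hAu⟩ := kernel h
      refine hu (e.injective ?_)
      rw [map_zero, ← hAu, ← he]
      rfl
    · intro h
      obtain ⟨K, -, hK⟩ := bound h
      exact HalfAnnulus.isInvertible_A hK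
  · have hs : σp + σm ≠ 0 := by
      intro h
      refine hκ ⟨?_, ?_⟩
      · rw [le_div_iff₀ hp]
        linarith
      · rw [div_le_iff₀ hp]
        linarith
    obtain ⟨K, -, hK⟩ := HalfAnnulus.exists_norm_le_norm_A_of_nonresonant hδ hp hm hs
      fun k hk => HalfAnnulus.not_resonance_of_notMem_Icc (HalfAnnulus.freq_pos hδ hk) hp hκ
    exact (injective_iff_map_eq_zero _).2 (HalfAnnulus.eq_zero_of_A_eq_zero hK)
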